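/- Let $\mathbf a=(a_1,a_2,a_3)$ and put $$g_2=4\Big(\frac{a_1^2}{3}-a_2\Big),\qquad g_3=4\Big(\frac{a_1a_2}{3}-\frac{2a_1^3}{27}-a_3\Big),\qquad Q(t)=1-a_1t^2+a_2t^4-a_3t^6 .$$ Let $\wp(z;g_2,g_3)=z^{-2}+\cdots$ be the Weierstrass function with $(\wp')^2=4\wp^3-g_2\wp-g_3$ (if $g_2^3=27g_3^2$, then $\wp=-(\log\sigma)''$ for the degenerate Weierstrass $\sigma$-function). Where the $a_i$ are elements of a $\mathbb Q$-algebra $R$, $\wp$ means its formal Laurent expansion at $z=0$, and roots of series with constant term $1$ are taken with constant term $1$. Let $F(u,v)$ be a commutative one-dimensional formal group with logarithm $g$, and let $\overline u$ be the inverse of $u$. The modulus square of $F$ is the two-valued law $$x*y=[F(u,v)F(\overline u,\overline v),\;F(u,\overline v)F(\overline u,v)],\qquad x=u\overline u,\quad y=v\overline v,$$ and its logarithm is the series $B$ with $B(u\overline u)=g(u)g(\overline u)$; its exponential is the series $B^{-1}$ inverse to $B$ under composition. Let $\mathcal G_{\mathbf a}$ be the two-valued formal group in which $x*y$ consists of the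 roots $z$ of $$(x+y+z-a_2xyz)^2-4(1+a_3xyz)(xy+yz+xz+a_1xyz)=0 .$$ **(i)** Let $u=I(x)=\int_0^{\sqrt x}\frac{dt}{\sqrt{1+a_1t^2+a_2t^4+a_3t^6}}$. Then $x(u)=\dfrac{1}{\wp(u;g_2,g_3)-a_1/3}$. This holds for formal series over every $\mathbb Q$-algebra, and for complex $a_i$ as an identity of functions for small $\sqrt x\ne0$. **(ii)** Over every $\mathbb Q$-algebra, the two-valued formal group $\mathcal G_{\mathbf a}$ has exactly one logarithm $B$; the logarithm and the exponential are $$B(x)=I(x)^2=\left(\int_0^{\sqrt x}\frac{dt}{\sqrt{1+a_1t^2+a_2t^4+a_3t^6}}\right)^2,\qquad B^{-1}(x)=\frac1{\wp(\sqrt x;g_2,g_3)-a_1/3}.$$ **(iii)** Over every $\mathbb Q$-algebra, the series $$F_{\mathrm{Bc}}(u,v)=\left[\left(\frac{u\sqrt{Q(v)}-v\sqrt{Q(u)}}{u^2-v^2}\right)^2+a_3u^2v^2\right]^{-1/2}=u+v+\cdots$$ is a commutative formal group law with exponential and logarithm $$f_{\mathrm{Bc}}(u)=\frac1{\sqrt{\wp(u;g_2,-g_3)+a_1/3}}=u+\cdots,\qquad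 g_{\mathrm{Bc}}(u)=\int_0^u\frac{dt}{\sqrt{1-a_1t^2+a_2t^4-a_3t^6}}.$$ **(iv)** Over $\mathbb Z[\tfrac12,a_1,a_2,a_3]$, the series $F_{\mathrm{Bc}}$ is a commutative formal group law with $\overline u=-u$ whose modulus square is $\mathcal G_{\mathbf a}$, and it is universal with this property: if $S$ is a commutative ring in which $2$ is invertible, $\mathbf b\in S^3$, and $H$ is a commutative formal group over $S$ with $\overline u=-u$ whose modulus square is $\mathcal G_{\mathbf b}$, then there is exactly one ring homomorphism $\varphi:\mathbb Z[\tfrac12,a_1,a_2,a_3]\to S$ with $\varphi_*F_{\mathrm{Bc}}=H$, and $\varphi(a_i)=b_i$ for $i=1,2,3$. **(v)** Let $R$ be a $\mathbb Q$-algebra, and let $\mathcal F$ be the class of formal groups over $R$ of the form $$\mathcal F(u,v)=\frac{u^2\lambda_1(v)-v^2\lambda_1(u)}{u\lambda_2(v)-v\lambda_2(u)},\qquad \lambda_1,\lambda_2\in R[[t]],\quad \lambda_2(0)\ \text{invertible}.$$ For $\mathbf a\in R^3$ the law $F_{\mathrm{Bc}}$ belongs to $\mathcal F$ if and only if $a_3=0$.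 A formal group over $R$ belongs both to $\mathcal F$ and to the class of the laws $F_{\mathrm{Bc}}$ (for some parameters in $R$) if and only if it is the formal group of the Ochanine genus for some $\delta,\varepsilon\in R$, that is, its logarithm is $\int_0^u\frac{dt}{\sqrt{1-2\delta t^2+\varepsilon t^4}}$. Equivalently, it is of the form $\mathcal F(u,v)$ with $\lambda_1\equiv1$; and also equivalently, it is $F_{\mathrm{Bc}}$ for some parameters with $a_3=0$. -/

import Mathlib

open Filter Topology

universe u

noncomputable section

namespace BuchstaberGenus

/-! ### Square roots, integrals and inverses of formal series -/

/-- The formal power series `h ^ (-1/2)`, for `h` with constant term `1` over a ring in which `2` is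
invertible. It is the binomial series `(1 + X) ^ (-1/2) = ∑ₙ C(2n, n) (-1/4)ⁿ Xⁿ` evaluated at
`X = h - 1`. -/
def invSqrt {R : Type u} [CommRing R] {σ : Type} (h : MvPowerSeries σ R) : MvPowerSeries σ R :=
  PowerSeries.subst (h - 1)
    (PowerSeries.mk fun n => (Nat.centralBinom n : R) * (-(Ring.inverse (4 : R))) ^ n)

/-- The formal power series `√h = h · h ^ (-1/2)`, for `h` with constant term `1`. -/
def sqrtSeries {R : Type u} [CommRing R] {σ : Type} (h : MvPowerSeries σ R) : MvPowerSeries σ R :=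
  h * invSqrt h

/-- The formal integral `∫₀ᵘ h(t) dt`. -/
def formalIntegral {R : Type u} [CommRing R] [Algebra ℚ R] (h : PowerSeries R) : PowerSeries R :=
  PowerSeries.mk fun n => ((n : ℚ)⁻¹) • PowerSeries.coeff (n - 1) h

/-- `f` and `g` are series without constant term that are inverse to each other under
composition. -/
def AreCompInverse {R : Type u} [CommRing R] (f g : PowerSeries R) : Prop :=
  PowerSeries.constantCoeff f = 0 ∧ PowerSeries.constantCoeff g = 0 ∧
    f.subst g = (PowerSeries.X : PowerSeries R) ∧ g.subst f = (PowerSeries.X : PowerSeries R)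

/-- The polynomial `1 + b₁ t² + b₂ t⁴ + b₃ t⁶`, as a power series in `t`. -/
def evenSextic {R : Type u} [CommRing R] (b₁ b₂ b₃ : R) : PowerSeries R :=
  1 + PowerSeries.C b₁ * PowerSeries.X ^ 2 + PowerSeries.C b₂ * PowerSeries.X ^ 4
    + PowerSeries.C b₃ * PowerSeries.X ^ 6

/-- `∫₀ˢ dt / √(1 + b₁ t² + b₂ t⁴ + b₃ t⁶)` as a formal power series in `s`. -/
def abelianIntegral {R : Type u} [CommRing R] [Algebra ℚ R] (b₁ b₂ b₃ : R) : PowerSeries R :=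
  formalIntegral (invSqrt (evenSextic b₁ b₂ b₃))

/-! ### The Weierstrass function -/

/-- The coefficients `c_k` of the Laurent expansion
`℘(z; g₂, g₃) = z⁻² + ∑_{k ≥ 2} c_k z ^ (2k - 2)`:
`c₂ = g₂ / 20`, `c₃ = g₃ / 28` and
`c_k = 3 / ((2k + 1)(k - 3)) · ∑_{m = 2}^{k - 2} c_m c_{k - m}` for `k ≥ 4`. -/
def wpCoeff {R : Type u} [CommRing R] [Algebra ℚ R] (g₂ g₃ : R) : ℕ → R
  | 0 => 0
  | 1 => 0
  | 2 => (1 / 20 : ℚ) • g₂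
  | 3 => (1 / 28 : ℚ) • g₃
  | n + 4 => (3 / ((2 * (n : ℚ) + 9) * ((n : ℚ) + 1))) •
      ∑ i : Fin (n + 1), wpCoeff g₂ g₃ (i.1 + 2) * wpCoeff g₂ g₃ (n - i.1 + 2)
  termination_by n => n
  decreasing_by all_goals omega

/-- The Laurent series of `℘(z; g₂, g₃)` at `z = 0`, with coefficients in the `ℚ`-algebra that
contains `g₂` and `g₃` (which may be degenerate, `g₂³ = 27 g₃²`). -/
def wpSeries {R : Type u} [CommRing R] [Algebra ℚ R] (g₂ g₃ : R) : LaurentSeries R :=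
  HahnSeries.single (-2 : ℤ) (1 : R) +
    HahnSeries.ofPowerSeries ℤ R
      (PowerSeries.mk fun n => if Even n then wpCoeff g₂ g₃ (n / 2 + 1) else 0)

/-- The Weierstrass sigma function of the degenerate invariants `g₂ = 4k⁴/3`, `g₃ = -8k⁶/27`. -/
def degenerateSigma (k z : ℂ) : ℂ :=
  if k = 0 then z else Complex.sinh (k * z) / k * Complex.exp (-(k ^ 2 * z ^ 2) / 6)

/-- The complex function `p` is the Weierstrass function `℘( · ; g₂, g₃)`: either the one of a period
lattice with invariants `g₂, g₃`, or, if `g₂³ = 27 g₃²`, the degenerate one `-(log σ)''`. (All pairs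
with `g₂³ = 27 g₃²` have the form `g₂ = 4k⁴/3`, `g₃ = -8k⁶/27`.) -/
def IsWeierstrassP (g₂ g₃ : ℂ) (p : ℂ → ℂ) : Prop :=
  (∃ L : PeriodPair, L.g₂ = g₂ ∧ L.g₃ = g₃ ∧ p = L.weierstrassP) ∨
  (∃ k : ℂ, g₂ = 4 * k ^ 4 / 3 ∧ g₃ = -8 * k ^ 6 / 27 ∧
    p = fun z => -deriv (logDeriv (degenerateSigma k)) z)

/-- `g₂ = 4 (a₁²/3 - a₂)`. -/
def invariant₂ {R : Type u} [CommRing R] [Algebra ℚ R] (a₁ a₂ : R) : R :=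
  4 * ((1 / 3 : ℚ) • a₁ ^ 2 - a₂)

/-- `g₃ = 4 (a₁a₂/3 - 2a₁³/27 - a₃)`. -/
def invariant₃ {R : Type u} [CommRing R] [Algebra ℚ R] (a₁ a₂ a₃ : R) : R :=
  4 * ((1 / 3 : ℚ) • (a₁ * a₂) - (2 / 27 : ℚ) • a₁ ^ 3 - a₃)

/-! ### Formal groups -/

/-- The variable `u` (or `x`) of `R⟦u, v⟧`. -/
abbrev varU (R : Type u) [CommRing R] : MvPowerSeries (Fin 2) R := MvPowerSeries.X 0

/-- The variable `v` (or `y`) of `R⟦u, v⟧`. -/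
abbrev varV (R : Type u) [CommRing R] : MvPowerSeries (Fin 2) R := MvPowerSeries.X 1

/-- The series `h(u)`. -/
abbrev atU {R : Type u} [CommRing R] (h : PowerSeries R) : MvPowerSeries (Fin 2) R :=
  h.subst (varU R)

/-- The series `h(v)`. -/
abbrev atV {R : Type u} [CommRing R] (h : PowerSeries R) : MvPowerSeries (Fin 2) R :=
  h.subst (varV R)

/-- `i(u) = ū` is the inverse of `u` in the formal group `F`. -/
def IsFormalInverse {R : Type u} [CommRing R] (F : FormalGroup R) (i : PowerSeries R) : Prop :=
  PowerSeries.constantCoeff i = 0 ∧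
    F.toPowerSeries.subst ![(PowerSeries.X : PowerSeries R), i] = (0 : PowerSeries R)

/-- `f` is the exponential of `F`: `f(u) = u + ⋯` and `F(f(u), f(v)) = f(u + v)`. -/
def IsExponential {R : Type u} [CommRing R] (F : FormalGroup R) (f : PowerSeries R) : Prop :=
  PowerSeries.constantCoeff f = 0 ∧ PowerSeries.coeff 1 f = 1 ∧
    F.toPowerSeries.subst ![atU f, atV f] = f.subst (varU R + varV R)

/-- `g` is the logarithm of `F`: `g(u) = u + ⋯` and `g(F(u, v)) = g(u) + g(v)`. -/
def IsLogarithm {R : Type u} [CommRing R] (F : FormalGroup R) (g : PowerSeries R) : Prop :=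
  PowerSeries.constantCoeff g = 0 ∧ PowerSeries.coeff 1 g = 1 ∧
    g.subst F.toPowerSeries = atU g + atV g

/-! ### Two-valued laws -/

/-- A two-valued law `x * y = [z₁, z₂]`, where `z₁, z₂` are the roots of `z² - Ψ₁(x, y) z + Ψ₂(x, y)`. -/
structure TwoValuedLaw (R : Type u) [CommRing R] where
  Ψ₁ : MvPowerSeries (Fin 2) R
  Ψ₂ : MvPowerSeries (Fin 2) R

/-- `G` is the modulus square of the formal group `F` with inverse `ū = i(u)`: for `x = uū` and
`y = vv̄` one has `x * y = [F(u, v)F(ū, v̄), F(u, v̄)F(ū, v)]`. -/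
def IsModulusSquareWith {R : Type u} [CommRing R] (F : FormalGroup R) (i : PowerSeries R)
    (G : TwoValuedLaw R) : Prop :=
  let z₁ := F.toPowerSeries.subst ![varU R, varV R] * F.toPowerSeries.subst ![atU i, atV i]
  let z₂ := F.toPowerSeries.subst ![varU R, atV i] * F.toPowerSeries.subst ![atU i, varV R]
  G.Ψ₁.subst ![varU R * atU i, varV R * atV i] = z₁ + z₂ ∧
    G.Ψ₂.subst ![varU R * atU i, varV R * atV i] = z₁ * z₂

/-- `G` is the modulus square of the formal group `F`. -/
def IsModulusSquare {R : Type u} [CommRing R] (F : FormalGroup R) (G : TwoValuedLaw R) : Prop :=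
  ∃ i : PowerSeries R, IsFormalInverse F i ∧ IsModulusSquareWith F i G

/-- `B` is a logarithm of the two-valued law `G`: `G` is the modulus square of a commutative formal
group with logarithm `g`, and `B(uū) = g(u) g(ū)`. -/
def IsTwoValuedLogarithm {R : Type u} [CommRing R] (G : TwoValuedLaw R) (B : PowerSeries R) : Prop :=
  ∃ (F : FormalGroup R) (i g : PowerSeries R), F.IsComm ∧ IsFormalInverse F i ∧
    IsModulusSquareWith F i G ∧ IsLogarithm F g ∧
    B.subst ((PowerSeries.X : PowerSeries R) * i) = g * g.subst i

/-- The polynomial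
`(x + y + z - a₂xyz)² - 4(1 + a₃xyz)(xy + yz + xz + a₁xyz)` in `z` over `R⟦x, y⟧`. -/
def buchstaberPolynomial {R : Type u} [CommRing R] (a₁ a₂ a₃ : R) :
    Polynomial (MvPowerSeries (Fin 2) R) :=
  let x : Polynomial (MvPowerSeries (Fin 2) R) := Polynomial.C (varU R)
  let y : Polynomial (MvPowerSeries (Fin 2) R) := Polynomial.C (varV R)
  let z : Polynomial (MvPowerSeries (Fin 2) R) := Polynomial.X
  let k : R → Polynomial (MvPowerSeries (Fin 2) R) :=
    fun r => Polynomial.C (MvPowerSeries.C r)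
  (x + y + z - k a₂ * x * y * z) ^ 2
    - 4 * (1 + k a₃ * x * y * z) * (x * y + y * z + x * z + k a₁ * x * y * z)

/-- Buchstaber's two-valued formal group: its law is given by the roots `z` of
`buchstaberPolynomial`, whose degree in `z` is two and whose leading coefficient is a series with
constant term `1`. -/
def buchstaberTwoValued {R : Type u} [CommRing R] (a₁ a₂ a₃ : R) : TwoValuedLaw R where
  Ψ₁ := -(buchstaberPolynomial a₁ a₂ a₃).coeff 1
    * MvPowerSeries.invOfUnit ((buchstaberPolynomial a₁ a₂ a₃).coeff 2) 1
  Ψ₂ := (buchstaberPolynomial a₁ a₂ a₃).coeff 0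
    * MvPowerSeries.invOfUnit ((buchstaberPolynomial a₁ a₂ a₃).coeff 2) 1

/-! ### The formal group law and the two classes -/

/-- The quotient `(u s(v) - v s(u)) / (u - v)`: if `s(t) = ∑ sₙ tⁿ`, then it equals
`s₀ - ∑_{i, j ≥ 1} s_{i+j} uⁱ vʲ`. -/
def crossQuotient {R : Type u} [CommRing R] (s : PowerSeries R) : MvPowerSeries (Fin 2) R :=
  fun m => if m = 0 then PowerSeries.coeff 0 s
    else if 1 ≤ m 0 ∧ 1 ≤ m 1 then -PowerSeries.coeff (m 0 + m 1) s else 0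

/-- `Q(t) = 1 - a₁t² + a₂t⁴ - a₃t⁶`. -/
def seriesQ {R : Type u} [CommRing R] (a₁ a₂ a₃ : R) : PowerSeries R :=
  evenSextic (-a₁) a₂ (-a₃)

/-- The law
`F(u, v) = [((u√Q(v) - v√Q(u)) / (u² - v²))² + a₃u²v²] ^ (-1/2)`. The series in brackets is
`(u + v)⁻²` times the series `((u√Q(v) - v√Q(u)) / (u - v))² + a₃u²v²(u + v)²` with constant term `1`,
and the branch of the root is the one with `F(u, v) = u + v + ⋯`. -/
def lawBc {R : Type u} [CommRing R] (a₁ a₂ a₃ : R) : MvPowerSeries (Fin 2) R :=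
  (varU R + varV R) *
    invSqrt (crossQuotient (sqrtSeries (seriesQ a₁ a₂ a₃)) ^ 2
      + MvPowerSeries.C a₃ * varU R ^ 2 * varV R ^ 2 * (varU R + varV R) ^ 2)

/-- `F(u, v) = (u² l₁(v) - v² l₁(u)) / (u l₂(v) - v l₂(u))`. -/
def HasFractionForm {R : Type u} [CommRing R] (F : MvPowerSeries (Fin 2) R)
    (l₁ l₂ : PowerSeries R) : Prop :=
  F * (varU R * atV l₂ - varV R * atU l₂) = varU R ^ 2 * atV l₁ - varV R ^ 2 * atU l₁

/-- The class of the laws `(u² l₁(v) - v² l₁(u)) / (u l₂(v) - v l₂(u))`, where `l₂(0)` is invertible,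
so that the denominator is `u - v` times an invertible series. -/
def InKricheverClass {R : Type u} [CommRing R] (F : MvPowerSeries (Fin 2) R) : Prop :=
  ∃ l₁ l₂ : PowerSeries R, IsUnit (PowerSeries.constantCoeff l₂) ∧ HasFractionForm F l₁ l₂

/-- The formal group `F` is the one of the Ochanine (elliptic) genus with parameters `δ, ε`: its
logarithm is `∫₀ᵘ dt / √(1 - 2δt² + εt⁴)`. -/
def IsOchanine {R : Type u} [CommRing R] [Algebra ℚ R] (F : FormalGroup R) (δ ε : R) : Prop :=
  IsLogarithm F (abelianIntegral (-2 * δ) ε 0)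

/-- The ring `ℤ[1/2, a₁, a₂, a₃]`. -/
abbrev ParameterRing : Type := MvPolynomial (Fin 3) (Localization.Away (2 : ℤ))

end BuchstaberGenus

end

open BuchstaberGenus

namespace BuchstaberGenus

/-! ### The chain rule and substitution in two variables -/

section ChainRule

variable {R : Type*} [CommRing R] {σ τ : Type*}

/-! The law comes from a differential equation. Let f be the inverse of g = ∫ dt/√Q, so f'² = Q(f).
Put Φ(u, v) = F_Bc(f(u), f(v)). The derivation ∂/∂u − ∂/∂v kills Φ: after clearing denominators this
is a polynomial identity in f and f' at the two points, since f'² and f'' are polynomials in f.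
Hence Φ depends on u + v only, and v = 0 gives Φ = f(u + v) (`lawBc_subst_exponential`). Over a
ℚ-algebra F_Bc is therefore the group law with logarithm g; over ℤ[1/2, a₁, a₂, a₃] the axioms are
inherited from ℚ[a₁, a₂, a₃].

For the Weierstrass form, let s invert ∫ dt/√P with P = 1 + a₁t² + a₂t⁴ + a₃t⁶. Then 1/s² + a₁/3
satisfies the equation of ℘, the shift removing the quadratic term of the cubic, and this equation
with leading term z⁻² fixes every coefficient (`eq_wpReduced`, `inverse_sq_mul_wpSeries`). For
complex functions, uniqueness comes from comparing orders of vanishing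
(`eventually_eq_zero_of_mul_deriv`).

If ū = −u, the roots of the two-valued law are −F(u, v)² and −F(u, −v)² at x = −u², y = −v². For
F_Bc both squares have explicit denominators, whose sum and product no longer contain square roots
and are the coefficients of the quadratic (`lawBc_sq_add_sq`, `lawBc_sq_mul_sq`). Conversely, if H
has the same sum and product of squares, then (H² − F(u, v)²)(H² − F(u, −v)²) = 0, and linear terms
decide which of the four factors vanishes (`eq_lawBc_of_isModulusSquare`). As the coefficients of
the quadratic recover the parameters, universality follows.

For uniqueness of the two-valued logarithm, take any group with the given modulus square, with
exponential f, and set φ(U) = f(U)f(−U). The sum of the roots gives an addition formula for φ(U + V)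
+ φ(U − V); its second V-derivative at V = 0 is a second-order equation determining φ. Since B(φ(U))
= −U², B is determined too.

For the class of fractions, the expansion to second order in v expresses λ₁ and λ₂ through S =
∂F/∂v(u, 0), up to terms that cancel in the fraction. With S = √Q, comparison with the formula for
F_Bc² forces a₃ = 0; with λ₁ = 1, it forces S² to be 1 + αt² + βt⁴. -/

theorem derivation_aeval [Fintype σ] {A : Type*} [CommRing A] [Algebra R A] (D : Derivation R A A)
    (a : σ → A) (p : MvPolynomial σ R) :
    D (MvPolynomial.aeval a p) =
      ∑ j, MvPolynomial.aeval a (MvPolynomial.pderiv j p) * D (a j) := by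
  classical
  induction p using MvPolynomial.induction_on with
  | C r => simp
  | add p q hp hq => simp [hp, hq, add_mul, Finset.sum_add_distrib]
  | mul_X p k hp =>
    simp only [map_mul, MvPolynomial.aeval_X, Derivation.leibniz, hp, smul_eq_mul,
      MvPolynomial.pderiv_X, map_add, add_mul, Finset.sum_add_distrib]
    congr 1
    · rw [Finset.sum_eq_single k]
      · simp
      · intro j _ hj
        simp [hj]
      · simp
    · rw [Finset.mul_sum]
      exact Finset.sum_congr rfl fun j _ => by ring

open scoped MvPowerSeries.WithPiTopology in
theorem continuous_pderiv [TopologicalSpace R] [IsTopologicalRing R] (k : σ) :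
    Continuous (MvPowerSeries.pderiv R k) := by
  refine continuous_pi fun d => ?_
  have : (fun f : MvPowerSeries σ R => (MvPowerSeries.pderiv R k f) d) =
      fun f => MvPowerSeries.coeff (d + Finsupp.single k 1) f * ((d k : R) + 1) :=
    funext fun f => MvPowerSeries.coeff_pderiv f d
  rw [this]
  exact (MvPowerSeries.WithPiTopology.continuous_coeff R _).mul continuous_const

open scoped MvPowerSeries.WithPiTopology in
-- For the discrete topology on `R` both sides are continuous in `f`, and polynomials, where the
-- rule is algebraic, are dense.
theorem pderiv_subst [Fintype σ] {a : σ → MvPowerSeries τ R} (ha : MvPowerSeries.HasSubst a)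
    (f : MvPowerSeries σ R) (i : τ) :
    MvPowerSeries.pderiv R i (f.subst a) =
      ∑ j, (MvPowerSeries.pderiv R j f).subst a * MvPowerSeries.pderiv R i (a j) := by
  let : UniformSpace R := ⊥
  have : DiscreteUniformity R := ⟨rfl⟩
  have hs := MvPowerSeries.continuous_subst (R := R) ha
  have hl : Continuous fun f : MvPowerSeries σ R => MvPowerSeries.pderiv R i (f.subst a) :=
    (continuous_pderiv i).comp hs
  have hr : Continuous fun f : MvPowerSeries σ R =>
      ∑ j, (MvPowerSeries.pderiv R j f).subst a * MvPowerSeries.pderiv R i (a j) :=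
    continuous_finsetSum _ fun j _ => (hs.comp (continuous_pderiv j)).mul continuous_const
  refine congrFun (MvPowerSeries.WithPiTopology.denseRange_toMvPowerSeries.equalizer hl hr ?_) f
  funext p
  simp only [Function.comp]
  rw [MvPowerSeries.subst_coe, derivation_aeval]
  refine Finset.sum_congr rfl fun j _ => ?_
  rw [MvPowerSeries.pderiv_coe, MvPowerSeries.subst_coe]

theorem hasSubst_pair {f g : MvPowerSeries τ R} (hf : MvPowerSeries.constantCoeff f = 0)
    (hg : MvPowerSeries.constantCoeff g = 0) : MvPowerSeries.HasSubst ![f, g] :=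
  MvPowerSeries.hasSubst_of_constantCoeff_zero fun s => by fin_cases s <;> simpa

theorem pderiv_subst_pair {f g : MvPowerSeries τ R} (hf : MvPowerSeries.constantCoeff f = 0)
    (hg : MvPowerSeries.constantCoeff g = 0) (F : MvPowerSeries (Fin 2) R) (i : τ) :
    MvPowerSeries.pderiv R i (F.subst ![f, g]) =
      (MvPowerSeries.pderiv R 0 F).subst ![f, g] * MvPowerSeries.pderiv R i f +
      (MvPowerSeries.pderiv R 1 F).subst ![f, g] * MvPowerSeries.pderiv R i g := by
  simp [pderiv_subst (hasSubst_pair hf hg)]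

theorem pderiv_powerSeries_subst {f : MvPowerSeries τ R} (hf : MvPowerSeries.constantCoeff f = 0)
    (h : PowerSeries R) (i : τ) :
    MvPowerSeries.pderiv R i (h.subst f) =
      (PowerSeries.derivative R h).subst f * MvPowerSeries.pderiv R i f := by
  have := pderiv_subst (PowerSeries.HasSubst.of_constantCoeff_zero hf).const h i
  simpa [PowerSeries.subst, PowerSeries.derivative] using this

theorem subst_pair_subst {υ : Type*} {f g : MvPowerSeries τ R}
    (hf : MvPowerSeries.constantCoeff f = 0)
    (hg : MvPowerSeries.constantCoeff g = 0) (F : MvPowerSeries (Fin 2) R)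
    {c : τ → MvPowerSeries υ R} (hc : MvPowerSeries.HasSubst c) :
    (F.subst ![f, g]).subst c = F.subst ![f.subst c, g.subst c] := by
  rw [MvPowerSeries.subst_comp_subst_apply (hasSubst_pair hf hg) hc]
  congr 1
  funext s
  fin_cases s <;> rfl

theorem powerSeries_subst_subst {υ : Type*} {f : MvPowerSeries τ R}
    (hf : MvPowerSeries.constantCoeff f = 0) (h : PowerSeries R)
    {c : τ → MvPowerSeries υ R} (hc : MvPowerSeries.HasSubst c) :
    (h.subst f).subst c = h.subst (f.subst c) :=
  MvPowerSeries.subst_comp_subst_apply (PowerSeries.HasSubst.of_constantCoeff_zero hf).const hc h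

end ChainRule

/-! ### Square roots of series -/

section InvSqrt

/-- The recurrence of the central binomial coefficients says c'(1 − 4X) = 2c, so c²(1 − 4X) has
derivative zero. Working over ℤ lets the identity be transported to every ring. -/
theorem centralBinom_series_sq :
    (PowerSeries.mk fun n => (Nat.centralBinom n : ℤ)) ^ 2 *
      (1 - 4 * (PowerSeries.X : PowerSeries ℤ)) = 1 := by
  set c : PowerSeries ℤ := PowerSeries.mk fun n => (Nat.centralBinom n : ℤ) with hc
  have hd : PowerSeries.derivative ℤ c * (1 - 4 * PowerSeries.X) = 2 * c := by
    have h4 : (4 : PowerSeries ℤ) = PowerSeries.C 4 := by simp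
    have h2 : (2 : PowerSeries ℤ) = PowerSeries.C 2 := by simp
    ext n
    rw [mul_sub, mul_one, h4, h2, ← mul_assoc, mul_comm _ (PowerSeries.C (4 : ℤ)), mul_assoc,
      map_sub, PowerSeries.coeff_C_mul, PowerSeries.coeff_C_mul, PowerSeries.coeff_derivative]
    have hrec := Nat.succ_mul_centralBinom_succ n
    cases n with
    | zero => simp [hc, Nat.centralBinom]
    | succ n =>
      rw [PowerSeries.coeff_succ_mul_X, PowerSeries.coeff_derivative]
      simp only [hc, PowerSeries.coeff_mk]
      zify at hrec
      push_cast
      linear_combination hrec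
  apply PowerSeries.derivative.ext
  · have h4 : PowerSeries.derivative ℤ (4 : PowerSeries ℤ) = 0 := by
      have : (4 : PowerSeries ℤ) = PowerSeries.C 4 := by simp
      rw [this, PowerSeries.derivative_C]
    simp only [Derivation.leibniz, Derivation.leibniz_pow, map_sub, PowerSeries.derivative_X, h4,
      Derivation.map_one_eq_zero, smul_eq_mul, nsmul_eq_mul]
    push_cast
    linear_combination 2 * c * hd
  · simp [hc]

variable {R : Type u} [CommRing R] {σ : Type}

/-- The integral identity is mapped to `R` and X is replaced by −X/4; invertibility of 2 is what
gives `Ring.inverse 4` its meaning. -/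
theorem binomial_series_sq (h2 : IsUnit (2 : R)) :
    (PowerSeries.mk fun n => (Nat.centralBinom n : R) * (-(Ring.inverse (4 : R))) ^ n) ^ 2 *
      (1 + PowerSeries.X) = 1 := by
  have h4 : IsUnit (4 : R) := by
    have : (4 : R) = 2 * 2 := by norm_num
    rw [this]
    exact h2.mul h2
  have h := congrArg (fun p => PowerSeries.rescale (-(Ring.inverse (4 : R)))
    (PowerSeries.map (Int.castRingHom R) p)) centralBinom_series_sq
  simp only [map_mul, map_pow, map_sub, map_one, PowerSeries.map_X, map_ofNat,
    PowerSeries.rescale_X] at h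
  have e : (PowerSeries.rescale (-(Ring.inverse (4 : R)))) (PowerSeries.map (Int.castRingHom R)
      (PowerSeries.mk fun n => (Nat.centralBinom n : ℤ))) =
      PowerSeries.mk fun n => (Nat.centralBinom n : R) * (-(Ring.inverse (4 : R))) ^ n := by
    ext n
    simp [PowerSeries.coeff_rescale, mul_comm]
  rw [e] at h
  have h4' : (4 : PowerSeries R) * PowerSeries.C (-(Ring.inverse (4 : R))) = -1 := by
    have : (4 : PowerSeries R) = PowerSeries.C 4 := (map_ofNat PowerSeries.C 4).symm
    rw [this, ← map_mul, mul_neg, Ring.mul_inverse_cancel _ h4, map_neg, map_one]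
  rw [← mul_assoc, h4', neg_one_mul, sub_neg_eq_add] at h
  exact h

theorem hasSubst_sub_one {h : MvPowerSeries σ R} (hh : MvPowerSeries.constantCoeff h = 1) :
    PowerSeries.HasSubst (h - 1) :=
  PowerSeries.HasSubst.of_constantCoeff_zero (by simp [hh])

theorem invSqrt_sq_mul (h2 : IsUnit (2 : R)) {h : MvPowerSeries σ R}
    (hh : MvPowerSeries.constantCoeff h = 1) : invSqrt h ^ 2 * h = 1 := by
  have hs := hasSubst_sub_one hh
  have := congrArg (PowerSeries.substAlgHom (R := R) hs) (binomial_series_sq h2)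
  simp only [map_mul, map_pow, map_add, map_one, PowerSeries.substAlgHom_X] at this
  rw [PowerSeries.coe_substAlgHom] at this
  rw [add_sub_cancel] at this
  exact this

theorem constantCoeff_invSqrt {h : MvPowerSeries σ R}
    (hh : MvPowerSeries.constantCoeff h = 1) :
    MvPowerSeries.constantCoeff (invSqrt h) = 1 := by
  have hs := hasSubst_sub_one hh
  rw [invSqrt]
  set b := PowerSeries.mk fun n => (Nat.centralBinom n : R) * (-(Ring.inverse (4 : R))) ^ n
    with hb
  have h1 := PowerSeries.constantCoeff_subst_eq_zero (a := h - 1) (by simp [hh]) (b - 1)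
    (by simp [hb])
  rw [PowerSeries.subst_sub hs, ← PowerSeries.coe_substAlgHom hs, map_one, map_sub, map_one,
    PowerSeries.coe_substAlgHom, sub_eq_zero] at h1
  exact h1

theorem isUnit_of_constantCoeff {τ : Type*} {k : MvPowerSeries τ R}
    (hk : IsUnit (MvPowerSeries.constantCoeff k)) : IsUnit k :=
  MvPowerSeries.isUnit_iff_constantCoeff.mpr hk

/-- The factor k + l of k² − l² has constant term 2, hence is a unit, whatever zero divisors `R`
has. -/
theorem eq_of_sq_eq_sq {τ : Type*} (h2 : IsUnit (2 : R)) {k l : MvPowerSeries τ R}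
    (hk : MvPowerSeries.constantCoeff k = 1) (hl : MvPowerSeries.constantCoeff l = 1)
    (h : k ^ 2 = l ^ 2) : k = l := by
  have hu : IsUnit (k + l) := isUnit_of_constantCoeff (by
    rw [map_add, hk, hl, one_add_one_eq_two]; exact h2)
  have : (k + l) * (k - l) = 0 := by linear_combination h
  exact sub_eq_zero.mp ((hu.mul_right_eq_zero).mp this)

/-- This characterisation by a polynomial equation is what makes the root commute with substitutions
and ring homomorphisms, with no look at coefficients. -/
theorem eq_invSqrt (h2 : IsUnit (2 : R)) {h k : MvPowerSeries σ R}
    (hk : MvPowerSeries.constantCoeff k = 1) (hkh : k ^ 2 * h = 1) : k = invSqrt h := by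
  have hh : MvPowerSeries.constantCoeff h = 1 := by
    have := congrArg MvPowerSeries.constantCoeff hkh
    simpa [hk] using this
  refine eq_of_sq_eq_sq h2 hk (constantCoeff_invSqrt hh) ?_
  linear_combination (-k ^ 2) * invSqrt_sq_mul h2 hh + invSqrt h ^ 2 * hkh

theorem invSqrt_subst (h2 : IsUnit (2 : R)) {τ : Type} {h : MvPowerSeries σ R}
    (hh : MvPowerSeries.constantCoeff h = 1) {a : σ → MvPowerSeries τ R}
    (ha : MvPowerSeries.HasSubst a)
    (ha0 : ∀ i, MvPowerSeries.constantCoeff (a i) = 0) :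
    (invSqrt h).subst a = invSqrt (h.subst a) := by
  refine eq_invSqrt h2 ?_ ?_
  · have := MvPowerSeries.constantCoeff_subst_eq_zero ha ha0 (f := invSqrt h - 1)
      (by simp [constantCoeff_invSqrt hh])
    rw [MvPowerSeries.subst_sub ha, ← MvPowerSeries.coe_substAlgHom ha, map_one, map_sub, map_one,
      MvPowerSeries.coe_substAlgHom, sub_eq_zero] at this
    exact this
  · have := congrArg (MvPowerSeries.substAlgHom (R := R) ha) (invSqrt_sq_mul h2 hh)
    simp only [map_mul, map_pow, map_one] at this
    simpa only [MvPowerSeries.coe_substAlgHom] using this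

theorem map_invSqrt {S : Type*} [CommRing S] (h2 : IsUnit (2 : R)) (φ : R →+* S)
    {h : MvPowerSeries σ R} (hh : MvPowerSeries.constantCoeff h = 1) :
    MvPowerSeries.map φ (invSqrt h) = invSqrt (MvPowerSeries.map φ h) := by
  refine eq_invSqrt (by have := h2.map φ; rwa [map_ofNat] at this) ?_ ?_
  · rw [MvPowerSeries.constantCoeff_map, constantCoeff_invSqrt hh, map_one]
  · rw [← map_pow, ← map_mul, invSqrt_sq_mul h2 hh, map_one]

theorem sqrtSeries_sq (h2 : IsUnit (2 : R)) {h : MvPowerSeries σ R}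
    (hh : MvPowerSeries.constantCoeff h = 1) : sqrtSeries h ^ 2 = h := by
  rw [sqrtSeries]
  linear_combination h * invSqrt_sq_mul h2 hh

theorem constantCoeff_sqrtSeries {h : MvPowerSeries σ R}
    (hh : MvPowerSeries.constantCoeff h = 1) :
    MvPowerSeries.constantCoeff (sqrtSeries h) = 1 := by
  rw [sqrtSeries, map_mul, hh, constantCoeff_invSqrt hh, one_mul]

theorem invSqrt_mul_sqrtSeries (h2 : IsUnit (2 : R)) {h : MvPowerSeries σ R}
    (hh : MvPowerSeries.constantCoeff h = 1) : invSqrt h * sqrtSeries h = 1 := by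
  rw [sqrtSeries]
  linear_combination invSqrt_sq_mul h2 hh

theorem map_sqrtSeries {S : Type*} [CommRing S] (h2 : IsUnit (2 : R)) (φ : R →+* S)
    {h : MvPowerSeries σ R} (hh : MvPowerSeries.constantCoeff h = 1) :
    MvPowerSeries.map φ (sqrtSeries h) = sqrtSeries (MvPowerSeries.map φ h) := by
  rw [sqrtSeries, sqrtSeries, map_mul, map_invSqrt h2 φ hh]

theorem sqrtSeries_subst (h2 : IsUnit (2 : R)) {τ : Type} {h : MvPowerSeries σ R}
    (hh : MvPowerSeries.constantCoeff h = 1) {a : σ → MvPowerSeries τ R}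
    (ha : MvPowerSeries.HasSubst a)
    (ha0 : ∀ i, MvPowerSeries.constantCoeff (a i) = 0) :
    (sqrtSeries h).subst a = sqrtSeries (h.subst a) := by
  rw [sqrtSeries, sqrtSeries, MvPowerSeries.subst_mul ha, invSqrt_subst h2 hh ha ha0]

end InvSqrt

/-! ### Series in two variables -/

section TwoVariables

variable {R : Type u} [CommRing R]

theorem isUnit_two [Algebra ℚ R] : IsUnit (2 : R) := by
  have := (IsUnit.mk0 (2 : ℚ) (by norm_num)).map (algebraMap ℚ R)
  rwa [map_ofNat] at this

/-- `R` may have zero divisors, so cancellation needs an invertible leading coefficient. Order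
monomials lexicographically, the exponent of `k` first. The coefficient of `a * b` at X_j times the
monomial `e` is the unit times b_e plus contributions of smaller coefficients of `b`, so induction
kills all of them. -/
theorem eq_zero_of_mul_eq_zero_of_isUnit_coeff {j k : Fin 2} (hjk : j ≠ k)
    {a b : MvPowerSeries (Fin 2) R}
    (h0 : MvPowerSeries.constantCoeff a = 0)
    (h1 : IsUnit (MvPowerSeries.coeff (Finsupp.single j 1) a)) (hab : a * b = 0) : b = 0 := by
  classical
  have ext2 : ∀ d e : Fin 2 →₀ ℕ, d j = e j → d k = e k → d = e := by
    intro d e hj hk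
    ext i
    have : i = j ∨ i = k := by omega
    rcases this with rfl | rfl <;> assumption
  have key : ∀ m n : ℕ, ∀ e : Fin 2 →₀ ℕ, e k = m → e j = n →
      MvPowerSeries.coeff e b = 0 := by
    intro m
    induction m using Nat.strong_induction_on with
    | _ m ihm =>
    intro n
    induction n using Nat.strong_induction_on with
    | _ n ihn =>
    intro e hek hej
    have hc := congrArg (MvPowerSeries.coeff (Finsupp.single j 1 + e)) hab
    rw [MvPowerSeries.coeff_mul, map_zero,
      Finset.sum_eq_single_of_mem (Finsupp.single j 1, e) (by simp)] at hc
    · exact (h1.mul_right_eq_zero).mp hc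
    · rintro ⟨p, q⟩ hpq hne
      rw [Finset.HasAntidiagonal.mem_antidiagonal] at hpq
      have hk := DFunLike.congr_fun hpq k
      have hj := DFunLike.congr_fun hpq j
      simp only [Finsupp.add_apply, Finsupp.single_eq_same, Finsupp.single_eq_of_ne hjk.symm]
        at hk hj
      by_cases hqk : q k < m
      · rw [ihm (q k) hqk (q j) q rfl rfl, mul_zero]
      by_cases hqj : q j < n
      · rw [ihn (q j) hqj q (by omega) rfl, mul_zero]
      by_cases hpj : p j = 0
      · have : p = 0 := ext2 _ _ (by simpa using hpj) (by simp; omega)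
        rw [this, MvPowerSeries.coeff_zero_eq_constantCoeff_apply, h0, zero_mul]
      · exfalso
        apply hne
        have hp : p = Finsupp.single j 1 :=
          ext2 _ _ (by simp; omega) (by simp [Finsupp.single_eq_of_ne hjk.symm]; omega)
        have hq : q = e := ext2 _ _ (by omega) (by omega)
        rw [hp, hq]
  ext e
  simpa using key _ _ e rfl rfl

theorem mul_left_cancel_of_isUnit_coeff {j k : Fin 2} (hjk : j ≠ k)
    {a b c : MvPowerSeries (Fin 2) R}
    (h0 : MvPowerSeries.constantCoeff a = 0)
    (h1 : IsUnit (MvPowerSeries.coeff (Finsupp.single j 1) a)) (hab : a * b = a * c) : b = c :=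
  sub_eq_zero.mp (eq_zero_of_mul_eq_zero_of_isUnit_coeff hjk h0 h1 (by rw [mul_sub, hab, sub_self]))

theorem coeff_single_one_X (i j : Fin 2) :
    MvPowerSeries.coeff (Finsupp.single j 1) (MvPowerSeries.X i : MvPowerSeries (Fin 2) R) =
      if i = j then 1 else 0 := by
  rw [MvPowerSeries.coeff_X]
  simp [Finsupp.single_left_inj, eq_comm]

theorem coeff_single_one_eq (F : MvPowerSeries (Fin 2) R) (j : Fin 2) :
    MvPowerSeries.coeff (Finsupp.single j 1) F =
      MvPowerSeries.constantCoeff (MvPowerSeries.pderiv R j F) := by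
  rw [← MvPowerSeries.coeff_zero_eq_constantCoeff_apply, MvPowerSeries.coeff_pderiv]
  simp

theorem varU_sub_varV_cancel {b c : MvPowerSeries (Fin 2) R}
    (h : (varU R - varV R) * b = (varU R - varV R) * c) : b = c :=
  mul_left_cancel_of_isUnit_coeff (j := 0) (k := 1) (by decide) (by simp)
    (by rw [map_sub, coeff_single_one_X, coeff_single_one_X]; simp) h

theorem varU_add_varV_cancel {b c : MvPowerSeries (Fin 2) R}
    (h : (varU R + varV R) * b = (varU R + varV R) * c) : b = c :=
  mul_left_cancel_of_isUnit_coeff (j := 0) (k := 1) (by decide) (by simp)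
    (by rw [map_add, coeff_single_one_X, coeff_single_one_X]; simp) h

theorem varU_cancel {b c : MvPowerSeries (Fin 2) R} (h : varU R * b = varU R * c) : b = c :=
  mul_left_cancel_of_isUnit_coeff (j := 0) (k := 1) (by decide) (by simp)
    (by rw [coeff_single_one_X]; simp) h

theorem varV_cancel {b c : MvPowerSeries (Fin 2) R} (h : varV R * b = varV R * c) : b = c :=
  mul_left_cancel_of_isUnit_coeff (j := 1) (k := 0) (by decide) (by simp)
    (by rw [coeff_single_one_X]; simp) h

theorem sq_sub_sq_cancel {b c : MvPowerSeries (Fin 2) R}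
    (h : (varU R ^ 2 - varV R ^ 2) * b = (varU R ^ 2 - varV R ^ 2) * c) : b = c := by
  refine varU_add_varV_cancel (varU_sub_varV_cancel ?_)
  linear_combination h

theorem varU_sub_varV_mul_crossQuotient (s : PowerSeries R) :
    (varU R - varV R) * crossQuotient s = varU R * atV s - varV R * atU s := by
  classical
  have hX : ∀ (i : Fin 2) (f : MvPowerSeries (Fin 2) R) (m : Fin 2 →₀ ℕ),
      MvPowerSeries.coeff m (MvPowerSeries.X i * f) =
        if m i = 0 then 0 else MvPowerSeries.coeff (m - Finsupp.single i 1) f := by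
    intro i f m
    rw [MvPowerSeries.X, MvPowerSeries.coeff_monomial_mul]
    simp only [one_mul, Finsupp.single_le_iff]
    split_ifs <;> first | rfl | omega
  have hc : ∀ m : Fin 2 →₀ ℕ, MvPowerSeries.coeff m (crossQuotient s) =
      if m = 0 then PowerSeries.coeff 0 s
      else if 1 ≤ m 0 ∧ 1 ≤ m 1 then -PowerSeries.coeff (m 0 + m 1) s else 0 := fun m => rfl
  have ext2 : ∀ d e : Fin 2 →₀ ℕ, d = e ↔ d 0 = e 0 ∧ d 1 = e 1 := by
    intro d e
    refine ⟨fun h => by simp [h], fun ⟨h, h'⟩ => ?_⟩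
    ext i
    fin_cases i <;> assumption
  ext m
  rw [sub_mul, map_sub, map_sub, hX, hX, hX, hX, hc, hc, atU, atV,
    PowerSeries.coeff_subst_single, PowerSeries.coeff_subst_single]
  simp only [ext2, Finsupp.tsub_apply, Finsupp.single_apply, Finsupp.zero_apply]
  generalize m 0 = a
  generalize m 1 = b
  simp
  -- The exponents 0, 1 and ≥ 2 are separated because lowering an exponent by one may reach an axis
  -- or the constant term, where the coefficients of `crossQuotient` follow another rule.
  rcases a with _ | _ | a <;> rcases b with _ | _ | b <;> simp <;> ring_nf

end TwoVariables

/-! ### Restriction to `v = 0` -/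

section AtZero

variable {R : Type u} [CommRing R]

/-- The restriction `M(u, 0)` of a series `M(u, v)`. -/
noncomputable def atZeroV : MvPowerSeries (Fin 2) R →ₐ[R] PowerSeries R :=
  MvPowerSeries.substAlgHom (hasSubst_pair (f := PowerSeries.X) (g := 0)
    PowerSeries.constantCoeff_X (map_zero _))

theorem atZeroV_apply (M : MvPowerSeries (Fin 2) R) :
    atZeroV M = M.subst ![(PowerSeries.X : PowerSeries R), 0] := by
  rw [atZeroV, MvPowerSeries.substAlgHom_apply]

theorem hasSubst_X_zero :
    MvPowerSeries.HasSubst ![(PowerSeries.X : PowerSeries R), 0] :=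
  hasSubst_pair PowerSeries.constantCoeff_X (map_zero _)

@[simp] theorem atZeroV_varU : atZeroV (varU R) = PowerSeries.X := by
  rw [atZeroV_apply, MvPowerSeries.subst_X hasSubst_X_zero]; rfl

@[simp] theorem atZeroV_varV : atZeroV (varV R) = 0 := by
  rw [atZeroV_apply, MvPowerSeries.subst_X hasSubst_X_zero]; rfl

@[simp] theorem atZeroV_C (r : R) : atZeroV (MvPowerSeries.C r) = PowerSeries.C r := by
  rw [atZeroV_apply, MvPowerSeries.subst_C]; rfl

theorem atZeroV_subst_pair {f g : MvPowerSeries (Fin 2) R}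
    (hf : MvPowerSeries.constantCoeff f = 0) (hg : MvPowerSeries.constantCoeff g = 0)
    (F : MvPowerSeries (Fin 2) R) :
    atZeroV (F.subst ![f, g]) = F.subst ![atZeroV f, atZeroV g] := by
  rw [atZeroV_apply, subst_pair_subst hf hg F hasSubst_X_zero, ← atZeroV_apply, ← atZeroV_apply]

theorem atZeroV_subst {f : MvPowerSeries (Fin 2) R}
    (hf : MvPowerSeries.constantCoeff f = 0) (h : PowerSeries R) :
    atZeroV (h.subst f) = h.subst (atZeroV f) := by
  rw [atZeroV_apply, powerSeries_subst_subst hf h hasSubst_X_zero, ← atZeroV_apply]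

theorem powerSeries_subst_zero {τ : Type*} (h : PowerSeries R) :
    h.subst (0 : MvPowerSeries τ R) = MvPowerSeries.C (PowerSeries.constantCoeff h) := by
  rw [PowerSeries.subst_zero_eq_C_constantCoeff, MvPowerSeries.map_C, Algebra.algebraMap_self,
    RingHom.id_apply]

@[simp] theorem atZeroV_atU (h : PowerSeries R) : atZeroV (atU h) = h := by
  rw [atU, atZeroV_subst (by simp), atZeroV_varU, PowerSeries.X_subst]

@[simp] theorem atZeroV_atV (h : PowerSeries R) :
    atZeroV (atV h) = PowerSeries.C (PowerSeries.constantCoeff h) := by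
  rw [atV, atZeroV_subst (by simp), atZeroV_varV, powerSeries_subst_zero]; rfl

theorem coeff_atZeroV (M : MvPowerSeries (Fin 2) R) (n : ℕ) :
    PowerSeries.coeff n (atZeroV M) = MvPowerSeries.coeff (Finsupp.single 0 n) M := by
  rw [atZeroV_apply, PowerSeries.coeff, MvPowerSeries.coeff_subst hasSubst_X_zero,
    finsum_eq_single _ (Finsupp.single 0 n)]
  · simp [PowerSeries.X, MvPowerSeries.coeff_X_pow]
  · intro d hd
    by_cases hd₁ : d 1 = 0
    · have h0 : d 0 ≠ n := by
        intro h
        apply hd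
        ext i
        fin_cases i <;> simp [h, hd₁]
      have : MvPowerSeries.coeff (Finsupp.single () n) (PowerSeries.X ^ d 0 : PowerSeries R) = 0 := by
        have := PowerSeries.coeff_X_pow (R := R) n (d 0)
        rw [if_neg (Ne.symm h0)] at this
        exact this
      simp [Finsupp.prod_fintype, hd₁, this]
    · simp [Finsupp.prod_fintype, hd₁]

theorem pderiv_one_atU (h : PowerSeries R) : MvPowerSeries.pderiv R 1 (atU h) = 0 := by
  rw [atU, pderiv_powerSeries_subst (by simp), MvPowerSeries.pderiv_X_of_ne (by decide), mul_zero]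

theorem pderiv_one_atV (h : PowerSeries R) :
    MvPowerSeries.pderiv R 1 (atV h) = atV (PowerSeries.derivative R h) := by
  rw [atV, pderiv_powerSeries_subst (by simp), MvPowerSeries.pderiv_X_self, mul_one]

theorem pderiv_zero_atU (h : PowerSeries R) :
    MvPowerSeries.pderiv R 0 (atU h) = atU (PowerSeries.derivative R h) := by
  rw [atU, pderiv_powerSeries_subst (by simp), MvPowerSeries.pderiv_X_self, mul_one]

theorem pderiv_zero_atV (h : PowerSeries R) : MvPowerSeries.pderiv R 0 (atV h) = 0 := by
  rw [atV, pderiv_powerSeries_subst (by simp), MvPowerSeries.pderiv_X_of_ne (by decide), mul_zero]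

/-- Integration in v: without torsion, ∂/∂v retains every coefficient with positive exponent of v,
and the restriction to v = 0 supplies the others. -/
theorem eq_of_pderiv_one_eq [Algebra ℚ R] {f g : MvPowerSeries (Fin 2) R}
    (hd : MvPowerSeries.pderiv R 1 f = MvPowerSeries.pderiv R 1 g)
    (h0 : atZeroV f = atZeroV g) : f = g := by
  have : IsAddTorsionFree R := .of_module_rat R
  ext n
  rcases Nat.eq_zero_or_eq_succ_pred (n 1) with h | h
  · have hn : n = Finsupp.single 0 (n 0) := by
      ext i
      fin_cases i <;> simp [h]
    rw [hn, ← coeff_atZeroV, ← coeff_atZeroV, h0]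
  · set k := (n 1).pred
    have hn : n = n - Finsupp.single 1 1 + Finsupp.single 1 1 := by
      ext i
      fin_cases i
      · simp
      · simp; omega
    have e := congrArg (MvPowerSeries.coeff (n - Finsupp.single 1 1)) hd
    rw [MvPowerSeries.coeff_pderiv, MvPowerSeries.coeff_pderiv, ← hn, ← Nat.cast_succ, mul_comm,
      ← nsmul_eq_mul, mul_comm, ← nsmul_eq_mul, smul_right_inj (Nat.succ_ne_zero _)] at e
    exact e

theorem constantCoeff_atU {h : PowerSeries R} (hh : PowerSeries.constantCoeff h = 0) :
    MvPowerSeries.constantCoeff (atU h) = 0 :=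
  PowerSeries.constantCoeff_subst_eq_zero (by simp) _ hh

theorem constantCoeff_atV {h : PowerSeries R} (hh : PowerSeries.constantCoeff h = 0) :
    MvPowerSeries.constantCoeff (atV h) = 0 :=
  PowerSeries.constantCoeff_subst_eq_zero (by simp) _ hh

theorem constantCoeff_subst_of_zero {τ : Type*} {f : MvPowerSeries τ R}
    (hf : MvPowerSeries.constantCoeff f = 0) (h : PowerSeries R) :
    MvPowerSeries.constantCoeff (h.subst f) = PowerSeries.constantCoeff h := by
  have hs := PowerSeries.HasSubst.of_constantCoeff_zero hf
  have h1 := PowerSeries.constantCoeff_subst_eq_zero hf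
    (h - PowerSeries.C (PowerSeries.constantCoeff h)) (by simp)
  rw [PowerSeries.subst_sub hs, PowerSeries.subst_C, map_sub, MvPowerSeries.constantCoeff_C,
    sub_eq_zero] at h1
  exact h1

theorem constantCoeff_subst_pair {τ : Type*} {f g : MvPowerSeries τ R}
    (hf : MvPowerSeries.constantCoeff f = 0) (hg : MvPowerSeries.constantCoeff g = 0)
    (F : MvPowerSeries (Fin 2) R) :
    MvPowerSeries.constantCoeff (F.subst ![f, g]) = MvPowerSeries.constantCoeff F := by
  have hs := hasSubst_pair hf hg
  have h1 := MvPowerSeries.constantCoeff_subst_eq_zero hs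
    (fun i => by fin_cases i <;> simpa) (f := F - MvPowerSeries.C (MvPowerSeries.constantCoeff F))
    (by simp)
  rw [MvPowerSeries.subst_sub hs, MvPowerSeries.subst_C, map_sub, MvPowerSeries.constantCoeff_C,
    sub_eq_zero] at h1
  exact h1

theorem subst_pair_varU {τ : Type*} {f g : MvPowerSeries τ R}
    (hf : MvPowerSeries.constantCoeff f = 0) (hg : MvPowerSeries.constantCoeff g = 0) :
    (varU R).subst ![f, g] = f :=
  MvPowerSeries.subst_X (hasSubst_pair hf hg) 0

theorem subst_pair_varV {τ : Type*} {f g : MvPowerSeries τ R}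
    (hf : MvPowerSeries.constantCoeff f = 0) (hg : MvPowerSeries.constantCoeff g = 0) :
    (varV R).subst ![f, g] = g :=
  MvPowerSeries.subst_X (hasSubst_pair hf hg) 1

theorem subst_pair_atU {τ : Type*} {f g : MvPowerSeries τ R}
    (hf : MvPowerSeries.constantCoeff f = 0) (hg : MvPowerSeries.constantCoeff g = 0)
    (h : PowerSeries R) : (atU h).subst ![f, g] = h.subst f := by
  rw [atU, powerSeries_subst_subst (by simp) h (hasSubst_pair hf hg), subst_pair_varU hf hg]

theorem subst_pair_atV {τ : Type*} {f g : MvPowerSeries τ R}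
    (hf : MvPowerSeries.constantCoeff f = 0) (hg : MvPowerSeries.constantCoeff g = 0)
    (h : PowerSeries R) : (atV h).subst ![f, g] = h.subst g := by
  rw [atV, powerSeries_subst_subst (by simp) h (hasSubst_pair hf hg), subst_pair_varV hf hg]

theorem subst_pair_varU_varV (F : MvPowerSeries (Fin 2) R) : F.subst ![varU R, varV R] = F := by
  have : ![varU R, varV R] = MvPowerSeries.X := by
    funext i
    fin_cases i <;> rfl
  rw [this, MvPowerSeries.subst_self]
  rfl

end AtZero

/-! ### Compositional inverses and formal integrals -/

section Inverses

variable {R : Type u} [CommRing R]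

theorem exists_areCompInverse {g : PowerSeries R} (h0 : PowerSeries.constantCoeff g = 0)
    (h1 : PowerSeries.coeff 1 g = 1) : ∃ f, AreCompInverse g f := by
  let : Invertible (PowerSeries.coeff 1 g) := by rw [h1]; exact invertibleOne
  exact ⟨g.substInv, h0, PowerSeries.constantCoeff_substInv g,
    PowerSeries.subst_substInv_right g h0, PowerSeries.subst_substInv_left g h0⟩

theorem AreCompInverse.symm {f g : PowerSeries R} (h : AreCompInverse f g) : AreCompInverse g f :=
  ⟨h.2.1, h.1, h.2.2.2, h.2.2.1⟩

theorem AreCompInverse.subst_subst {f g : PowerSeries R} (h : AreCompInverse f g) {τ : Type*}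
    {Z : MvPowerSeries τ R} (hZ : MvPowerSeries.constantCoeff Z = 0) :
    f.subst (g.subst Z) = Z := by
  have hZ' := PowerSeries.HasSubst.of_constantCoeff_zero hZ
  rw [← PowerSeries.subst_comp_subst_apply (PowerSeries.HasSubst.of_constantCoeff_zero' h.2.1) hZ',
    h.2.2.1, PowerSeries.subst_X hZ']

theorem AreCompInverse.coeff_one_mul {f g : PowerSeries R} (h : AreCompInverse f g) :
    PowerSeries.coeff 1 f * PowerSeries.coeff 1 g = 1 := by
  have hg := PowerSeries.HasSubst.of_constantCoeff_zero' h.2.1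
  have := congrArg (fun p => PowerSeries.constantCoeff (PowerSeries.derivative R p)) h.2.2.1
  simp only [PowerSeries.derivative_subst hg, PowerSeries.derivative_X, map_mul, map_one] at this
  have h' : PowerSeries.constantCoeff ((PowerSeries.derivative R f).subst g) =
      PowerSeries.constantCoeff (PowerSeries.derivative R f) :=
    constantCoeff_subst_of_zero h.2.1 _
  rw [h', ← PowerSeries.coeff_zero_eq_constantCoeff_apply,
    ← PowerSeries.coeff_zero_eq_constantCoeff_apply, PowerSeries.coeff_derivative,
    PowerSeries.coeff_derivative] at this
  simpa using this

variable [Algebra ℚ R]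

theorem derivative_formalIntegral (h : PowerSeries R) :
    PowerSeries.derivative R (formalIntegral h) = h := by
  ext n
  rw [PowerSeries.coeff_derivative, formalIntegral, PowerSeries.coeff_mk, Nat.add_sub_cancel,
    Algebra.smul_def, mul_comm, ← mul_assoc]
  have : ((n : R) + 1) * algebraMap ℚ R ((n + 1 : ℕ) : ℚ)⁻¹ = 1 := by
    have e : ((n : R) + 1) = algebraMap ℚ R ((n + 1 : ℕ) : ℚ) := by simp
    rw [e, ← map_mul, mul_inv_cancel₀ (by positivity), map_one]
  rw [this, one_mul]

theorem constantCoeff_formalIntegral (h : PowerSeries R) :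
    PowerSeries.constantCoeff (formalIntegral h) = 0 := by
  -- The convention (0 : ℚ)⁻¹ = 0 is what makes the constant term vanish.
  rw [← PowerSeries.coeff_zero_eq_constantCoeff_apply, formalIntegral, PowerSeries.coeff_mk]
  simp

theorem coeff_one_formalIntegral (h : PowerSeries R) :
    PowerSeries.coeff 1 (formalIntegral h) = PowerSeries.constantCoeff h := by
  simp [formalIntegral]

end Inverses

/-! ### Formal groups and their logarithms -/

section FormalGroups

variable {R : Type u} [CommRing R]

theorem law_subst_pair {f g : PowerSeries R} (hg : PowerSeries.constantCoeff g = 0)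
    {τ : Type*} {A B : MvPowerSeries τ R} (hA : MvPowerSeries.constantCoeff A = 0)
    (hB : MvPowerSeries.constantCoeff B = 0) :
    (f.subst (atU g + atV g)).subst ![A, B] = f.subst (g.subst A + g.subst B) := by
  have hs := hasSubst_pair hA hB
  rw [powerSeries_subst_subst (by rw [map_add, constantCoeff_atU hg, constantCoeff_atV hg, add_zero])
    f hs, MvPowerSeries.subst_add hs, subst_pair_atU hA hB, subst_pair_atV hA hB]

theorem constantCoeff_subst_eq_zero' {τ : Type*} {f : MvPowerSeries τ R} {h : PowerSeries R}
    (hf : MvPowerSeries.constantCoeff f = 0) (hh : PowerSeries.constantCoeff h = 0) :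
    MvPowerSeries.constantCoeff (h.subst f) = 0 :=
  PowerSeries.constantCoeff_subst_eq_zero hf h hh

theorem isLogarithm_toPowerSeries_eq {F : FormalGroup R} {f g : PowerSeries R}
    (hF : IsLogarithm F g) (h : AreCompInverse f g) :
    F.toPowerSeries = f.subst (atU g + atV g) := by
  rw [← hF.2.2, h.subst_subst F.zero_constantCoeff]

theorem isLogarithm_unique {F G : FormalGroup R} {g : PowerSeries R}
    (hF : IsLogarithm F g) (hG : IsLogarithm G g) : F = G := by
  obtain ⟨f, hf⟩ := exists_areCompInverse hF.1 hF.2.1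
  apply FormalGroup.ext
  rw [isLogarithm_toPowerSeries_eq hF hf.symm, isLogarithm_toPowerSeries_eq hG hf.symm]

/-- The law is the additive group transported along g, so its axioms are those of addition. -/
theorem exists_formalGroup_of_log {f g : PowerSeries R} (h : AreCompInverse f g)
    (h1 : PowerSeries.coeff 1 g = 1) :
    ∃ F : FormalGroup R, F.toPowerSeries = f.subst (atU g + atV g) ∧ F.IsComm ∧
      IsLogarithm F g := by
  have hg := h.2.1
  have hf := h.1
  have hsum : MvPowerSeries.constantCoeff (atU g + atV g) = 0 := by
    rw [map_add, constantCoeff_atU hg, constantCoeff_atV hg, add_zero]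
  have hf1 : PowerSeries.coeff 1 f = 1 := by simpa [h1] using h.coeff_one_mul
  have hc : MvPowerSeries.constantCoeff (f.subst (atU g + atV g)) = 0 :=
    constantCoeff_subst_eq_zero' hsum hf
  have hd : ∀ p : PowerSeries R, PowerSeries.constantCoeff (PowerSeries.derivative R p) =
      PowerSeries.coeff 1 p := by
    intro p
    rw [← PowerSeries.coeff_zero_eq_constantCoeff_apply, PowerSeries.coeff_derivative]
    simp
  let F : FormalGroup R :=
    { toPowerSeries := f.subst (atU g + atV g)
      zero_constantCoeff := hc
      lin_coeff_X := by
        rw [coeff_single_one_eq, pderiv_powerSeries_subst hsum, map_add, pderiv_zero_atU,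
          pderiv_zero_atV, add_zero, map_mul, constantCoeff_subst_of_zero hsum,
          constantCoeff_subst_of_zero (by simp), hd, hd, h1, hf1, one_mul]
      lin_coeff_Y := by
        rw [coeff_single_one_eq, pderiv_powerSeries_subst hsum, map_add, pderiv_one_atU,
          pderiv_one_atV, zero_add, map_mul, constantCoeff_subst_of_zero hsum,
          constantCoeff_subst_of_zero (by simp), hd, hd, h1, hf1, one_mul]
      assoc := by
        have hX : ∀ i : Fin 3, MvPowerSeries.constantCoeff (MvPowerSeries.X i :
          MvPowerSeries (Fin 3) R) = 0 := fun i => by simp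
        have hgX : ∀ i : Fin 3, MvPowerSeries.constantCoeff (g.subst (MvPowerSeries.X i :
          MvPowerSeries (Fin 3) R)) = 0 := fun i => constantCoeff_subst_eq_zero' (hX i) hg
        have hgg : ∀ i j : Fin 3, MvPowerSeries.constantCoeff (g.subst (MvPowerSeries.X i :
          MvPowerSeries (Fin 3) R) + g.subst (MvPowerSeries.X j :
          MvPowerSeries (Fin 3) R)) = 0 := fun i j => by rw [map_add, hgX, hgX, add_zero]
        rw [law_subst_pair hg (hX 0) (hX 1), law_subst_pair hg (hX 1) (hX 2),
          law_subst_pair hg (constantCoeff_subst_eq_zero' (hgg _ _) hf) (hX 2),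
          law_subst_pair hg (hX 0) (constantCoeff_subst_eq_zero' (hgg _ _) hf),
          h.symm.subst_subst (hgg _ _), h.symm.subst_subst (hgg _ _), add_assoc] }
  refine ⟨F, rfl, ⟨?_⟩, hg, h1, ?_⟩
  · change f.subst (atU g + atV g) =
      (f.subst (atU g + atV g)).subst ![MvPowerSeries.X 1, MvPowerSeries.X 0]
    rw [law_subst_pair hg (by simp) (by simp), add_comm]
  · exact h.symm.subst_subst hsum

theorem isExponential_of_isLogarithm {F : FormalGroup R} {f g : PowerSeries R}
    (hF : IsLogarithm F g) (h : AreCompInverse f g) : IsExponential F f := by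
  refine ⟨h.1, by simpa [hF.2.1] using h.coeff_one_mul, ?_⟩
  rw [isLogarithm_toPowerSeries_eq hF h, law_subst_pair h.2.1 (constantCoeff_atU h.1)
    (constantCoeff_atV h.1), h.symm.subst_subst (by simp), h.symm.subst_subst (by simp)]

theorem subst_pair_powerSeries_subst {f g : PowerSeries R} (hf : PowerSeries.constantCoeff f = 0)
    (hg : PowerSeries.constantCoeff g = 0) (F : MvPowerSeries (Fin 2) R) {τ : Type*}
    {Z : MvPowerSeries τ R} (hZ : MvPowerSeries.constantCoeff Z = 0) :
    PowerSeries.subst Z (F.subst ![f, g] : PowerSeries R) =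
      F.subst ![f.subst Z, g.subst Z] :=
  subst_pair_subst hf hg F (PowerSeries.HasSubst.of_constantCoeff_zero hZ).const

theorem powerSeries_zero_subst {τ : Type*} {Z : MvPowerSeries τ R}
    (hZ : MvPowerSeries.constantCoeff Z = 0) : (0 : PowerSeries R).subst Z = 0 := by
  rw [← PowerSeries.coe_substAlgHom (PowerSeries.HasSubst.of_constantCoeff_zero hZ), map_zero]

/-- Uniqueness of negatives in the monoid of points of `F` with values in R⟦X⟧, applied to the point
X. -/
theorem isFormalInverse_unique {F : FormalGroup R} [F.IsComm] {i j : PowerSeries R}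
    (hi : IsFormalInverse F i) (hj : IsFormalInverse F j) : i = j := by
  let X : F.Point Unit := ⟨PowerSeries.X, PowerSeries.HasSubst.X'⟩
  let I : F.Point Unit := ⟨i, PowerSeries.HasSubst.of_constantCoeff_zero' hi.1⟩
  let J : F.Point Unit := ⟨j, PowerSeries.HasSubst.of_constantCoeff_zero' hj.1⟩
  have hI : I + X = 0 := by
    rw [add_comm]
    exact Subtype.ext hi.2
  have hJ : X + J = 0 := Subtype.ext hj.2
  have h : I = J := left_neg_eq_right_neg hI hJ
  exact congrArg Subtype.val h

theorem isFormalInverse_subst {F : FormalGroup R} {i : PowerSeries R}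
    (hi : IsFormalInverse F i) {τ : Type*} {Z : MvPowerSeries τ R}
    (hZ : MvPowerSeries.constantCoeff Z = 0) :
    F.toPowerSeries.subst ![Z, i.subst Z] = 0 := by
  have := congrArg (PowerSeries.subst Z) hi.2
  rwa [subst_pair_powerSeries_subst PowerSeries.constantCoeff_X hi.1 _ hZ,
    PowerSeries.subst_X (PowerSeries.HasSubst.of_constantCoeff_zero hZ),
    powerSeries_zero_subst hZ] at this

/-- In a commutative monoid the negative of a sum is the sum of the negatives. When ū = −u this
becomes the oddness F(−u, −v) = −F(u, v). -/
theorem formalInverse_add {F : FormalGroup R} [F.IsComm] {i : PowerSeries R}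
    (hi : IsFormalInverse F i) :
    F.toPowerSeries.subst ![atU i, atV i] = i.subst F.toPowerSeries := by
  let U : F.Point (Fin 2) := ⟨varU R, PowerSeries.HasSubst.X 0⟩
  let V : F.Point (Fin 2) := ⟨varV R, PowerSeries.HasSubst.X 1⟩
  let iU : F.Point (Fin 2) :=
    ⟨atU i, PowerSeries.HasSubst.of_constantCoeff_zero (constantCoeff_atU hi.1)⟩
  let iV : F.Point (Fin 2) :=
    ⟨atV i, PowerSeries.HasSubst.of_constantCoeff_zero (constantCoeff_atV hi.1)⟩
  let iF : F.Point (Fin 2) := ⟨i.subst F.toPowerSeries, PowerSeries.HasSubst.of_constantCoeff_zero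
    (constantCoeff_subst_eq_zero' F.zero_constantCoeff hi.1)⟩
  have hU : U + iU = 0 :=
    Subtype.ext (isFormalInverse_subst hi (MvPowerSeries.constantCoeff_X 0))
  have hV : V + iV = 0 :=
    Subtype.ext (isFormalInverse_subst hi (MvPowerSeries.constantCoeff_X 1))
  have hUV : (U + V).val = F.toPowerSeries := subst_pair_varU_varV _
  have hF : (U + V) + iF = 0 := Subtype.ext (by
    rw [FormalGroup.add_apply, hUV]
    exact isFormalInverse_subst hi F.zero_constantCoeff)
  have h : (iU + iV) + (U + V) = 0 := by
    have : (iU + iV) + (U + V) = (U + iU) + (V + iV) := by abel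
    rw [this, hU, hV, add_zero]
  have h' : iU + iV = iF := left_neg_eq_right_neg h hF
  exact congrArg Subtype.val h'

/-- The series `∂F/∂v (u, 0)`. -/
noncomputable def linearPart (F : MvPowerSeries (Fin 2) R) : PowerSeries R :=
  atZeroV (MvPowerSeries.pderiv R 1 F)

theorem formalGroup_subst_zero (F : FormalGroup R) {τ : Type*} {f : MvPowerSeries τ R}
    (hf : MvPowerSeries.constantCoeff f = 0) : F.toPowerSeries.subst ![f, 0] = f :=
  F.add_zero (PowerSeries.HasSubst.of_constantCoeff_zero hf)

theorem atZeroV_formalGroup (F : FormalGroup R) : atZeroV F.toPowerSeries = PowerSeries.X := by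
  rw [atZeroV_apply]
  exact F.Xzero_eq_X

/-- Invariance of the differential du/S(u): differentiate F(F(x, y), z) = F(x, F(y, z)) in z and set
z = 0. -/
theorem pderiv_one_mul_linearPart (F : FormalGroup R) :
    MvPowerSeries.pderiv R 1 F.toPowerSeries * atV (linearPart F.toPowerSeries) =
      (linearPart F.toPowerSeries).subst F.toPowerSeries := by
  set P := MvPowerSeries.pderiv R 1 F.toPowerSeries with hP
  have hX : ∀ i : Fin 3, MvPowerSeries.constantCoeff (MvPowerSeries.X i :
    MvPowerSeries (Fin 3) R) = 0 := fun i => by simp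
  have hFX : ∀ i j : Fin 3, MvPowerSeries.constantCoeff (F.toPowerSeries.subst
      ![(MvPowerSeries.X i : MvPowerSeries (Fin 3) R), MvPowerSeries.X j]) = 0 := fun i j => by
    rw [constantCoeff_subst_pair (hX i) (hX j), F.zero_constantCoeff]
  have h := congrArg (MvPowerSeries.pderiv R 2) F.assoc
  have h01 : MvPowerSeries.pderiv R 2 (F.toPowerSeries.subst
      ![(MvPowerSeries.X 0 : MvPowerSeries (Fin 3) R), MvPowerSeries.X 1]) = 0 := by
    rw [pderiv_subst_pair (hX 0) (hX 1), MvPowerSeries.pderiv_X_of_ne (by decide),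
      MvPowerSeries.pderiv_X_of_ne (by decide), mul_zero, mul_zero, add_zero]
  have h12 : MvPowerSeries.pderiv R 2 (F.toPowerSeries.subst
      ![(MvPowerSeries.X 1 : MvPowerSeries (Fin 3) R), MvPowerSeries.X 2]) =
      P.subst ![(MvPowerSeries.X 1 : MvPowerSeries (Fin 3) R), MvPowerSeries.X 2] := by
    rw [pderiv_subst_pair (hX 1) (hX 2), MvPowerSeries.pderiv_X_of_ne (by decide),
      MvPowerSeries.pderiv_X_self, mul_zero, mul_one, zero_add]
  rw [pderiv_subst_pair (hFX 0 1) (hX 2), pderiv_subst_pair (hX 0) (hFX 1 2), h01, h12,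
    MvPowerSeries.pderiv_X_self, MvPowerSeries.pderiv_X_of_ne (by decide), mul_zero, mul_zero,
    mul_one, zero_add, zero_add] at h
  have hc : MvPowerSeries.HasSubst ![varU R, varV R, 0] :=
    MvPowerSeries.hasSubst_of_constantCoeff_zero fun s => by fin_cases s <;> simp
  have h' := congrArg (MvPowerSeries.subst ![varU R, varV R, 0]) h
  have e0 : (MvPowerSeries.X 0 : MvPowerSeries (Fin 3) R).subst ![varU R, varV R, 0] = varU R :=
    MvPowerSeries.subst_X hc 0
  have e1 : (MvPowerSeries.X 1 : MvPowerSeries (Fin 3) R).subst ![varU R, varV R, 0] = varV R :=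
    MvPowerSeries.subst_X hc 1
  have e2 : (MvPowerSeries.X 2 : MvPowerSeries (Fin 3) R).subst ![varU R, varV R, 0] = 0 :=
    MvPowerSeries.subst_X hc 2
  rw [MvPowerSeries.subst_mul hc, subst_pair_subst (hFX 0 1) (hX 2) _ hc,
    subst_pair_subst (hX 0) (hFX 1 2) _ hc, subst_pair_subst (hX 0) (hX 1) _ hc,
    subst_pair_subst (hX 1) (hX 2) _ hc, subst_pair_subst (hX 1) (hX 2) _ hc, e0, e1, e2,
    subst_pair_varU_varV, formalGroup_subst_zero F (by simp), subst_pair_varU_varV] at h'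
  have hS : ∀ {Z : MvPowerSeries (Fin 2) R}, MvPowerSeries.constantCoeff Z = 0 →
      (linearPart F.toPowerSeries).subst Z = P.subst ![Z, 0] := by
    intro Z hZ
    rw [linearPart, atZeroV_apply,
      subst_pair_powerSeries_subst PowerSeries.constantCoeff_X (map_zero _) _ hZ,
      PowerSeries.subst_X (PowerSeries.HasSubst.of_constantCoeff_zero hZ),
      powerSeries_zero_subst hZ]
  rw [atV, hS (by simp), hS F.zero_constantCoeff, h']

theorem constantCoeff_linearPart (F : FormalGroup R) :
    PowerSeries.constantCoeff (linearPart F.toPowerSeries) = 1 := by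
  rw [linearPart, ← PowerSeries.coeff_zero_eq_constantCoeff_apply, coeff_atZeroV,
    Finsupp.single_zero, MvPowerSeries.coeff_zero_eq_constantCoeff_apply, ← coeff_single_one_eq,
    F.lin_coeff_Y]

/-- One more v-derivative of the invariance relation at v = 0; so the second-order term of a group
law in v is determined by its first-order term. -/
theorem atZeroV_pderiv_pderiv (F : FormalGroup R) :
    atZeroV (MvPowerSeries.pderiv R 1 (MvPowerSeries.pderiv R 1 F.toPowerSeries)) =
      PowerSeries.derivative R (linearPart F.toPowerSeries) * linearPart F.toPowerSeries -
      linearPart F.toPowerSeries *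
        PowerSeries.C (PowerSeries.coeff 1 (linearPart F.toPowerSeries)) := by
  have h := congrArg (fun M => atZeroV (MvPowerSeries.pderiv R 1 M)) (pderiv_one_mul_linearPart F)
  set S := linearPart F.toPowerSeries with hS
  simp only [Derivation.leibniz, smul_eq_mul, pderiv_powerSeries_subst F.zero_constantCoeff,
    pderiv_one_atV, map_add, map_mul, atZeroV_atV, atZeroV_subst F.zero_constantCoeff,
    atZeroV_formalGroup, PowerSeries.X_subst] at h
  have h2 : PowerSeries.constantCoeff (PowerSeries.derivative R S) = PowerSeries.coeff 1 S := by
    rw [← PowerSeries.coeff_zero_eq_constantCoeff_apply, PowerSeries.coeff_derivative]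
    simp
  have h1 : PowerSeries.constantCoeff S = 1 := constantCoeff_linearPart F
  have h3 : atZeroV (MvPowerSeries.pderiv R 1 F.toPowerSeries) = S := rfl
  rw [h1, h2, h3, map_one] at h
  linear_combination h

/-- By invariance of du/S, the v-derivative of g(F) is g'(F)S(F)/S(v) = 1/S(v) = g'(v), and at v = 0
both sides are g(u). -/
theorem isLogarithm_of_derivative_mul [Algebra ℚ R] {F : FormalGroup R} {g : PowerSeries R}
    (hg : PowerSeries.constantCoeff g = 0)
    (hgF : PowerSeries.derivative R g * linearPart F.toPowerSeries = 1) : IsLogarithm F g := by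
  set S := linearPart F.toPowerSeries with hS
  have hS1 : PowerSeries.constantCoeff S = 1 := constantCoeff_linearPart F
  refine ⟨hg, ?_, eq_of_pderiv_one_eq ?_ ?_⟩
  · have := congrArg PowerSeries.constantCoeff hgF
    rw [map_mul, hS1, mul_one, map_one, ← PowerSeries.coeff_zero_eq_constantCoeff_apply,
      PowerSeries.coeff_derivative] at this
    simpa using this
  · have hu : IsUnit (atV S) := isUnit_of_constantCoeff (by
      rw [atV, constantCoeff_subst_of_zero (by simp), hS1]; exact isUnit_one)
    apply hu.mul_right_cancel
    have hF := PowerSeries.HasSubst.of_constantCoeff_zero F.zero_constantCoeff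
    have hV : PowerSeries.HasSubst (varV R) := PowerSeries.HasSubst.X 1
    rw [pderiv_powerSeries_subst F.zero_constantCoeff, map_add, pderiv_one_atU, pderiv_one_atV,
      zero_add, mul_assoc, pderiv_one_mul_linearPart, ← PowerSeries.subst_mul hF, hgF, atV, atV,
      ← PowerSeries.subst_mul hV, hgF, ← PowerSeries.coe_substAlgHom hF,
      ← PowerSeries.coe_substAlgHom hV, map_one, map_one]
  · rw [atZeroV_subst F.zero_constantCoeff, atZeroV_formalGroup, PowerSeries.X_subst, map_add,
      atZeroV_atU, atZeroV_atV, hg, map_zero, add_zero]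

end FormalGroups

/-! ### The law `lawBc` -/

section Law

variable {R : Type u} [CommRing R]

theorem constantCoeff_evenSextic (b₁ b₂ b₃ : R) :
    MvPowerSeries.constantCoeff (evenSextic b₁ b₂ b₃) = 1 := by
  change PowerSeries.constantCoeff (evenSextic b₁ b₂ b₃) = 1
  simp [evenSextic]

theorem constantCoeff_seriesQ (a₁ a₂ a₃ : R) :
    MvPowerSeries.constantCoeff (seriesQ a₁ a₂ a₃) = 1 :=
  constantCoeff_evenSextic _ _ _

theorem evenSextic_subst {τ : Type*} {Z : MvPowerSeries τ R}
    (hZ : MvPowerSeries.constantCoeff Z = 0) (b₁ b₂ b₃ : R) :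
    (evenSextic b₁ b₂ b₃).subst Z =
      1 + MvPowerSeries.C b₁ * Z ^ 2 + MvPowerSeries.C b₂ * Z ^ 4 + MvPowerSeries.C b₃ * Z ^ 6 := by
  have hs := PowerSeries.HasSubst.of_constantCoeff_zero hZ
  rw [evenSextic, PowerSeries.subst_add hs, PowerSeries.subst_add hs, PowerSeries.subst_add hs,
    PowerSeries.subst_mul hs, PowerSeries.subst_mul hs, PowerSeries.subst_mul hs,
    PowerSeries.subst_pow hs, PowerSeries.subst_pow hs, PowerSeries.subst_pow hs,
    PowerSeries.subst_X hs, PowerSeries.subst_C, PowerSeries.subst_C, PowerSeries.subst_C,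
    ← PowerSeries.coe_substAlgHom hs, map_one]

/-- The square root `√Q(t)`. -/
noncomputable abbrev sqrtQ (a₁ a₂ a₃ : R) : PowerSeries R := sqrtSeries (seriesQ a₁ a₂ a₃)

/-- The series whose inverse square root is the second factor of `lawBc`. -/
noncomputable abbrev lawKernel (a₁ a₂ a₃ : R) : MvPowerSeries (Fin 2) R :=
  crossQuotient (sqrtQ a₁ a₂ a₃) ^ 2
      + MvPowerSeries.C a₃ * varU R ^ 2 * varV R ^ 2 * (varU R + varV R) ^ 2

theorem lawBc_eq (a₁ a₂ a₃ : R) :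
    lawBc a₁ a₂ a₃ = (varU R + varV R) * invSqrt (lawKernel a₁ a₂ a₃) := rfl

theorem constantCoeff_sqrtQ (a₁ a₂ a₃ : R) :
    PowerSeries.constantCoeff (sqrtQ a₁ a₂ a₃) = 1 :=
  constantCoeff_sqrtSeries (constantCoeff_seriesQ _ _ _)

theorem constantCoeff_crossQuotient (s : PowerSeries R) :
    MvPowerSeries.constantCoeff (crossQuotient s) = PowerSeries.constantCoeff s := by
  rw [← MvPowerSeries.coeff_zero_eq_constantCoeff_apply,
    ← PowerSeries.coeff_zero_eq_constantCoeff_apply]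
  exact if_pos (c := (0 : Fin 2 →₀ ℕ) = 0)
    (e := if 1 ≤ (0 : Fin 2 →₀ ℕ) 0 ∧ 1 ≤ (0 : Fin 2 →₀ ℕ) 1 then
      -PowerSeries.coeff ((0 : Fin 2 →₀ ℕ) 0 + (0 : Fin 2 →₀ ℕ) 1) s else 0) rfl

theorem constantCoeff_lawKernel (a₁ a₂ a₃ : R) :
    MvPowerSeries.constantCoeff (lawKernel a₁ a₂ a₃) = 1 := by
  simp [lawKernel, constantCoeff_crossQuotient, constantCoeff_sqrtQ]

/-- Multiplying the kernel by (u − v)² turns the quotient into its numerator, which leaves an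
identity without root or division. -/
theorem lawBc_sq (h2 : IsUnit (2 : R)) (a₁ a₂ a₃ : R) :
    lawBc a₁ a₂ a₃ ^ 2 *
      ((varU R * atV (sqrtQ a₁ a₂ a₃) - varV R * atU (sqrtQ a₁ a₂ a₃)) ^ 2
        + MvPowerSeries.C a₃ * varU R ^ 2 * varV R ^ 2 * (varU R ^ 2 - varV R ^ 2) ^ 2)
      = (varU R ^ 2 - varV R ^ 2) ^ 2 := by
  rw [lawBc_eq, ← varU_sub_varV_mul_crossQuotient]
  linear_combination (varU R ^ 2 - varV R ^ 2) ^ 2 *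
    invSqrt_sq_mul h2 (constantCoeff_lawKernel a₁ a₂ a₃)

theorem constantCoeff_lawBc (a₁ a₂ a₃ : R) :
    MvPowerSeries.constantCoeff (lawBc a₁ a₂ a₃) = 0 := by
  simp [lawBc_eq]

theorem constantCoeff_pderiv_lawBc (a₁ a₂ a₃ : R) (j : Fin 2) :
    MvPowerSeries.constantCoeff (MvPowerSeries.pderiv R j (lawBc a₁ a₂ a₃)) = 1 := by
  rw [lawBc_eq, Derivation.leibniz, map_add, smul_eq_mul, smul_eq_mul, map_mul, map_mul,
    constantCoeff_invSqrt (constantCoeff_lawKernel _ _ _)]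
  fin_cases j
  · simp [MvPowerSeries.pderiv_X_of_ne (show (1 : Fin 2) ≠ 0 by decide)]
  · simp [MvPowerSeries.pderiv_X_of_ne (show (0 : Fin 2) ≠ 1 by decide)]

theorem atZeroV_crossQuotient (s : PowerSeries R) :
    atZeroV (crossQuotient s) = PowerSeries.C (PowerSeries.constantCoeff s) := by
  have h := congrArg atZeroV (varU_sub_varV_mul_crossQuotient s)
  rw [map_mul, map_sub, map_sub, map_mul, map_mul, atZeroV_varU, atZeroV_varV, atZeroV_atV,
    sub_zero, zero_mul, sub_zero] at h
  exact PowerSeries.X_mul_cancel h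

theorem invSqrt_one (h2 : IsUnit (2 : R)) {σ : Type} : invSqrt (1 : MvPowerSeries σ R) = 1 :=
  (eq_invSqrt h2 (by simp) (by simp)).symm

theorem atZeroV_invSqrt (h2 : IsUnit (2 : R)) {h : MvPowerSeries (Fin 2) R}
    (hh : MvPowerSeries.constantCoeff h = 1) :
    atZeroV (invSqrt h) = invSqrt (atZeroV h) := by
  rw [atZeroV_apply, atZeroV_apply]
  refine invSqrt_subst h2 hh hasSubst_X_zero fun i => ?_
  fin_cases i
  · exact PowerSeries.constantCoeff_X
  · exact map_zero _

theorem atZeroV_lawBc (h2 : IsUnit (2 : R)) (a₁ a₂ a₃ : R) :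
    atZeroV (lawBc a₁ a₂ a₃) = PowerSeries.X := by
  rw [lawBc_eq, map_mul, atZeroV_invSqrt h2 (constantCoeff_lawKernel _ _ _)]
  simp only [lawKernel, map_add, map_mul, map_pow, atZeroV_varU, atZeroV_varV,
    atZeroV_crossQuotient, constantCoeff_sqrtQ, map_one]
  simp [invSqrt_one h2]

theorem map_crossQuotient {S : Type*} [CommRing S] (φ : R →+* S) (s : PowerSeries R) :
    MvPowerSeries.map φ (crossQuotient s) = crossQuotient (PowerSeries.map φ s) := by
  classical
  ext m
  rw [MvPowerSeries.coeff_map]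
  change φ (if m = 0 then PowerSeries.coeff 0 s
    else if 1 ≤ m 0 ∧ 1 ≤ m 1 then -PowerSeries.coeff (m 0 + m 1) s else 0) =
    (if m = 0 then PowerSeries.coeff 0 (PowerSeries.map φ s)
    else if 1 ≤ m 0 ∧ 1 ≤ m 1 then -PowerSeries.coeff (m 0 + m 1) (PowerSeries.map φ s) else 0)
  split_ifs <;> simp

theorem map_seriesQ {S : Type*} [CommRing S] (φ : R →+* S) (a₁ a₂ a₃ : R) :
    PowerSeries.map φ (seriesQ a₁ a₂ a₃) = seriesQ (φ a₁) (φ a₂) (φ a₃) := by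
  simp [seriesQ, evenSextic]

theorem map_sqrtQ {S : Type*} [CommRing S] (h2 : IsUnit (2 : R)) (φ : R →+* S) (a₁ a₂ a₃ : R) :
    PowerSeries.map φ (sqrtQ a₁ a₂ a₃) = sqrtQ (φ a₁) (φ a₂) (φ a₃) := by
  rw [sqrtQ, sqrtQ, ← map_seriesQ]
  exact map_sqrtSeries h2 φ (constantCoeff_seriesQ _ _ _)

theorem map_lawBc {S : Type*} [CommRing S] (h2 : IsUnit (2 : R)) (φ : R →+* S) (a₁ a₂ a₃ : R) :
    MvPowerSeries.map φ (lawBc a₁ a₂ a₃) = lawBc (φ a₁) (φ a₂) (φ a₃) := by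
  rw [lawBc_eq, lawBc_eq, map_mul, map_invSqrt h2 φ (constantCoeff_lawKernel _ _ _)]
  simp only [lawKernel, map_add, map_mul, map_pow, map_crossQuotient, map_sqrtQ h2,
    MvPowerSeries.map_X, MvPowerSeries.map_C]

end Law

/-! ### The addition theorem -/

section AdditionTheorem

variable {R : Type u} [CommRing R]

/-- In the coordinates (u + v, v) the hypothesis says that the derivative in the second coordinate
vanishes. -/
theorem eq_subst_add_of_pderiv_eq [Algebra ℚ R] {Φ : MvPowerSeries (Fin 2) R}
    (h : MvPowerSeries.pderiv R 0 Φ = MvPowerSeries.pderiv R 1 Φ) :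
    Φ = (atZeroV Φ).subst (varU R + varV R) := by
  have hm : MvPowerSeries.constantCoeff (varU R - varV R) = 0 := by simp
  have hp : MvPowerSeries.constantCoeff (varU R + varV R) = 0 := by simp
  have hv : MvPowerSeries.constantCoeff (varV R) = 0 := by simp
  have key : Φ.subst ![varU R - varV R, varV R] = atU (atZeroV Φ) := by
    refine eq_of_pderiv_one_eq ?_ ?_
    · rw [pderiv_subst_pair hm hv, h, pderiv_one_atU, map_sub, MvPowerSeries.pderiv_X_self,
        MvPowerSeries.pderiv_X_of_ne (by decide)]
      ring
    · rw [atZeroV_subst_pair hm hv, map_sub, atZeroV_varU, atZeroV_varV, sub_zero, atZeroV_atU,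
        ← atZeroV_apply]
  have := congrArg (MvPowerSeries.subst ![varU R + varV R, varV R]) key
  rw [subst_pair_subst hm hv _ (hasSubst_pair hp hv), subst_pair_atU hp hv,
    MvPowerSeries.subst_sub (hasSubst_pair hp hv), subst_pair_varU hp hv, subst_pair_varV hp hv,
    add_sub_cancel_right, subst_pair_varU_varV] at this
  exact this

/-- Differentiate the first-order equation and cancel 2f'. -/
theorem derivative_derivative_of_sqrt [Algebra ℚ R] {a₁ a₂ a₃ : R} {f : PowerSeries R}
    (hf1 : IsUnit (PowerSeries.derivative R f))
    (hf : PowerSeries.derivative R f ^ 2 =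
      1 - PowerSeries.C a₁ * f ^ 2 + PowerSeries.C a₂ * f ^ 4 - PowerSeries.C a₃ * f ^ 6) :
    PowerSeries.derivative R (PowerSeries.derivative R f) =
      -PowerSeries.C a₁ * f + 2 * PowerSeries.C a₂ * f ^ 3 - 3 * PowerSeries.C a₃ * f ^ 5 := by
  have h2 : IsUnit (2 : PowerSeries R) := by
    have := (isUnit_two (R := R)).map (PowerSeries.C (R := R))
    rwa [map_ofNat] at this
  have h := congrArg (PowerSeries.derivative R) hf
  simp only [map_sub, map_add, Derivation.leibniz, Derivation.leibniz_pow, smul_eq_mul,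
    nsmul_eq_mul, PowerSeries.derivative_C, Derivation.map_one_eq_zero] at h
  push_cast at h
  apply (h2.mul hf1).mul_left_cancel
  linear_combination h

/-- The addition theorem. The left side is Φ = (s + t)J with J²K = 1; it suffices that D = ∂/∂u −
∂/∂v annihilates it, for then it is a series in u + v, read off at v = 0. -/
theorem lawBc_subst_exponential [Algebra ℚ R] (a₁ a₂ a₃ : R) {f : PowerSeries R}
    (hf0 : PowerSeries.constantCoeff f = 0)
    (hf : PowerSeries.derivative R f = (sqrtQ a₁ a₂ a₃).subst f) :
    (lawBc a₁ a₂ a₃).subst ![atU f, atV f] = f.subst (varU R + varV R) := by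
  have h2 : IsUnit (2 : R) := isUnit_two
  have hfs := PowerSeries.HasSubst.of_constantCoeff_zero' hf0
  have hQ := sqrtSeries_sq h2 (constantCoeff_seriesQ a₁ a₂ a₃)
  have hf' : PowerSeries.derivative R f ^ 2 =
      1 - PowerSeries.C a₁ * f ^ 2 + PowerSeries.C a₂ * f ^ 4 - PowerSeries.C a₃ * f ^ 6 := by
    rw [hf, ← PowerSeries.subst_pow hfs, hQ, seriesQ, evenSextic_subst hf0, map_neg, map_neg]
    change 1 + -PowerSeries.C a₁ * f ^ 2 + PowerSeries.C a₂ * f ^ 4 + -PowerSeries.C a₃ * f ^ 6 = _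
    ring
  have hfc : PowerSeries.constantCoeff (PowerSeries.derivative R f) = 1 := by
    rw [hf]
    exact (constantCoeff_subst_of_zero hf0 _).trans (constantCoeff_sqrtQ _ _ _)
  have hf'' := derivative_derivative_of_sqrt (isUnit_of_constantCoeff (by
    change IsUnit (PowerSeries.constantCoeff _); rw [hfc]; exact isUnit_one)) hf'
  have hs0 := constantCoeff_atU hf0
  have ht0 := constantCoeff_atV hf0
  have hst := hasSubst_pair hs0 ht0
  set s := atU f with hs
  set t := atV f with ht
  set S := atU (PowerSeries.derivative R f) with hS
  set T := atV (PowerSeries.derivative R f) with hT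
  set c := (crossQuotient (sqrtQ a₁ a₂ a₃)).subst ![s, t] with hc
  set A₁ : MvPowerSeries (Fin 2) R := MvPowerSeries.C a₁
  set A₂ : MvPowerSeries (Fin 2) R := MvPowerSeries.C a₂
  set A₃ : MvPowerSeries (Fin 2) R := MvPowerSeries.C a₃
  set K := c ^ 2 + A₃ * s ^ 2 * t ^ 2 * (s + t) ^ 2 with hK
  set J := invSqrt K with hJ
  have hcst : (s - t) * c = s * T - t * S := by
    have := congrArg (MvPowerSeries.subst ![s, t])
      (varU_sub_varV_mul_crossQuotient (sqrtQ a₁ a₂ a₃))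
    rw [MvPowerSeries.subst_mul hst, MvPowerSeries.subst_sub hst, MvPowerSeries.subst_sub hst,
      MvPowerSeries.subst_mul hst, MvPowerSeries.subst_mul hst, subst_pair_varU hs0 ht0,
      subst_pair_varV hs0 ht0, subst_pair_atU hs0 ht0, subst_pair_atV hs0 ht0] at this
    rw [hc, this, hS, hT, hf, atU, atV,
      PowerSeries.subst_comp_subst_apply hfs (PowerSeries.HasSubst.X 0),
      PowerSeries.subst_comp_subst_apply hfs (PowerSeries.HasSubst.X 1)]
  have hu := PowerSeries.HasSubst.X (S := R) (0 : Fin 2)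
  have hv := PowerSeries.HasSubst.X (S := R) (1 : Fin 2)
  have hC : ∀ (Z : MvPowerSeries (Fin 2) R) (r : R), PowerSeries.subst Z (PowerSeries.C r) =
    MvPowerSeries.C r := fun Z r => PowerSeries.subst_C r
  have hSs : S ^ 2 = 1 - A₁ * s ^ 2 + A₂ * s ^ 4 - A₃ * s ^ 6 := by
    have := congrArg (PowerSeries.substAlgHom hu) hf'
    simpa only [map_sub, map_add, map_mul, map_pow, map_one, PowerSeries.coe_substAlgHom, hC]
      using this
  have hTs : T ^ 2 = 1 - A₁ * t ^ 2 + A₂ * t ^ 4 - A₃ * t ^ 6 := by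
    have := congrArg (PowerSeries.substAlgHom hv) hf'
    simpa only [map_sub, map_add, map_mul, map_pow, map_one, PowerSeries.coe_substAlgHom, hC]
      using this
  have hS' : atU (PowerSeries.derivative R (PowerSeries.derivative R f)) =
      -A₁ * s + 2 * A₂ * s ^ 3 - 3 * A₃ * s ^ 5 := by
    have := congrArg (PowerSeries.substAlgHom hu) hf''
    simpa only [map_sub, map_add, map_mul, map_pow, map_neg, map_ofNat,
      PowerSeries.coe_substAlgHom, hC] using this
  have hT' : atV (PowerSeries.derivative R (PowerSeries.derivative R f)) =
      -A₁ * t + 2 * A₂ * t ^ 3 - 3 * A₃ * t ^ 5 := by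
    have := congrArg (PowerSeries.substAlgHom hv) hf''
    simpa only [map_sub, map_add, map_mul, map_pow, map_neg, map_ofNat,
      PowerSeries.coe_substAlgHom, hC] using this
  let D : Derivation R (MvPowerSeries (Fin 2) R) (MvPowerSeries (Fin 2) R) :=
    MvPowerSeries.pderiv R 0 - MvPowerSeries.pderiv R 1
  have hD : ∀ M, D M = MvPowerSeries.pderiv R 0 M - MvPowerSeries.pderiv R 1 M := fun M => rfl
  have Ds : D s = S := by rw [hD, pderiv_zero_atU, pderiv_one_atU, sub_zero]
  have Dt : D t = -T := by rw [hD, pderiv_zero_atV, pderiv_one_atV, zero_sub]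
  have DS : D S = -A₁ * s + 2 * A₂ * s ^ 3 - 3 * A₃ * s ^ 5 := by
    rw [hD, pderiv_zero_atU, pderiv_one_atU, sub_zero, hS']
  have DT : D T = -(-A₁ * t + 2 * A₂ * t ^ 3 - 3 * A₃ * t ^ 5) := by
    rw [hD, pderiv_zero_atV, pderiv_one_atV, zero_sub, hT']
  have DA : ∀ r, D (MvPowerSeries.C r) = 0 := fun r => by
    rw [hD, MvPowerSeries.pderiv_C, MvPowerSeries.pderiv_C, sub_zero]
  have hc1 : MvPowerSeries.constantCoeff c = 1 := by
    rw [hc, constantCoeff_subst_pair hs0 ht0, constantCoeff_crossQuotient, constantCoeff_sqrtQ]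
  have hK1 : MvPowerSeries.constantCoeff K = 1 := by
    rw [hK, map_add, map_mul, map_pow, map_pow, map_add, hs0, ht0, hc1]
    ring
  have hJK : J ^ 2 * K = 1 := invSqrt_sq_mul h2 hK1
  have hJ1 : MvPowerSeries.constantCoeff J = 1 := constantCoeff_invSqrt hK1
  have hΦ : (lawBc a₁ a₂ a₃).subst ![s, t] = (s + t) * J := by
    rw [lawBc_eq, MvPowerSeries.subst_mul hst, invSqrt_subst h2 (constantCoeff_lawKernel _ _ _) hst
      (fun i => by fin_cases i <;> simpa), MvPowerSeries.subst_add hst, subst_pair_varU hs0 ht0,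
      subst_pair_varV hs0 ht0, lawKernel, MvPowerSeries.subst_add hst, MvPowerSeries.subst_mul hst,
      MvPowerSeries.subst_mul hst, MvPowerSeries.subst_mul hst, MvPowerSeries.subst_pow hst,
      MvPowerSeries.subst_pow hst, MvPowerSeries.subst_pow hst, MvPowerSeries.subst_pow hst,
      MvPowerSeries.subst_add hst, subst_pair_varU hs0 ht0, subst_pair_varV hs0 ht0,
      MvPowerSeries.subst_C]
  -- s − t = f(u) − f(v) has linear coefficient f'(0) = 1 in u, so it may be cancelled.
  have hcancel : ∀ {p : MvPowerSeries (Fin 2) R}, (s - t) * p = 0 → p = 0 := by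
    intro p hp
    refine eq_zero_of_mul_eq_zero_of_isUnit_coeff (j := 0) (k := 1) (by decide)
      (by rw [map_sub, hs0, ht0, sub_zero]) ?_ hp
    rw [coeff_single_one_eq, map_sub, pderiv_zero_atU, pderiv_zero_atV, sub_zero, atU,
      constantCoeff_subst_of_zero (by simp), hfc]
    exact isUnit_one
  -- The product with (s − t)² is a polynomial in s, t, S, T, so D can be applied to it explicitly.
  have hWK : (s - t) ^ 2 * K = (s * T - t * S) ^ 2 + A₃ * s ^ 2 * t ^ 2 * (s ^ 2 - t ^ 2) ^ 2 := by
    rw [hK, ← hcst]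
    ring
  have hDW := congrArg D hWK
  simp only [map_sub, map_add, Derivation.leibniz, Derivation.leibniz_pow, smul_eq_mul,
    nsmul_eq_mul, Ds, Dt, DS, DT, A₃, DA] at hDW
  push_cast at hDW
  -- Up to the unit 2KJ and the factor J² this is the equation DΦ = 0. Two factors s − t bring in
  -- the polynomial (s − t)²K, the third pairs with s + t to give s² − t²; the remaining discrepancy
  -- is a multiple of the relations for S² and T².
  have hE : 2 * K * (S - T) - (s + t) * D K = 0 := by
    apply hcancel
    apply hcancel
    apply hcancel
    linear_combination
      (-(s ^ 2 - t ^ 2)) * hDW + (4 * (s * S + t * T)) * hWK +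
      4 * (s * T - t * S) * s * t * (hTs - hSs)
  have hDΦ : D ((s + t) * J) = 0 := by
    have hDJ := congrArg D hJK
    simp only [Derivation.leibniz, Derivation.leibniz_pow, smul_eq_mul, nsmul_eq_mul,
      Derivation.map_one_eq_zero] at hDJ
    push_cast at hDJ
    have hu : IsUnit (2 * K * J) := isUnit_of_constantCoeff (by
      rw [map_mul, map_mul, hK1, hJ1, map_ofNat, mul_one, mul_one]; exact h2)
    apply hu.mul_right_eq_zero.mp
    simp only [map_add, Derivation.leibniz, smul_eq_mul, Ds, Dt]
    linear_combination (s + t) * hDJ + J ^ 2 * hE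
  rw [hD] at hDΦ
  have h := eq_subst_add_of_pderiv_eq (sub_eq_zero.mp hDΦ)
  rw [← hΦ] at h
  rw [h, atZeroV_subst_pair hs0 ht0, hs, ht, atZeroV_atU, atZeroV_atV, hf0, map_zero]
  congr 1
  have h3 := congrArg (PowerSeries.subst f) (atZeroV_lawBc h2 a₁ a₂ a₃)
  rwa [atZeroV_apply, subst_pair_powerSeries_subst PowerSeries.constantCoeff_X (map_zero _) _ hf0,
    PowerSeries.subst_X hfs, powerSeries_zero_subst hf0] at h3

/-- The logarithm `∫₀ᵘ dt / √Q(t)`. -/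
noncomputable abbrev logBc [Algebra ℚ R] (a₁ a₂ a₃ : R) : PowerSeries R :=
  formalIntegral (invSqrt (seriesQ a₁ a₂ a₃))

/-- The derivative of the inverse series: f' = 1/g'(f), where g' = h^(−1/2). -/
theorem derivative_eq_of_areCompInverse_formalIntegral [Algebra ℚ R] {h f : PowerSeries R}
    (hh : PowerSeries.constantCoeff h = 1)
    (hf : AreCompInverse f (formalIntegral (invSqrt h))) :
    PowerSeries.derivative R f = PowerSeries.subst f (sqrtSeries h) := by
  have hfs := PowerSeries.HasSubst.of_constantCoeff_zero' hf.1
  have h1 := congrArg (PowerSeries.derivative R) hf.2.2.2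
  rw [PowerSeries.derivative_subst hfs, derivative_formalIntegral, PowerSeries.derivative_X] at h1
  have h2 := congrArg (PowerSeries.substAlgHom hfs) (invSqrt_mul_sqrtSeries isUnit_two hh)
  rw [map_mul, map_one, PowerSeries.coe_substAlgHom] at h2
  linear_combination PowerSeries.subst f (sqrtSeries h) * h1 - PowerSeries.derivative R f * h2

theorem exists_formalGroup_lawBc [Algebra ℚ R] (a₁ a₂ a₃ : R) :
    ∃ F : FormalGroup R, F.toPowerSeries = lawBc a₁ a₂ a₃ ∧ F.IsComm ∧
      IsLogarithm F (logBc a₁ a₂ a₃) := by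
  have hg0 := constantCoeff_formalIntegral (invSqrt (seriesQ a₁ a₂ a₃))
  have hg1 : PowerSeries.coeff 1 (logBc a₁ a₂ a₃) = 1 := by
    rw [coeff_one_formalIntegral]
    exact constantCoeff_invSqrt (constantCoeff_seriesQ _ _ _)
  obtain ⟨f, hf⟩ := exists_areCompInverse hg0 hg1
  obtain ⟨F, hF, hcomm, hlog⟩ := exists_formalGroup_of_log hf.symm hg1
  refine ⟨F, ?_, hcomm, hlog⟩
  have h := lawBc_subst_exponential a₁ a₂ a₃ hf.2.1
    (derivative_eq_of_areCompInverse_formalIntegral (constantCoeff_seriesQ _ _ _) hf.symm)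
  have hU := constantCoeff_atU hg0
  have hV := constantCoeff_atV hg0
  -- Substituting u ↦ g(u), v ↦ g(v) in F(f(u), f(v)) = f(u + v) identifies `lawBc` with the law
  -- transported from addition.
  have := congrArg (MvPowerSeries.subst ![atU (logBc a₁ a₂ a₃), atV (logBc a₁ a₂ a₃)]) h
  rw [subst_pair_subst (constantCoeff_atU hf.2.1) (constantCoeff_atV hf.2.1) _
    (hasSubst_pair hU hV), subst_pair_atU hU hV, subst_pair_atV hU hV,
    hf.symm.subst_subst (by simp), hf.symm.subst_subst (by simp), subst_pair_varU_varV,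
    powerSeries_subst_subst (by simp) _ (hasSubst_pair hU hV),
    MvPowerSeries.subst_add (hasSubst_pair hU hV), subst_pair_varU hU hV,
    subst_pair_varV hU hV] at this
  rw [hF, this]

end AdditionTheorem

/-! ### Laws in fraction form -/

section FractionForm

variable {R : Type u} [CommRing R]

theorem constantCoeff_derivative (p : PowerSeries R) :
    PowerSeries.constantCoeff (PowerSeries.derivative R p) = PowerSeries.coeff 1 p := by
  rw [← PowerSeries.coeff_zero_eq_constantCoeff_apply, PowerSeries.coeff_derivative]
  simp

theorem derivative_mul_linearPart {F : FormalGroup R} {g : PowerSeries R} (h : IsLogarithm F g) :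
    PowerSeries.derivative R g * linearPart F.toPowerSeries = 1 := by
  have := congrArg (fun M => atZeroV (MvPowerSeries.pderiv R 1 M)) h.2.2
  simp only [pderiv_powerSeries_subst F.zero_constantCoeff, map_add, pderiv_one_atU,
    pderiv_one_atV, map_mul, atZeroV_subst F.zero_constantCoeff, atZeroV_formalGroup,
    PowerSeries.X_subst, atZeroV_atV, constantCoeff_derivative, h.2.1, map_one, zero_add] at this
  exact this

theorem linearPart_lawBc [Algebra ℚ R] (a₁ a₂ a₃ : R) :
    linearPart (lawBc a₁ a₂ a₃) = sqrtQ a₁ a₂ a₃ := by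
  obtain ⟨F, hF, -, hlog⟩ := exists_formalGroup_lawBc a₁ a₂ a₃
  have h := derivative_mul_linearPart hlog
  rw [derivative_formalIntegral, hF] at h
  have h' := invSqrt_mul_sqrtSeries isUnit_two (constantCoeff_seriesQ a₁ a₂ a₃)
  linear_combination sqrtQ a₁ a₂ a₃ * h - linearPart (lawBc a₁ a₂ a₃) * h'

/-- For a₃ = 0 the kernel is the square of c = (u√Q(v) − v√Q(u))/(u − v), so the root can be
extracted and F = (u + v)/c. -/
theorem hasFractionForm_lawBc_zero (h2 : IsUnit (2 : R)) (a₁ a₂ : R) :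
    HasFractionForm (lawBc a₁ a₂ 0) 1 (sqrtQ a₁ a₂ 0) := by
  set c := crossQuotient (sqrtQ a₁ a₂ 0) with hc
  have hc1 : MvPowerSeries.constantCoeff c = 1 := by
    rw [hc, constantCoeff_crossQuotient, constantCoeff_sqrtQ]
  have hk : lawKernel a₁ a₂ 0 = c ^ 2 := by simp [lawKernel, hc]
  have hk1 : MvPowerSeries.constantCoeff (c ^ 2) = 1 := by rw [map_pow, hc1, one_pow]
  have hI : invSqrt (c ^ 2) * c = 1 := by
    refine eq_of_sq_eq_sq h2 ?_ (map_one _) ?_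
    · rw [map_mul, constantCoeff_invSqrt hk1, hc1, one_mul]
    · linear_combination invSqrt_sq_mul h2 hk1
  have hone : ∀ i : Fin 2, (1 : PowerSeries R).subst (MvPowerSeries.X i : MvPowerSeries (Fin 2) R)
      = 1 := fun i => by rw [← PowerSeries.coe_substAlgHom (PowerSeries.HasSubst.X i), map_one]
  rw [HasFractionForm, ← varU_sub_varV_mul_crossQuotient, lawBc_eq, hk, atU, atV, hone, hone]
  linear_combination (varU R ^ 2 - varV R ^ 2) * hI

/-- The three conclusions are the terms of order 0, 1 and 2 of the fraction identity in v at v = 0,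
after cancelling powers of u. They recover both numerator and denominator series from S, the second
v-derivative at v = 0 and a few coefficients. -/
theorem hasFractionForm_expansion {F : FormalGroup R} {l₁ l₂ : PowerSeries R}
    (h : HasFractionForm F.toPowerSeries l₁ l₂) :
    PowerSeries.constantCoeff l₁ = PowerSeries.constantCoeff l₂ ∧
    PowerSeries.X * PowerSeries.C (PowerSeries.coeff 1 l₂) - l₂ =
      PowerSeries.X * PowerSeries.C (PowerSeries.coeff 1 l₁) -
        PowerSeries.C (PowerSeries.constantCoeff l₂) * linearPart F.toPowerSeries ∧
    2 * l₁ = 2 * PowerSeries.X ^ 2 *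
        PowerSeries.C (PowerSeries.coeff 2 l₁ - PowerSeries.coeff 2 l₂) -
      PowerSeries.X * PowerSeries.C (PowerSeries.constantCoeff l₂) *
        atZeroV (MvPowerSeries.pderiv R 1 (MvPowerSeries.pderiv R 1 F.toPowerSeries)) -
      2 * linearPart F.toPowerSeries * (PowerSeries.X * PowerSeries.C (PowerSeries.coeff 1 l₁) -
        PowerSeries.C (PowerSeries.constantCoeff l₂) * linearPart F.toPowerSeries) := by
  rw [HasFractionForm] at h
  have h0 := congrArg atZeroV h
  have h1 := congrArg (fun M => atZeroV (MvPowerSeries.pderiv R 1 M)) h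
  have h2 := congrArg (fun M => atZeroV (MvPowerSeries.pderiv R 1 (MvPowerSeries.pderiv R 1 M))) h
  have hS : atZeroV (MvPowerSeries.pderiv R 1 F.toPowerSeries) = linearPart F.toPowerSeries := rfl
  have hu : MvPowerSeries.pderiv R 1 (varU R) = 0 := MvPowerSeries.pderiv_X_of_ne (by decide)
  have hv : MvPowerSeries.pderiv R 1 (varV R) = 1 := MvPowerSeries.pderiv_X_self
  have hdd : ∀ p : PowerSeries R, PowerSeries.constantCoeff
      (PowerSeries.derivative R (PowerSeries.derivative R p)) = 2 * PowerSeries.coeff 2 p := by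
    intro p
    rw [constantCoeff_derivative, PowerSeries.coeff_derivative]
    norm_num [mul_comm]
  simp only [map_mul, map_sub, map_pow, map_add, Derivation.leibniz, Derivation.leibniz_pow,
    smul_eq_mul, nsmul_eq_mul, hu, hv, hS, pderiv_one_atU, pderiv_one_atV, atZeroV_atU,
    atZeroV_atV, atZeroV_varU, atZeroV_varV, atZeroV_formalGroup, constantCoeff_derivative, hdd,
    map_ofNat, mul_zero, zero_mul, add_zero, zero_add, sub_zero, mul_one, pow_one, Nat.add_one_sub_one, Nat.cast_ofNat, smul_zero,
    ne_eq, OfNat.ofNat_ne_zero, not_false_eq_true, zero_pow] at h0 h1 h2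
  have e0 : PowerSeries.constantCoeff l₁ = PowerSeries.constantCoeff l₂ := by
    have h0' : (PowerSeries.X : PowerSeries R) ^ 2 *
        PowerSeries.C (PowerSeries.constantCoeff l₁) = PowerSeries.X ^ 2 *
        PowerSeries.C (PowerSeries.constantCoeff l₂) := by linear_combination -h0
    have := PowerSeries.X_pow_mul_cancel h0'
    simpa using congrArg PowerSeries.constantCoeff this
  refine ⟨e0, ?_, ?_⟩
  · apply PowerSeries.X_mul_cancel
    linear_combination h1
  · have e1 : PowerSeries.X * PowerSeries.C (PowerSeries.coeff 1 l₂) - l₂ =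
      PowerSeries.X * PowerSeries.C (PowerSeries.coeff 1 l₁) -
        PowerSeries.C (PowerSeries.constantCoeff l₂) * linearPart F.toPowerSeries := by
      apply PowerSeries.X_mul_cancel
      linear_combination h1
    rw [map_sub]
    linear_combination h2 - 2 * linearPart F.toPowerSeries * e1

theorem derivative_sq_eq {S : PowerSeries R} {b₁ b₂ b₃ : R} (h : S ^ 2 = evenSextic b₁ b₂ b₃) :
    2 * S * PowerSeries.derivative R S = 2 * PowerSeries.C b₁ * PowerSeries.X +
      4 * PowerSeries.C b₂ * PowerSeries.X ^ 3 + 6 * PowerSeries.C b₃ * PowerSeries.X ^ 5 := by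
  have h' := congrArg (PowerSeries.derivative R) h
  simp only [evenSextic, map_add, Derivation.leibniz, Derivation.leibniz_pow, smul_eq_mul,
    nsmul_eq_mul, PowerSeries.derivative_C, PowerSeries.derivative_X,
    Derivation.map_one_eq_zero] at h'
  push_cast at h'
  linear_combination h'

theorem subst_quadratic {τ : Type*} {Z : MvPowerSeries τ R}
    (hZ : MvPowerSeries.constantCoeff Z = 0) (b c : R) (S : PowerSeries R) :
    (PowerSeries.X * PowerSeries.C b + PowerSeries.C c * S).subst Z =
      Z * MvPowerSeries.C b + MvPowerSeries.C c * S.subst Z := by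
  have hs := PowerSeries.HasSubst.of_constantCoeff_zero hZ
  rw [PowerSeries.subst_add hs, PowerSeries.subst_mul hs, PowerSeries.subst_mul hs,
    PowerSeries.subst_X hs, PowerSeries.subst_C, PowerSeries.subst_C]

/-- The expansion with S = √Q makes l₂ a combination of X and S, and l₁ a combination of X² and 1 +
a₃X⁶/2. This gives a second formula for F; squaring it and comparing with `lawBc_sq` yields a
relation whose uv-coefficient is 8a₃. -/
theorem eq_zero_of_inKricheverClass_lawBc [Algebra ℚ R] {a₁ a₂ a₃ : R}
    (h : InKricheverClass (lawBc a₁ a₂ a₃)) : a₃ = 0 := by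
  have h2 : IsUnit (2 : R) := isUnit_two
  have hC2 : ∀ {τ : Type}, IsUnit (2 : MvPowerSeries τ R) := fun {τ} => by
    have := h2.map (MvPowerSeries.C (σ := τ) (R := R))
    rwa [map_ofNat] at this
  obtain ⟨F, hF, -, -⟩ := exists_formalGroup_lawBc a₁ a₂ a₃
  obtain ⟨l₁, l₂, hu, hform⟩ := h
  have hsq := lawBc_sq h2 a₁ a₂ a₃
  have hS : linearPart F.toPowerSeries = sqrtQ a₁ a₂ a₃ := by rw [hF, linearPart_lawBc]
  rw [← hF] at hform hsq
  obtain ⟨-, e1, e2⟩ := hasFractionForm_expansion hform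
  have hdd := atZeroV_pderiv_pderiv F
  rw [hS] at e1 e2 hdd
  set S := sqrtQ a₁ a₂ a₃ with hSdef
  have hSQ : S ^ 2 = evenSextic (-a₁) a₂ (-a₃) := sqrtSeries_sq h2 (constantCoeff_seriesQ a₁ a₂ a₃)
  have hS1 : PowerSeries.constantCoeff S = 1 := constantCoeff_sqrtQ a₁ a₂ a₃
  have hdS := derivative_sq_eq hSQ
  have hs1 : PowerSeries.coeff 1 S = 0 := by
    have := congrArg PowerSeries.constantCoeff hdS
    simp only [map_mul, map_add, map_pow, hS1, constantCoeff_derivative, map_ofNat,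
      PowerSeries.constantCoeff_X, mul_zero, mul_one, ne_eq, OfNat.ofNat_ne_zero,
      not_false_eq_true, zero_pow, add_zero] at this
    exact h2.mul_right_eq_zero.mp this
  rw [hs1, map_zero, mul_zero, sub_zero] at hdd
  rw [hdd] at e2
  set c := PowerSeries.constantCoeff l₂
  -- As S has no linear term, the coefficient of X in the formula for 2l₁ gives 4 · coeff 1 l₁ = 0.
  have hc1 : PowerSeries.coeff 1 l₁ = 0 := by
    have := congrArg (fun p => PowerSeries.constantCoeff (PowerSeries.derivative R p)) e2
    have hd2 : PowerSeries.derivative R (2 : PowerSeries R) = 0 := Derivation.map_natCast _ 2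
    simp only [map_sub, map_mul, map_pow, Derivation.leibniz, Derivation.leibniz_pow, smul_eq_mul,
      nsmul_eq_mul, map_add, PowerSeries.derivative_C, PowerSeries.derivative_X, hd2,
      constantCoeff_derivative, hs1, hS1, PowerSeries.constantCoeff_X,
      PowerSeries.constantCoeff_C, map_ofNat] at this
    simp only [map_zero, map_one] at this
    have h4 : (2 * 2 : R) * PowerSeries.coeff 1 l₁ = 0 := by
      linear_combination this
    exact (h2.mul h2).mul_right_eq_zero.mp h4
  rw [hc1, map_zero, mul_zero, zero_sub] at e1 e2
  set β := PowerSeries.coeff 2 l₁ - PowerSeries.coeff 2 l₂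
  have el2 : l₂ = PowerSeries.X * PowerSeries.C (PowerSeries.coeff 1 l₂) + PowerSeries.C c * S := by
    linear_combination -e1
  -- S² and SS' are polynomials: in 4S² − 2XSS' the terms in X⁴ cancel, leaving those in 1, X² and
  -- X⁶.
  have el1 : 2 * l₁ = PowerSeries.X ^ 2 * PowerSeries.C (2 * β - c * a₁) +
      PowerSeries.C c * (2 + PowerSeries.C a₃ * PowerSeries.X ^ 6) := by
    apply (hC2 (τ := Unit)).mul_left_cancel
    rw [evenSextic, map_neg, map_neg] at hSQ
    rw [map_neg, map_neg] at hdS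
    rw [map_sub, map_mul, map_mul, map_ofNat]
    linear_combination 2 * e2 - PowerSeries.X * PowerSeries.C c * hdS + 4 * PowerSeries.C c * hSQ
  have hl1 : ∀ i : Fin 2, 2 * l₁.subst (MvPowerSeries.X i : MvPowerSeries (Fin 2) R) =
      MvPowerSeries.X i ^ 2 * MvPowerSeries.C (2 * β - c * a₁) +
      MvPowerSeries.C c * (2 + MvPowerSeries.C a₃ * MvPowerSeries.X i ^ 6) := by
    intro i
    have hi := PowerSeries.HasSubst.X (S := R) i
    have := congrArg (PowerSeries.substAlgHom hi) el1
    have hC : ∀ r : R, PowerSeries.subst (MvPowerSeries.X i : MvPowerSeries (Fin 2) R)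
      (PowerSeries.C r) = MvPowerSeries.C r := fun r => PowerSeries.subst_C r
    rw [map_mul, map_add, map_mul, map_mul, map_add, map_mul, map_pow, map_pow, map_ofNat,
      PowerSeries.substAlgHom_X, PowerSeries.coe_substAlgHom, hC, hC, hC] at this
    exact this
  have hL1 := hl1 0
  have hL2 := hl1 1
  rw [HasFractionForm, el2, atV, atU, subst_quadratic (by simp), subst_quadratic (by simp)] at hform
  have hcu : IsUnit (MvPowerSeries.C c : MvPowerSeries (Fin 2) R) :=
    hu.map (MvPowerSeries.C (σ := Fin 2) (R := R))
  -- The linear term of l₂ and the quadratic term of l₁ drop out by antisymmetry, and the unit c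
  -- cancels.
  have hmain : 2 * F.toPowerSeries * (varU R * atV S - varV R * atU S) =
      (varU R ^ 2 - varV R ^ 2) *
        (2 - MvPowerSeries.C a₃ * varU R ^ 2 * varV R ^ 2 * (varU R ^ 2 + varV R ^ 2)) := by
    apply hcu.mul_left_cancel
    linear_combination 2 * hform + varU R ^ 2 * hL2 - varV R ^ 2 * hL1
  -- The square of `hmain` against four times `lawBc_sq`; the common factor u²v²(u² − v²)² is
  -- cancelled.
  have hcan : 4 * MvPowerSeries.C a₃ * F.toPowerSeries ^ 2 =
      4 * MvPowerSeries.C a₃ * (varU R ^ 2 + varV R ^ 2) -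
      MvPowerSeries.C a₃ ^ 2 * varU R ^ 2 * varV R ^ 2 * (varU R ^ 2 + varV R ^ 2) ^ 2 := by
    apply varU_cancel
    apply varU_cancel
    apply varV_cancel
    apply varV_cancel
    apply sq_sub_sq_cancel
    apply sq_sub_sq_cancel
    linear_combination 4 * hsq - (2 * F.toPowerSeries * (varU R * atV S - varV R * atU S) +
      (varU R ^ 2 - varV R ^ 2) *
        (2 - MvPowerSeries.C a₃ * varU R ^ 2 * varV R ^ 2 * (varU R ^ 2 + varV R ^ 2))) * hmain
  -- Coefficient of uv: F² = (u + v + ⋯)² contributes 2, and the right side has no such term.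
  have hf := congrArg (fun M => MvPowerSeries.constantCoeff
    (MvPowerSeries.pderiv R 0 (MvPowerSeries.pderiv R 1 M))) hcan
  have hn : ∀ (j : Fin 2) , MvPowerSeries.pderiv R j (4 : MvPowerSeries (Fin 2) R) = 0 := fun j =>
    Derivation.map_natCast _ 4
  have hn' : ∀ (j : Fin 2) , MvPowerSeries.pderiv R j (2 : MvPowerSeries (Fin 2) R) = 0 := fun j =>
    Derivation.map_natCast _ 2
  have hF0 := F.zero_constantCoeff
  have hFu := F.lin_coeff_X
  have hFv := F.lin_coeff_Y
  rw [coeff_single_one_eq] at hFu hFv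
  have huv : MvPowerSeries.pderiv R 1 (varU R) = 0 := MvPowerSeries.pderiv_X_of_ne (by decide)
  have hvu : MvPowerSeries.pderiv R 0 (varV R) = 0 := MvPowerSeries.pderiv_X_of_ne (by decide)
  simp only [map_sub, map_mul, map_pow, Derivation.leibniz, Derivation.leibniz_pow, smul_eq_mul,
      nsmul_eq_mul, map_add, MvPowerSeries.pderiv_C, MvPowerSeries.pderiv_X_self, huv, hvu, hn, hn',
      hF0, hFu, hFv, MvPowerSeries.constantCoeff_X, MvPowerSeries.constantCoeff_C,
      Nat.add_one_sub_one, pow_one, Nat.cast_ofNat, map_zero, map_one, map_ofNat] at hf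
  have h8 : (2 * 2 * 2 : R) * a₃ = 0 := by linear_combination hf
  exact ((h2.mul h2).mul h2).mul_right_eq_zero.mp h8

theorem inKricheverClass_lawBc_iff [Algebra ℚ R] (a₁ a₂ a₃ : R) :
    InKricheverClass (lawBc a₁ a₂ a₃) ↔ a₃ = 0 := by
  refine ⟨eq_zero_of_inKricheverClass_lawBc, ?_⟩
  rintro rfl
  exact ⟨1, sqrtQ a₁ a₂ 0, by rw [constantCoeff_sqrtQ]; exact isUnit_one,
    hasFractionForm_lawBc_zero isUnit_two a₁ a₂⟩

/-- With l₁ = 1 the second-order term of the expansion is an Euler-type equation 4Q − XQ' = 4 + 4bX²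
for Q = S², whose solutions are polynomials in X² of degree at most two. Then S = √Q is the
reciprocal of g'. -/
theorem exists_isOchanine_of_hasFractionForm_one [Algebra ℚ R] {F : FormalGroup R}
    {l₂ : PowerSeries R} (h : HasFractionForm F.toPowerSeries 1 l₂) :
    ∃ δ ε : R, IsOchanine F δ ε := by
  have h2 : IsUnit (2 : R) := isUnit_two
  obtain ⟨e0, e1, e2⟩ := hasFractionForm_expansion h
  have hdd := atZeroV_pderiv_pderiv F
  set S := linearPart F.toPowerSeries with hS
  have hS1 : PowerSeries.constantCoeff S = 1 := constantCoeff_linearPart F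
  have hone1 : PowerSeries.coeff 1 (1 : PowerSeries R) = 0 := by simp [PowerSeries.coeff_one]
  have hone2 : PowerSeries.coeff 2 (1 : PowerSeries R) = 0 := by simp [PowerSeries.coeff_one]
  rw [map_one] at e0
  have hC0 : PowerSeries.C (0 : R) = 0 := map_zero _
  have hC1 : PowerSeries.C (1 : R) = 1 := map_one _
  rw [← e0, hone1, hC0, hC1, mul_zero, one_mul, zero_sub] at e1
  rw [← e0, hone1, hone2, hC0, hC1, mul_zero, one_mul, zero_sub, zero_sub] at e2
  have hs1 : PowerSeries.coeff 1 S = 0 := by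
    have := congrArg (PowerSeries.coeff 1) e1
    rw [map_sub, map_neg, mul_comm, PowerSeries.coeff_C_mul, PowerSeries.coeff_one_X, mul_one,
      sub_self] at this
    linear_combination this
  rw [hs1, map_zero, mul_zero, sub_zero] at hdd
  rw [hdd] at e2
  set Q := S ^ 2 with hQ
  have hdQ : PowerSeries.derivative R Q = 2 * S * PowerSeries.derivative R S := by
    rw [hQ, PowerSeries.derivative_pow]
    push_cast
    ring
  set b := PowerSeries.coeff 2 l₂
  have hmain : PowerSeries.C 4 * Q - PowerSeries.X * PowerSeries.derivative R Q =
      PowerSeries.C 4 + PowerSeries.C (4 * b) * PowerSeries.X ^ 2 := by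
    rw [hdQ, map_mul, map_ofNat]
    rw [map_neg] at e2
    linear_combination -2 * e2 + 4 * hQ
  -- The coefficient of Xⁿ in 4Q − XQ' is (4 − n)q_n, so only q₄ remains free.
  have hcoeff : ∀ n : ℕ, n ≠ 0 → n ≠ 2 → n ≠ 4 → PowerSeries.coeff n Q = 0 := by
    intro n h0 h2 h4
    have := congrArg (PowerSeries.coeff n) hmain
    obtain ⟨m, rfl⟩ := Nat.exists_eq_succ_of_ne_zero h0
    rw [Nat.succ_eq_add_one, map_sub, map_add, PowerSeries.coeff_C_mul,
      PowerSeries.coeff_succ_X_mul, PowerSeries.coeff_derivative, PowerSeries.coeff_C_mul,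
      PowerSeries.coeff_X_pow, if_neg (by simpa using h2), PowerSeries.coeff_C,
      if_neg (by simp), mul_zero, add_zero] at this
    have hq : IsUnit (algebraMap ℚ R (4 - (m + 1))) := by
      refine (IsUnit.mk0 _ ?_).map _
      intro hm
      apply h4
      have : ((m + 1 : ℕ) : ℚ) = 4 := by push_cast; linarith
      exact_mod_cast this
    apply hq.mul_right_eq_zero.mp
    rw [map_sub, map_add, map_natCast, map_ofNat, map_one]
    linear_combination this
  have hQS : Q = evenSextic (PowerSeries.coeff 2 Q) (PowerSeries.coeff 4 Q) 0 := by
    ext n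
    simp only [evenSextic, map_add, PowerSeries.coeff_C_mul, PowerSeries.coeff_X_pow,
      PowerSeries.coeff_one, map_zero, zero_mul]
    by_cases h0 : n = 0
    · subst h0
      simp [hQ, hS1]
    by_cases h2 : n = 2
    · subst h2; simp
    by_cases h4 : n = 4
    · subst h4; simp
    · rw [hcoeff n h0 h2 h4]
      simp [h0, h2, h4]
  refine ⟨-((1 / 2 : ℚ) • PowerSeries.coeff 2 Q), PowerSeries.coeff 4 Q, ?_⟩
  have hδ : -2 * -((1 / 2 : ℚ) • PowerSeries.coeff 2 Q) = PowerSeries.coeff 2 Q := by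
    rw [neg_mul_neg, mul_smul_comm, ← smul_mul_assoc]
    have : (1 / 2 : ℚ) • (2 : R) = 1 := by
      rw [Algebra.smul_def, ← map_ofNat (algebraMap ℚ R), ← map_mul]
      norm_num
    rw [this, one_mul]
  rw [IsOchanine, hδ, abelianIntegral, ← hQS]
  have hQ1 : MvPowerSeries.constantCoeff Q = 1 := by
    rw [hQS, constantCoeff_evenSextic]
  refine isLogarithm_of_derivative_mul (constantCoeff_formalIntegral _) ?_
  rw [derivative_formalIntegral, ← hS]
  have : S = sqrtSeries Q := eq_of_sq_eq_sq h2 hS1 (constantCoeff_sqrtSeries hQ1)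
    (sqrtSeries_sq h2 hQ1).symm
  rw [this]
  exact invSqrt_mul_sqrtSeries h2 hQ1

theorem logBc_eq_abelianIntegral [Algebra ℚ R] (a₁ a₂ a₃ : R) :
    logBc a₁ a₂ a₃ = abelianIntegral (-a₁) a₂ (-a₃) := rfl

theorem exists_isOchanine_iff_lawBc [Algebra ℚ R] (F : FormalGroup R) :
    (∃ δ ε : R, IsOchanine F δ ε) ↔ ∃ b₁ b₂ : R, F.toPowerSeries = lawBc b₁ b₂ 0 := by
  constructor
  · rintro ⟨δ, ε, h⟩
    refine ⟨2 * δ, ε, ?_⟩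
    obtain ⟨G, hG, -, hlog⟩ := exists_formalGroup_lawBc (2 * δ) ε 0
    rw [logBc_eq_abelianIntegral, neg_zero, ← neg_mul] at hlog
    rw [isLogarithm_unique h hlog, hG]
  · rintro ⟨b₁, b₂, h⟩
    refine exists_isOchanine_of_hasFractionForm_one (l₂ := sqrtQ b₁ b₂ 0) ?_
    rw [h]
    exact hasFractionForm_lawBc_zero isUnit_two b₁ b₂

theorem exists_isOchanine_iff_hasFractionForm_one [Algebra ℚ R] (F : FormalGroup R) :
    (∃ δ ε : R, IsOchanine F δ ε) ↔
      ∃ l₂ : PowerSeries R, HasFractionForm F.toPowerSeries 1 l₂ := by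
  constructor
  · intro h
    obtain ⟨b₁, b₂, h⟩ := (exists_isOchanine_iff_lawBc F).mp h
    refine ⟨sqrtQ b₁ b₂ 0, ?_⟩
    rw [h]
    exact hasFractionForm_lawBc_zero isUnit_two b₁ b₂
  · rintro ⟨l₂, h⟩
    exact exists_isOchanine_of_hasFractionForm_one h

theorem inKricheverClass_and_lawBc_iff [Algebra ℚ R] (F : FormalGroup R) :
    (InKricheverClass F.toPowerSeries ∧ ∃ b₁ b₂ b₃ : R, F.toPowerSeries = lawBc b₁ b₂ b₃) ↔
      ∃ δ ε : R, IsOchanine F δ ε := by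
  rw [exists_isOchanine_iff_lawBc]
  constructor
  · rintro ⟨hk, b₁, b₂, b₃, h⟩
    rw [h, inKricheverClass_lawBc_iff] at hk
    exact ⟨b₁, b₂, by rw [h, hk]⟩
  · rintro ⟨b₁, b₂, h⟩
    exact ⟨by rw [h, inKricheverClass_lawBc_iff], b₁, b₂, 0, h⟩

end FractionForm

/-! ### Odd series and the abelian integral -/

section Odd

variable {R : Type u} [CommRing R]

theorem constantCoeff_X_sq : PowerSeries.constantCoeff ((PowerSeries.X : PowerSeries R) ^ 2) = 0 := by
  simp

theorem subst_X_sq_injective {p q : PowerSeries R}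
    (h : p.subst (PowerSeries.X ^ 2 : PowerSeries R) = q.subst (PowerSeries.X ^ 2 : PowerSeries R)) :
    p = q := by
  ext n
  have := congrArg (PowerSeries.coeff (2 * n)) h
  rw [PowerSeries.coeff_subst_X_pow (by norm_num), PowerSeries.coeff_subst_X_pow (by norm_num)]
    at this
  simpa using this

theorem exists_eq_X_mul_subst_sq [Algebra ℚ R] {p : PowerSeries R}
    (h : p.subst (-PowerSeries.X : PowerSeries R) = -p) :
    ∃ κ : PowerSeries R, p = PowerSeries.X * κ.subst (PowerSeries.X ^ 2 : PowerSeries R) := by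
  have h2 : IsUnit (2 : R) := isUnit_two
  have hr : PowerSeries.rescale (-1 : R) p = -p := by
    rw [PowerSeries.rescale_eq_subst, neg_one_smul, h]
  refine ⟨PowerSeries.mk fun n => PowerSeries.coeff (2 * n + 1) p, ?_⟩
  ext n
  rcases Nat.even_or_odd' n with ⟨m, rfl | rfl⟩
  · have := congrArg (PowerSeries.coeff (2 * m)) hr
    rw [PowerSeries.coeff_rescale, map_neg, pow_mul, neg_one_sq, one_pow, one_mul] at this
    have h0 : PowerSeries.coeff (2 * m) p = 0 := by
      apply h2.mul_right_eq_zero.mp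
      linear_combination this
    rw [h0]
    rcases m with _ | m
    · simp
    · rw [show 2 * (m + 1) = 2 * m + 1 + 1 by ring, PowerSeries.coeff_succ_X_mul,
        PowerSeries.coeff_subst_X_pow (by norm_num), if_neg (by omega)]
  · rw [PowerSeries.coeff_succ_X_mul, PowerSeries.coeff_subst_X_pow (by norm_num),
      if_pos (by simp)]
    simp

theorem derivative_X_mul_subst_sq (κ : PowerSeries R) :
    PowerSeries.derivative R (PowerSeries.X * κ.subst (PowerSeries.X ^ 2 : PowerSeries R)) =
      (κ + 2 * PowerSeries.X * PowerSeries.derivative R κ).subst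
        (PowerSeries.X ^ 2 : PowerSeries R) := by
  have hs := PowerSeries.HasSubst.of_constantCoeff_zero' (constantCoeff_X_sq (R := R))
  rw [Derivation.leibniz, PowerSeries.derivative_subst hs, PowerSeries.derivative_X,
    PowerSeries.derivative_pow, PowerSeries.derivative_X, smul_eq_mul, smul_eq_mul,
    ← PowerSeries.coe_substAlgHom hs, map_add, map_mul, map_mul, PowerSeries.substAlgHom_X,
    map_ofNat]
  push_cast
  ring

/-- The series `1 + b₁ Y + b₂ Y² + b₃ Y³`. -/
noncomputable def cubicSeries (b₁ b₂ b₃ : R) : PowerSeries R :=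
  1 + PowerSeries.C b₁ * PowerSeries.X + PowerSeries.C b₂ * PowerSeries.X ^ 2
    + PowerSeries.C b₃ * PowerSeries.X ^ 3

theorem constantCoeff_cubicSeries (b₁ b₂ b₃ : R) :
    MvPowerSeries.constantCoeff (cubicSeries b₁ b₂ b₃) = 1 := by
  change PowerSeries.constantCoeff (cubicSeries b₁ b₂ b₃) = 1
  simp [cubicSeries]

theorem cubicSeries_subst {τ : Type*} {Z : MvPowerSeries τ R}
    (hZ : MvPowerSeries.constantCoeff Z = 0) (b₁ b₂ b₃ : R) :
    (cubicSeries b₁ b₂ b₃).subst Z =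
      1 + MvPowerSeries.C b₁ * Z + MvPowerSeries.C b₂ * Z ^ 2 + MvPowerSeries.C b₃ * Z ^ 3 := by
  have hs := PowerSeries.HasSubst.of_constantCoeff_zero hZ
  rw [cubicSeries, PowerSeries.subst_add hs, PowerSeries.subst_add hs, PowerSeries.subst_add hs,
    PowerSeries.subst_mul hs, PowerSeries.subst_mul hs, PowerSeries.subst_mul hs,
    PowerSeries.subst_pow hs, PowerSeries.subst_pow hs,
    PowerSeries.subst_X hs, PowerSeries.subst_C, PowerSeries.subst_C, PowerSeries.subst_C,
    ← PowerSeries.coe_substAlgHom hs, map_one]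

theorem invSqrt_powerSeries_subst (h2 : IsUnit (2 : R)) {h : PowerSeries R}
    (hh : PowerSeries.constantCoeff h = 1) {τ : Type} {Z : MvPowerSeries τ R}
    (hZ : MvPowerSeries.constantCoeff Z = 0) :
    PowerSeries.subst Z (invSqrt h) = invSqrt (h.subst Z) :=
  invSqrt_subst h2 hh (PowerSeries.HasSubst.of_constantCoeff_zero hZ).const fun _ => hZ

theorem constantCoeff_neg_X : PowerSeries.constantCoeff (-PowerSeries.X : PowerSeries R) = 0 := by
  simp

theorem AreCompInverse.odd {f s : PowerSeries R} (h : AreCompInverse f s)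
    (hf : f.subst (-PowerSeries.X : PowerSeries R) = -f) :
    s.subst (-PowerSeries.X : PowerSeries R) = -s := by
  have hss := PowerSeries.HasSubst.of_constantCoeff_zero' h.2.1
  have hn := PowerSeries.HasSubst.of_constantCoeff_zero' (constantCoeff_neg_X (R := R))
  have hns : PowerSeries.constantCoeff (-s) = 0 := by rw [map_neg, h.2.1, neg_zero]
  have h1 := congrArg (PowerSeries.subst s) hf
  rw [PowerSeries.subst_comp_subst_apply hn hss, ← PowerSeries.coe_substAlgHom hss, map_neg,
    map_neg, PowerSeries.substAlgHom_X, PowerSeries.coe_substAlgHom, h.2.2.1] at h1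
  have h2 := h.symm.subst_subst hns
  rw [h1] at h2
  exact h2

/-- The four extreme terms of the convolution contain the coefficients 1 and 0 of N; the inner terms
form the sum of the recurrence of `wpCoeff`. -/
theorem coeff_sq_add_four {N : PowerSeries R} (h0 : PowerSeries.coeff 0 N = 1)
    (h1 : PowerSeries.coeff 1 N = 0) (m : ℕ) :
    PowerSeries.coeff (m + 4) (N ^ 2) = 2 * PowerSeries.coeff (m + 4) N +
      ∑ i ∈ Finset.range (m + 1), PowerSeries.coeff (i + 2) N * PowerSeries.coeff (m - i + 2) N := by
  rw [sq, PowerSeries.coeff_mul, Finset.Nat.sum_antidiagonal_eq_sum_range_succ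
    (fun i j => PowerSeries.coeff i N * PowerSeries.coeff j N), Finset.sum_range_succ,
    Finset.sum_range_succ, Finset.sum_range_succ', Finset.sum_range_succ']
  have e : ∑ k ∈ Finset.range (m + 1), PowerSeries.coeff (k + 1 + 1) N *
      PowerSeries.coeff (m + 4 - (k + 1 + 1)) N =
      ∑ i ∈ Finset.range (m + 1), PowerSeries.coeff (i + 2) N *
        PowerSeries.coeff (m - i + 2) N := by
    refine Finset.sum_congr rfl fun k hk => ?_
    rw [Finset.mem_range] at hk
    rw [show m + 4 - (k + 1 + 1) = m - k + 2 by omega]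
  rw [e]
  simp [h0, h1]
  ring

variable [Algebra ℚ R]

/-- The series `k` with `∫₀ˢ dt / √(1 + b₁ t² + b₂ t⁴ + b₃ t⁶) = s k(s²)`. -/
noncomputable def reducedIntegral (b₁ b₂ b₃ : R) : PowerSeries R :=
  PowerSeries.mk fun n => ((2 * n + 1 : ℚ)⁻¹) •
    PowerSeries.coeff n (invSqrt (cubicSeries b₁ b₂ b₃) : PowerSeries R)

/-- This is d/ds (s k(s²)) = P(s)^(−1/2) with X in place of s²; the operator 1 + 2X d/dX multiplies
the coefficient of Xⁿ by 2n + 1. -/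
theorem reducedIntegral_add (b₁ b₂ b₃ : R) :
    reducedIntegral b₁ b₂ b₃ +
      2 * PowerSeries.X * PowerSeries.derivative R (reducedIntegral b₁ b₂ b₃) =
      invSqrt (cubicSeries b₁ b₂ b₃) := by
  have key : ∀ (n : ℕ) (r : R),
      (1 + 2 * (n : R)) * ((2 * n + 1 : ℚ)⁻¹ • r) = r := by
    intro n r
    rw [Algebra.smul_def, ← mul_assoc]
    have e : (1 + 2 * (n : R)) = algebraMap ℚ R (2 * n + 1) := by
      rw [map_add, map_mul, map_ofNat, map_natCast, map_one, add_comm]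
    rw [e, ← map_mul, mul_inv_cancel₀ (by positivity), map_one, one_mul]
  have h2 : (2 : PowerSeries R) = PowerSeries.C 2 := (map_ofNat PowerSeries.C 2).symm
  ext n
  rw [map_add, h2, mul_assoc, PowerSeries.coeff_C_mul]
  rcases n with _ | n
  · rw [reducedIntegral, PowerSeries.coeff_mk]
    simp
  · rw [PowerSeries.coeff_succ_X_mul, PowerSeries.coeff_derivative, reducedIntegral,
      PowerSeries.coeff_mk]
    have := key (n + 1) (PowerSeries.coeff (n + 1) (invSqrt (cubicSeries b₁ b₂ b₃) : PowerSeries R))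
    push_cast at this ⊢
    linear_combination this

theorem abelianIntegral_eq (b₁ b₂ b₃ : R) :
    abelianIntegral b₁ b₂ b₃ =
      PowerSeries.X * (reducedIntegral b₁ b₂ b₃).subst (PowerSeries.X ^ 2 : PowerSeries R) := by
  have : IsAddTorsionFree R := .of_module_rat R
  apply PowerSeries.derivative.ext
  · rw [abelianIntegral, derivative_formalIntegral, derivative_X_mul_subst_sq, reducedIntegral_add,
      invSqrt_powerSeries_subst isUnit_two (constantCoeff_cubicSeries _ _ _) constantCoeff_X_sq,
      cubicSeries_subst constantCoeff_X_sq]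
    congr 1
    rw [evenSextic, ← pow_mul, ← pow_mul]
    rfl
  · rw [abelianIntegral, constantCoeff_formalIntegral]
    simp

/-- Replacing t by it changes the signs of b₁ and b₃. In the variable t² this is X ↦ −X, which needs
no square root of −1 in `R`. -/
theorem reducedIntegral_neg (b₁ b₂ b₃ : R) :
    reducedIntegral (-b₁) b₂ (-b₃) = PowerSeries.rescale (-1) (reducedIntegral b₁ b₂ b₃) := by
  have hc : cubicSeries (-b₁) b₂ (-b₃) =
      (cubicSeries b₁ b₂ b₃).subst ((-1 : R) • PowerSeries.X : PowerSeries R) := by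
    rw [← PowerSeries.rescale_eq_subst]
    simp only [cubicSeries, map_add, map_mul, map_pow, map_one, PowerSeries.rescale_X, map_neg]
    have : ∀ r : R, PowerSeries.rescale (-1 : R) (PowerSeries.C r) = PowerSeries.C r := fun r => by
      ext n
      rw [PowerSeries.coeff_rescale, PowerSeries.coeff_C]
      split_ifs with h <;> simp [h]
    rw [this, this, this]
    ring
  have hz : MvPowerSeries.constantCoeff ((-1 : R) • PowerSeries.X : PowerSeries R) = 0 := by
    change PowerSeries.constantCoeff _ = 0
    simp
  have hq : (invSqrt (cubicSeries (-b₁) b₂ (-b₃)) : PowerSeries R) =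
      PowerSeries.rescale (-1) (invSqrt (cubicSeries b₁ b₂ b₃) : PowerSeries R) := by
    rw [hc, PowerSeries.rescale_eq_subst,
      invSqrt_powerSeries_subst isUnit_two (constantCoeff_cubicSeries _ _ _) hz]
  ext n
  rw [PowerSeries.coeff_rescale, reducedIntegral, reducedIntegral, PowerSeries.coeff_mk,
    PowerSeries.coeff_mk, hq, PowerSeries.coeff_rescale, mul_smul_comm]

theorem abelianIntegral_odd (b₁ b₂ b₃ : R) :
    (abelianIntegral b₁ b₂ b₃).subst (-PowerSeries.X : PowerSeries R) =
      -abelianIntegral b₁ b₂ b₃ := by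
  have hs := PowerSeries.HasSubst.of_constantCoeff_zero' (constantCoeff_neg_X (R := R))
  have hs2 := PowerSeries.HasSubst.of_constantCoeff_zero' (constantCoeff_X_sq (R := R))
  rw [abelianIntegral_eq, PowerSeries.subst_mul hs, PowerSeries.subst_X hs,
    PowerSeries.subst_comp_subst_apply hs2 hs, PowerSeries.subst_pow hs, PowerSeries.subst_X hs,
    neg_sq, neg_mul]

theorem constantCoeff_abelianIntegral (b₁ b₂ b₃ : R) :
    PowerSeries.constantCoeff (abelianIntegral b₁ b₂ b₃) = 0 :=
  constantCoeff_formalIntegral _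

theorem coeff_one_abelianIntegral (b₁ b₂ b₃ : R) :
    PowerSeries.coeff 1 (abelianIntegral b₁ b₂ b₃) = 1 := by
  rw [abelianIntegral, coeff_one_formalIntegral]
  exact constantCoeff_invSqrt (constantCoeff_evenSextic _ _ _)

end Odd

/-! ### The Weierstrass series -/

section Weierstrass

variable {R : Type u} [CommRing R] [Algebra ℚ R]

/-- The series `N` with `℘(z) = z⁻² N(z²)`. -/
noncomputable def wpReduced (g₂ g₃ : R) : PowerSeries R :=
  PowerSeries.mk fun n => if n = 0 then 1 else wpCoeff g₂ g₃ n

theorem ofPowerSeries_X_sq_mul_wpSeries (g₂ g₃ : R) :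
    HahnSeries.ofPowerSeries ℤ R (PowerSeries.X ^ 2) * wpSeries g₂ g₃ =
      HahnSeries.ofPowerSeries ℤ R
        ((wpReduced g₂ g₃).subst (PowerSeries.X ^ 2 : PowerSeries R)) := by
  have h : (wpReduced g₂ g₃).subst (PowerSeries.X ^ 2 : PowerSeries R) =
      1 + PowerSeries.X ^ 2 *
        PowerSeries.mk fun n => if Even n then wpCoeff g₂ g₃ (n / 2 + 1) else 0 := by
    ext n
    rw [PowerSeries.coeff_subst_X_pow (by norm_num), map_add, PowerSeries.coeff_one,
      PowerSeries.coeff_X_pow_mul']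
    rcases n with _ | _ | n
    · simp [wpReduced]
    · simp
    · rw [if_neg (show ¬ n + 1 + 1 = 0 by omega), if_pos (show 2 ≤ n + 1 + 1 by omega), zero_add,
        PowerSeries.coeff_mk,
        show n + 1 + 1 - 2 = n by omega, show (n + 1 + 1) / 2 = n / 2 + 1 by omega]
      by_cases he : Even n
      · rw [if_pos he, if_pos (by obtain ⟨k, rfl⟩ := he; omega)]
        simp [wpReduced]
      · rw [if_neg he, if_neg (by
          intro hd
          apply he
          rw [Nat.even_iff]
          omega)]
  rw [h, map_add, map_mul, map_one, wpSeries, mul_add, HahnSeries.ofPowerSeries_X_pow,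
    HahnSeries.single_mul_single]
  norm_num

/-- With ℘(z) = z⁻²N(z²) one has ℘' = 2z⁻³(XN' − N) at X = z², so the hypothesis is the Weierstrass
equation. Its derivative is a second-order equation quadratic in N, whose coefficients give the
recurrence. -/
theorem eq_wpReduced {N : PowerSeries R} {g₂ g₃ : R} (h0 : PowerSeries.constantCoeff N = 1)
    (h : 4 * (PowerSeries.X * PowerSeries.derivative R N - N) ^ 2 =
      4 * N ^ 3 - PowerSeries.C g₂ * PowerSeries.X ^ 2 * N - PowerSeries.C g₃ * PowerSeries.X ^ 3) :
    N = wpReduced g₂ g₃ := by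
  have h2 : IsUnit (2 : R) := isUnit_two
  have hq : ∀ {q : ℚ}, q ≠ 0 → ∀ {x y : R}, algebraMap ℚ R q * x = algebraMap ℚ R q * y → x = y :=
    fun {q} hq0 {x y} hxy => ((IsUnit.mk0 q hq0).map (algebraMap ℚ R)).mul_left_cancel hxy
  have h0' : PowerSeries.coeff 0 N = 1 := by
    rw [PowerSeries.coeff_zero_eq_constantCoeff_apply, h0]
  have hode : 4 * (2 * (PowerSeries.X * (PowerSeries.X *
      PowerSeries.derivative R (PowerSeries.derivative R N))) -
      3 * (PowerSeries.X * PowerSeries.derivative R N) + 3 * N) =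
      12 * N ^ 2 - PowerSeries.C g₂ * PowerSeries.X ^ 2 := by
    have hd := congrArg (PowerSeries.derivative R) h
    have hd4 : PowerSeries.derivative R (4 : PowerSeries R) = 0 := Derivation.map_natCast _ 4
    simp only [map_sub, Derivation.leibniz, Derivation.leibniz_pow, smul_eq_mul, nsmul_eq_mul,
      PowerSeries.derivative_C, PowerSeries.derivative_X, hd4] at hd
    push_cast at hd
    have hA : IsUnit (PowerSeries.X * PowerSeries.derivative R N - N) :=
      isUnit_of_constantCoeff (by
        change IsUnit (PowerSeries.constantCoeff _)
        simp [h0])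
    apply hA.mul_left_cancel
    -- X d/dX − 3 annihilates g₃X³; what remains is divisible by XN' − N, a unit with constant term
    -- −1.
    linear_combination PowerSeries.X * hd - 3 * h
  have hco : ∀ n, PowerSeries.coeff n (PowerSeries.X * PowerSeries.derivative R N) =
      n * PowerSeries.coeff n N := by
    intro n
    rcases n with _ | n
    · simp
    · rw [PowerSeries.coeff_succ_X_mul, PowerSeries.coeff_derivative, mul_comm]
      push_cast
      rfl
  have hco2 : ∀ n, PowerSeries.coeff n (PowerSeries.X * (PowerSeries.X *
      PowerSeries.derivative R (PowerSeries.derivative R N))) =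
      n * (n - 1) * PowerSeries.coeff n N := by
    intro n
    rcases n with _ | _ | n
    · simp
    · simp
    · rw [PowerSeries.coeff_succ_X_mul, PowerSeries.coeff_succ_X_mul, PowerSeries.coeff_derivative,
        PowerSeries.coeff_derivative]
      push_cast
      ring
  have hrec : ∀ n : ℕ, 4 * (2 * (n * (n - 1)) - 3 * n + 3) * PowerSeries.coeff n N =
      12 * PowerSeries.coeff n (N ^ 2) - (if n = 2 then g₂ else 0) := by
    intro n
    have := congrArg (PowerSeries.coeff n) hode
    have e4 : (4 : PowerSeries R) = PowerSeries.C 4 := (map_ofNat PowerSeries.C 4).symm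
    have e2 : (2 : PowerSeries R) = PowerSeries.C 2 := (map_ofNat PowerSeries.C 2).symm
    have e3 : (3 : PowerSeries R) = PowerSeries.C 3 := (map_ofNat PowerSeries.C 3).symm
    have e12 : (12 : PowerSeries R) = PowerSeries.C 12 := (map_ofNat PowerSeries.C 12).symm
    rw [e2, e3, e4, e12] at this
    simp only [map_sub, map_add, PowerSeries.coeff_C_mul, hco, hco2, PowerSeries.coeff_X_pow]
      at this
    rw [mul_ite, mul_one, mul_zero] at this
    linear_combination this
  have c1 : PowerSeries.coeff 1 N = 0 := by
    have := hrec 1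
    simp [sq, PowerSeries.coeff_mul, Finset.Nat.antidiagonal_succ, h0] at this
    apply hq (q := 24) (by norm_num)
    rw [map_ofNat]
    linear_combination -this
  have c2 : PowerSeries.coeff 2 N = (1 / 20 : ℚ) • g₂ := by
    have := hrec 2
    simp [sq, PowerSeries.coeff_mul, Finset.Nat.antidiagonal_succ, h0, c1] at this
    apply hq (q := 20) (by norm_num)
    rw [Algebra.smul_def, ← mul_assoc, ← map_mul, map_ofNat]
    norm_num
    linear_combination -this
  -- After the terms 2c_n of N² are moved to the left, the recurrence has factor 4(2n + 1)(n − 3),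
  -- which is zero at n = 3. Hence c₃ is taken from the first-order equation, the only one that
  -- contains g₃.
  have c3 : PowerSeries.coeff 3 N = (1 / 28 : ℚ) • g₃ := by
    have e4 : (4 : PowerSeries R) = PowerSeries.C 4 := (map_ofNat PowerSeries.C 4).symm
    rw [e4] at h
    have := congrArg (PowerSeries.coeff 3) h
    rw [map_sub, map_sub, PowerSeries.coeff_C_mul, PowerSeries.coeff_C_mul, PowerSeries.coeff_C_mul,
      PowerSeries.coeff_X_pow_self, mul_assoc, PowerSeries.coeff_C_mul,
      PowerSeries.coeff_X_pow_mul', sq, pow_three, PowerSeries.coeff_mul, PowerSeries.coeff_mul]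
      at this
    simp [PowerSeries.coeff_mul, Finset.Nat.antidiagonal_succ, h0, c1,
      hco] at this
    apply hq (q := 28) (by norm_num)
    rw [Algebra.smul_def, ← mul_assoc, ← map_mul, map_ofNat]
    norm_num
    linear_combination -this
  ext n
  induction n using Nat.strong_induction_on with
  | _ n ih =>
    rcases n with _ | _ | _ | _ | m
    · simp [wpReduced, h0]
    · simp [wpReduced, c1, wpCoeff]
    · simp [wpReduced, c2, wpCoeff]
    · simp [wpReduced, c3, wpCoeff]
    · have hm := hrec (m + 4)
      rw [coeff_sq_add_four h0' c1, if_neg (by omega)] at hm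
      have hsum : ∑ i ∈ Finset.range (m + 1),
          PowerSeries.coeff (i + 2) N * PowerSeries.coeff (m - i + 2) N =
          ∑ i : Fin (m + 1), wpCoeff g₂ g₃ (i.1 + 2) * wpCoeff g₂ g₃ (m - i.1 + 2) := by
        rw [Fin.sum_univ_eq_sum_range
          (fun i => wpCoeff g₂ g₃ (i + 2) * wpCoeff g₂ g₃ (m - i + 2))]
        refine Finset.sum_congr rfl fun i hi => ?_
        rw [Finset.mem_range] at hi
        rw [ih (i + 2) (by omega), ih (m - i + 2) (by omega)]
        simp [wpReduced]
      rw [hsum] at hm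
      have hw : PowerSeries.coeff (m + 4) (wpReduced g₂ g₃) = wpCoeff g₂ g₃ (m + 4) := by
        simp [wpReduced]
      rw [show m + 1 + 1 + 1 + 1 = m + 4 by ring, hw, wpCoeff]
      set T := ∑ i : Fin (m + 1), wpCoeff g₂ g₃ (i.1 + 2) * wpCoeff g₂ g₃ (m - i.1 + 2)
      -- The factor 4(2n + 1)(n − 3) at n = m + 4.
      have hne : (4 * ((2 * (m : ℚ) + 9) * ((m : ℚ) + 1))) ≠ 0 := by positivity
      apply hq hne
      rw [Algebra.smul_def, ← mul_assoc (algebraMap ℚ R _) (algebraMap ℚ R _), ← map_mul]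
      have e : (4 * ((2 * (m : ℚ) + 9) * ((m : ℚ) + 1))) *
          (3 / ((2 * (m : ℚ) + 9) * ((m : ℚ) + 1))) = 12 := by
        field_simp
        norm_num
      rw [e, map_mul, map_mul, map_add, map_add, map_mul, map_natCast, map_one, map_ofNat,
        map_ofNat, map_ofNat, map_ofNat]
      push_cast at hm
      linear_combination hm

theorem algebraMap_third : 3 * algebraMap ℚ R (1 / 3) = 1 := by
  rw [← map_ofNat (algebraMap ℚ R) 3, ← map_mul]
  norm_num

/-- Write s = Xκ(X²). The series N = κ⁻² + (b₁/3)X satisfies the reduced Weierstrass equation, hence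
is `wpReduced`, and s²(℘ − b₁/3) = 1 is the definition of N read backwards. -/
theorem inverse_sq_mul_wpSeries {b₁ b₂ b₃ : R} {s : PowerSeries R}
    (hs : AreCompInverse (abelianIntegral b₁ b₂ b₃) s) :
    HahnSeries.ofPowerSeries ℤ R (s ^ 2) *
          (wpSeries (invariant₂ b₁ b₂) (invariant₃ b₁ b₂ b₃)
            - HahnSeries.C ((1 / 3 : ℚ) • b₁)) = 1 := by
  have h2 : IsUnit (2 : R) := isUnit_two
  have hX := PowerSeries.HasSubst.of_constantCoeff_zero' (constantCoeff_X_sq (R := R))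
  obtain ⟨κ, hκ⟩ := exists_eq_X_mul_subst_sq (hs.odd (abelianIntegral_odd b₁ b₂ b₃))
  have hκ0 : PowerSeries.constantCoeff κ = 1 := by
    have h1 := hs.coeff_one_mul
    rw [coeff_one_abelianIntegral, one_mul, hκ, ← zero_add 1, PowerSeries.coeff_succ_X_mul,
      PowerSeries.coeff_subst_X_pow (by norm_num)] at h1
    simpa using h1
  have hds : PowerSeries.derivative R s ^ 2 = 1 + PowerSeries.C b₁ * s ^ 2 +
      PowerSeries.C b₂ * s ^ 4 + PowerSeries.C b₃ * s ^ 6 := by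
    have hss := PowerSeries.HasSubst.of_constantCoeff_zero' hs.2.1
    rw [derivative_eq_of_areCompInverse_formalIntegral (constantCoeff_evenSextic _ _ _) hs.symm,
      ← PowerSeries.subst_pow hss, sqrtSeries_sq h2 (constantCoeff_evenSextic _ _ _),
      evenSextic_subst hs.2.1]
    rfl
  -- The equation s'² = P(s) in the variable X², where oddness of s makes all terms even.
  have hκode : (κ + 2 * PowerSeries.X * PowerSeries.derivative R κ) ^ 2 =
      1 + PowerSeries.C b₁ * PowerSeries.X * κ ^ 2 + PowerSeries.C b₂ * PowerSeries.X ^ 2 * κ ^ 4 +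
      PowerSeries.C b₃ * PowerSeries.X ^ 3 * κ ^ 6 := by
    apply subst_X_sq_injective
    have hC : ∀ r : R, PowerSeries.subst (PowerSeries.X ^ 2 : PowerSeries R) (PowerSeries.C r) =
      PowerSeries.C r := fun r => PowerSeries.subst_C r
    rw [PowerSeries.subst_pow hX, ← derivative_X_mul_subst_sq, ← hκ, hds, hκ,
      ← PowerSeries.coe_substAlgHom hX]
    simp only [map_add, map_mul, map_pow, map_one, PowerSeries.substAlgHom_X]
    simp only [PowerSeries.coe_substAlgHom, hC]
    ring
  have hκu : IsUnit κ := isUnit_of_constantCoeff (by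
    change IsUnit (PowerSeries.constantCoeff κ); rw [hκ0]; exact isUnit_one)
  obtain ⟨ι, hι⟩ := hκu.exists_right_inv
  have hι0 : PowerSeries.constantCoeff ι = 1 := by
    have := congrArg PowerSeries.constantCoeff hι
    simpa [hκ0] using this
  have hdι : PowerSeries.derivative R ι = -ι ^ 2 * PowerSeries.derivative R κ := by
    have := congrArg (PowerSeries.derivative R) hι
    rw [Derivation.leibniz, Derivation.map_one_eq_zero, smul_eq_mul, smul_eq_mul] at this
    linear_combination ι * this - PowerSeries.derivative R ι * hι
  set t := algebraMap ℚ R (1 / 3) with ht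
  have ht3 : 3 * t = 1 := algebraMap_third
  set N := ι ^ 2 + PowerSeries.C (t * b₁) * PowerSeries.X with hN
  have hN0 : PowerSeries.constantCoeff N = 1 := by simp [hN, hι0]
  have hθ : PowerSeries.X * PowerSeries.derivative R N - N =
      -ι ^ 3 * (κ + 2 * PowerSeries.X * PowerSeries.derivative R κ) := by
    rw [hN, map_add, Derivation.leibniz, Derivation.leibniz_pow, PowerSeries.derivative_C,
      PowerSeries.derivative_X, hdι]
    simp only [smul_eq_mul, nsmul_eq_mul]
    push_cast
    linear_combination ι ^ 2 * hι
  have hC3 : 3 * PowerSeries.C t = (1 : PowerSeries R) := by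
    rw [← map_ofNat (PowerSeries.C (R := R)) 3, ← map_mul, ht3, map_one]
  have hg₂ : PowerSeries.C (invariant₂ b₁ b₂) =
      4 * (PowerSeries.C t * PowerSeries.C b₁ ^ 2 - PowerSeries.C b₂) := by
    rw [invariant₂, Algebra.smul_def]
    simp only [map_mul, map_sub, map_pow, map_ofNat, ht]
  have hg₃ : PowerSeries.C (invariant₃ b₁ b₂ b₃) =
      4 * (PowerSeries.C t * (PowerSeries.C b₁ * PowerSeries.C b₂) -
        2 * PowerSeries.C t ^ 3 * PowerSeries.C b₁ ^ 3 - PowerSeries.C b₃) := by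
    have : algebraMap ℚ R (2 / 27) = 2 * t ^ 3 := by
      rw [ht, ← map_pow, ← map_ofNat (algebraMap ℚ R) 2, ← map_mul]
      norm_num
    rw [invariant₃, Algebra.smul_def, Algebra.smul_def, this]
    simp only [map_mul, map_sub, map_pow, map_ofNat, ht]
  -- Multiplying the equation of κ by κ⁻⁶ gives the cubic in κ⁻² with coefficients 1, b₁X, b₂X²,
  -- b₃X³; the shift N = κ⁻² + (b₁/3)X depresses it, and g₂, g₃ are its coefficients.
  have hNode : 4 * (PowerSeries.X * PowerSeries.derivative R N - N) ^ 2 =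
      4 * N ^ 3 - PowerSeries.C (invariant₂ b₁ b₂) * PowerSeries.X ^ 2 * N -
        PowerSeries.C (invariant₃ b₁ b₂ b₃) * PowerSeries.X ^ 3 := by
    have e : (-ι ^ 3 * (κ + 2 * PowerSeries.X * PowerSeries.derivative R κ)) ^ 2 =
        ι ^ 6 + PowerSeries.C b₁ * PowerSeries.X * ι ^ 4 +
        PowerSeries.C b₂ * PowerSeries.X ^ 2 * ι ^ 2 + PowerSeries.C b₃ * PowerSeries.X ^ 3 := by
      have p2 : κ ^ 2 * ι ^ 2 = 1 := by rw [← mul_pow, hι, one_pow]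
      have p4 : κ ^ 4 * ι ^ 4 = 1 := by rw [← mul_pow, hι, one_pow]
      have p6 : κ ^ 6 * ι ^ 6 = 1 := by rw [← mul_pow, hι, one_pow]
      linear_combination ι ^ 6 * hκode + PowerSeries.C b₁ * PowerSeries.X * ι ^ 4 * p2 +
        PowerSeries.C b₂ * PowerSeries.X ^ 2 * ι ^ 2 * p4 +
        PowerSeries.C b₃ * PowerSeries.X ^ 3 * p6
    rw [hθ, e, hg₂, hg₃, hN, map_mul]
    generalize PowerSeries.C t = T at hC3
    generalize PowerSeries.C b₁ = B₁
    generalize PowerSeries.C b₂ = B₂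
    generalize PowerSeries.C b₃ = B₃
    generalize (PowerSeries.X : PowerSeries R) = Y
    linear_combination (exp := 1) (-4 * B₁ * Y * ι ^ 4 - 4 * B₁ ^ 2 * Y ^ 2 * T * ι ^ 2 -
      4 * B₁ ^ 3 * Y ^ 3 * T ^ 2) * hC3
  have hNw := eq_wpReduced hN0 hNode
  have hs2 : s ^ 2 = (κ ^ 2).subst (PowerSeries.X ^ 2 : PowerSeries R) * PowerSeries.X ^ 2 := by
    rw [hκ, PowerSeries.subst_pow hX]
    ring
  have hCt : (HahnSeries.C ((1 / 3 : ℚ) • b₁) : LaurentSeries R) =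
      HahnSeries.ofPowerSeries ℤ R (PowerSeries.C (t * b₁)) := by
    rw [HahnSeries.ofPowerSeries_C, Algebra.smul_def]
  rw [hs2, map_mul, mul_assoc, mul_sub, ofPowerSeries_X_sq_mul_wpSeries, ← hNw, hCt, ← map_mul,
    ← map_sub, ← map_mul]
  have : PowerSeries.subst (PowerSeries.X ^ 2 : PowerSeries R) (κ ^ 2) *
      (N.subst (PowerSeries.X ^ 2 : PowerSeries R) - PowerSeries.X ^ 2 * PowerSeries.C (t * b₁)) =
      1 := by
    have hC : PowerSeries.subst (PowerSeries.X ^ 2 : PowerSeries R) (PowerSeries.C (t * b₁)) =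
      PowerSeries.C (t * b₁) := PowerSeries.subst_C _
    rw [hN, PowerSeries.subst_add hX, PowerSeries.subst_mul hX, PowerSeries.subst_X hX, hC,
      mul_comm (PowerSeries.C (t * b₁)), add_sub_cancel_right, ← PowerSeries.subst_mul hX,
      ← mul_pow, hι, one_pow, ← PowerSeries.coe_substAlgHom hX, map_one]
  rw [this, map_one]

end Weierstrass

/-! ### The modulus square of the law -/

section ModulusSquare

/-- The leading coefficient of `buchstaberPolynomial` in `z`. -/
def quadCoeff₂ {A : Type*} [CommRing A] (a₁ a₂ a₃ x y : A) : A :=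
  (1 - a₂ * x * y) ^ 2 - 4 * a₃ * x * y * (x + y + a₁ * x * y)

/-- The linear coefficient of `buchstaberPolynomial` in `z`. -/
def quadCoeff₁ {A : Type*} [CommRing A] (a₁ a₂ a₃ x y : A) : A :=
  2 * (x + y) * (1 - a₂ * x * y) - 4 * (x + y + a₁ * x * y) - 4 * a₃ * x ^ 2 * y ^ 2

theorem map_quadCoeff₂ {A B G : Type*} [CommRing A] [CommRing B] [FunLike G A B]
    [RingHomClass G A B] (φ : G) (a₁ a₂ a₃ x y : A) :
    φ (quadCoeff₂ a₁ a₂ a₃ x y) = quadCoeff₂ (φ a₁) (φ a₂) (φ a₃) (φ x) (φ y) := by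
  simp only [quadCoeff₂, map_sub, map_mul, map_add, map_pow, map_one, map_ofNat]

theorem map_quadCoeff₁ {A B G : Type*} [CommRing A] [CommRing B] [FunLike G A B]
    [RingHomClass G A B] (φ : G) (a₁ a₂ a₃ x y : A) :
    φ (quadCoeff₁ a₁ a₂ a₃ x y) = quadCoeff₁ (φ a₁) (φ a₂) (φ a₃) (φ x) (φ y) := by
  simp only [quadCoeff₁, map_sub, map_mul, map_add, map_pow, map_one, map_ofNat]

variable {R : Type u} [CommRing R]

theorem buchstaberPolynomial_eq (a₁ a₂ a₃ : R) :
    buchstaberPolynomial a₁ a₂ a₃ =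
      Polynomial.C (quadCoeff₂ (MvPowerSeries.C a₁) (MvPowerSeries.C a₂) (MvPowerSeries.C a₃)
        (varU R) (varV R)) * Polynomial.X ^ 2 +
      Polynomial.C (quadCoeff₁ (MvPowerSeries.C a₁) (MvPowerSeries.C a₂) (MvPowerSeries.C a₃)
        (varU R) (varV R)) * Polynomial.X +
      Polynomial.C ((varU R - varV R) ^ 2) := by
  rw [map_quadCoeff₂, map_quadCoeff₁, map_pow, map_sub, buchstaberPolynomial, quadCoeff₁,
    quadCoeff₂]
  ring

/-- These are Vieta's relations multiplied by the leading coefficient, which has constant term 1 and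
thus remains invertible after the substitution. -/
theorem isModulusSquareWith_iff {F : FormalGroup R} {i : PowerSeries R} (a₁ a₂ a₃ : R) :
    IsModulusSquareWith F i (buchstaberTwoValued a₁ a₂ a₃) ↔
      (F.toPowerSeries * F.toPowerSeries.subst ![atU i, atV i] +
          F.toPowerSeries.subst ![varU R, atV i] * F.toPowerSeries.subst ![atU i, varV R]) *
          quadCoeff₂ (MvPowerSeries.C a₁) (MvPowerSeries.C a₂) (MvPowerSeries.C a₃)
            (varU R * atU i) (varV R * atV i) =
        -quadCoeff₁ (MvPowerSeries.C a₁) (MvPowerSeries.C a₂) (MvPowerSeries.C a₃)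
            (varU R * atU i) (varV R * atV i) ∧
      F.toPowerSeries * F.toPowerSeries.subst ![atU i, atV i] *
          (F.toPowerSeries.subst ![varU R, atV i] * F.toPowerSeries.subst ![atU i, varV R]) *
          quadCoeff₂ (MvPowerSeries.C a₁) (MvPowerSeries.C a₂) (MvPowerSeries.C a₃)
            (varU R * atU i) (varV R * atV i) =
        (varU R * atU i - varV R * atV i) ^ 2 := by
  have hU : MvPowerSeries.constantCoeff (varU R * atU i) = 0 := by simp
  have hV : MvPowerSeries.constantCoeff (varV R * atV i) = 0 := by simp
  have hs := hasSubst_pair hU hV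
  have hC : ∀ r : R, MvPowerSeries.substAlgHom hs (MvPowerSeries.C r) = MvPowerSeries.C r :=
    fun r => by rw [MvPowerSeries.coe_substAlgHom, MvPowerSeries.subst_C]
  have hxU : MvPowerSeries.substAlgHom hs (varU R) = varU R * atU i := by
    rw [MvPowerSeries.coe_substAlgHom, subst_pair_varU hU hV]
  have hxV : MvPowerSeries.substAlgHom hs (varV R) = varV R * atV i := by
    rw [MvPowerSeries.coe_substAlgHom, subst_pair_varV hU hV]
  set q₂ := quadCoeff₂ (MvPowerSeries.C a₁) (MvPowerSeries.C a₂) (MvPowerSeries.C a₃)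
    (varU R) (varV R) with hq₂
  set q₁ := quadCoeff₁ (MvPowerSeries.C a₁) (MvPowerSeries.C a₂) (MvPowerSeries.C a₃)
    (varU R) (varV R) with hq₁
  have h20 : MvPowerSeries.constantCoeff q₂ = ((1 : Rˣ) : R) := by
    simp [hq₂, quadCoeff₂]
  have hw := congrArg (MvPowerSeries.substAlgHom hs) (MvPowerSeries.mul_invOfUnit q₂ 1 h20)
  have e2 : MvPowerSeries.substAlgHom hs q₂ = quadCoeff₂ (MvPowerSeries.C a₁)
      (MvPowerSeries.C a₂) (MvPowerSeries.C a₃) (varU R * atU i) (varV R * atV i) := by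
    rw [hq₂, map_quadCoeff₂, hC, hC, hC, hxU, hxV]
  have e1 : MvPowerSeries.substAlgHom hs q₁ = quadCoeff₁ (MvPowerSeries.C a₁)
      (MvPowerSeries.C a₂) (MvPowerSeries.C a₃) (varU R * atU i) (varV R * atV i) := by
    rw [hq₁, map_quadCoeff₁, hC, hC, hC, hxU, hxV]
  rw [map_mul, map_one, e2] at hw
  have c0 : (buchstaberPolynomial a₁ a₂ a₃).coeff 0 = (varU R - varV R) ^ 2 := by
    rw [buchstaberPolynomial_eq, Polynomial.coeff_add, Polynomial.coeff_add,
      Polynomial.coeff_C_mul_X_pow, Polynomial.coeff_C_mul_X, Polynomial.coeff_C_zero]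
    simp
  have c1 : (buchstaberPolynomial a₁ a₂ a₃).coeff 1 = q₁ := by
    rw [buchstaberPolynomial_eq, Polynomial.coeff_add, Polynomial.coeff_add,
      Polynomial.coeff_C_mul_X_pow, Polynomial.coeff_C_mul_X, Polynomial.coeff_C]
    simp [hq₁]
  have c2 : (buchstaberPolynomial a₁ a₂ a₃).coeff 2 = q₂ := by
    rw [buchstaberPolynomial_eq, Polynomial.coeff_add, Polynomial.coeff_add,
      Polynomial.coeff_C_mul_X_pow, Polynomial.coeff_C_mul_X, Polynomial.coeff_C]
    simp [hq₂]
  rw [IsModulusSquareWith, subst_pair_varU_varV, buchstaberTwoValued]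
  simp only [c0, c1, c2]
  rw [← MvPowerSeries.coe_substAlgHom hs, map_mul, map_mul, map_neg, map_pow, map_sub, e1, hxU,
    hxV]
  set w := MvPowerSeries.substAlgHom hs (MvPowerSeries.invOfUnit q₂ 1)
  constructor
  · rintro ⟨h1, h2⟩
    rw [← h1, ← h2]
    constructor
    · linear_combination (-quadCoeff₁ (MvPowerSeries.C a₁)
        (MvPowerSeries.C a₂) (MvPowerSeries.C a₃) (varU R * atU i) (varV R * atV i)) * hw
    · linear_combination (varU R * atU i - varV R * atV i) ^ 2 * hw
  · rintro ⟨h1, h2⟩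
    rw [← h1, ← h2]
    constructor
    · linear_combination (F.toPowerSeries * F.toPowerSeries.subst ![atU i, atV i] +
          F.toPowerSeries.subst ![varU R, atV i] * F.toPowerSeries.subst ![atU i, varV R]) * hw
    · linear_combination (F.toPowerSeries * F.toPowerSeries.subst ![atU i, atV i] *
          (F.toPowerSeries.subst ![varU R, atV i] * F.toPowerSeries.subst ![atU i, varV R])) * hw

theorem neg_X_subst {τ : Type*} {Z : MvPowerSeries τ R}
    (hZ : MvPowerSeries.constantCoeff Z = 0) : (-PowerSeries.X : PowerSeries R).subst Z = -Z := by
  have hs := PowerSeries.HasSubst.of_constantCoeff_zero hZ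
  rw [← PowerSeries.coe_substAlgHom hs, map_neg, PowerSeries.substAlgHom_X]

/-- For a law with `ū = -u`, being the modulus square means that `F(u, v)²` and `F(u, -v)²` have
prescribed sum and product. -/
theorem isModulusSquareWith_neg_iff {F : FormalGroup R} [F.IsComm]
    (hi : IsFormalInverse F (-PowerSeries.X)) (a₁ a₂ a₃ : R) :
    IsModulusSquareWith F (-PowerSeries.X) (buchstaberTwoValued a₁ a₂ a₃) ↔
      (F.toPowerSeries ^ 2 + F.toPowerSeries.subst ![varU R, -varV R] ^ 2) *
          quadCoeff₂ (MvPowerSeries.C a₁) (MvPowerSeries.C a₂) (MvPowerSeries.C a₃)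
            (-varU R ^ 2) (-varV R ^ 2) =
        quadCoeff₁ (MvPowerSeries.C a₁) (MvPowerSeries.C a₂) (MvPowerSeries.C a₃)
            (-varU R ^ 2) (-varV R ^ 2) ∧
      F.toPowerSeries ^ 2 * F.toPowerSeries.subst ![varU R, -varV R] ^ 2 *
          quadCoeff₂ (MvPowerSeries.C a₁) (MvPowerSeries.C a₂) (MvPowerSeries.C a₃)
            (-varU R ^ 2) (-varV R ^ 2) =
        (varU R ^ 2 - varV R ^ 2) ^ 2 := by
  have hU : MvPowerSeries.constantCoeff (varU R) = 0 := by simp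
  have hV : MvPowerSeries.constantCoeff (varV R) = 0 := by simp
  have hnU : MvPowerSeries.constantCoeff (-varU R) = 0 := by simp
  have hnV : MvPowerSeries.constantCoeff (-varV R) = 0 := by simp
  have eU : atU (-PowerSeries.X : PowerSeries R) = -varU R := neg_X_subst hU
  have eV : atV (-PowerSeries.X : PowerSeries R) = -varV R := neg_X_subst hV
  -- Oddness of `F` turns the two roots into −F(u, v)² and −F(u, −v)².
  have e1 : F.toPowerSeries.subst ![-varU R, -varV R] = -F.toPowerSeries := by
    rw [← eU, ← eV, formalInverse_add hi, neg_X_subst F.zero_constantCoeff]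
  have e2 : F.toPowerSeries.subst ![-varU R, varV R] =
      -F.toPowerSeries.subst ![varU R, -varV R] := by
    have := congrArg (MvPowerSeries.subst ![varU R, -varV R]) e1
    have hs := hasSubst_pair hU hnV
    rw [subst_pair_subst hnU hnV _ hs, ← MvPowerSeries.coe_substAlgHom hs, map_neg, map_neg,
      map_neg, MvPowerSeries.coe_substAlgHom, subst_pair_varU hU hnV, subst_pair_varV hU hnV,
      neg_neg] at this
    exact this
  have ex : ∀ x : MvPowerSeries (Fin 2) R, x * -x = -x ^ 2 := fun x => by ring
  rw [isModulusSquareWith_iff, eU, eV, e1, e2, ex, ex, ex, ex]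
  generalize F.toPowerSeries ^ 2 = p
  generalize F.toPowerSeries.subst ![varU R, -varV R] ^ 2 = q
  constructor
  · rintro ⟨h1, h2⟩
    exact ⟨by linear_combination -h1, by linear_combination h2⟩
  · rintro ⟨h1, h2⟩
    exact ⟨by linear_combination -h1, by linear_combination h2⟩

/-! ### The squares of `F(u, v)` and `F(u, -v)` for the law `lawBc` -/

theorem seriesQ_subst {τ : Type*} {Z : MvPowerSeries τ R}
    (hZ : MvPowerSeries.constantCoeff Z = 0) (a₁ a₂ a₃ : R) :
    (seriesQ a₁ a₂ a₃).subst Z =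
      1 - MvPowerSeries.C a₁ * Z ^ 2 + MvPowerSeries.C a₂ * Z ^ 4 - MvPowerSeries.C a₃ * Z ^ 6 := by
  rw [seriesQ, evenSextic_subst hZ, map_neg, map_neg]
  ring

theorem sqrtQ_subst_neg (h2 : IsUnit (2 : R)) (a₁ a₂ a₃ : R) {τ : Type} {Z : MvPowerSeries τ R}
    (hZ : MvPowerSeries.constantCoeff Z = 0) :
    (sqrtQ a₁ a₂ a₃).subst (-Z) = (sqrtQ a₁ a₂ a₃).subst Z := by
  have hZ' : MvPowerSeries.constantCoeff (-Z) = 0 := by rw [map_neg, hZ, neg_zero]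
  have h : ∀ {W : MvPowerSeries τ R}, MvPowerSeries.constantCoeff W = 0 →
      (sqrtQ a₁ a₂ a₃).subst W = sqrtSeries ((seriesQ a₁ a₂ a₃).subst W) := fun hW =>
    sqrtSeries_subst h2 (constantCoeff_seriesQ _ _ _)
      (PowerSeries.HasSubst.of_constantCoeff_zero hW).const fun _ => hW
  rw [h hZ, h hZ', seriesQ_subst hZ, seriesQ_subst hZ']
  congr 1
  ring

theorem sqrtQ_subst_sq (h2 : IsUnit (2 : R)) (a₁ a₂ a₃ : R) {τ : Type} {Z : MvPowerSeries τ R}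
    (hZ : MvPowerSeries.constantCoeff Z = 0) :
    (sqrtQ a₁ a₂ a₃).subst Z ^ 2 = 1 - MvPowerSeries.C a₁ * Z ^ 2 + MvPowerSeries.C a₂ * Z ^ 4 -
      MvPowerSeries.C a₃ * Z ^ 6 := by
  have hs := PowerSeries.HasSubst.of_constantCoeff_zero hZ
  rw [← PowerSeries.subst_pow hs, sqrtSeries_sq h2 (constantCoeff_seriesQ _ _ _),
    seriesQ_subst hZ]

theorem lawBc_subst_neg_sq (h2 : IsUnit (2 : R)) (a₁ a₂ a₃ : R) :
    (lawBc a₁ a₂ a₃).subst ![varU R, -varV R] ^ 2 *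
      ((varU R * atV (sqrtQ a₁ a₂ a₃) + varV R * atU (sqrtQ a₁ a₂ a₃)) ^ 2
        + MvPowerSeries.C a₃ * varU R ^ 2 * varV R ^ 2 * (varU R ^ 2 - varV R ^ 2) ^ 2)
      = (varU R ^ 2 - varV R ^ 2) ^ 2 := by
  have hU : MvPowerSeries.constantCoeff (varU R) = 0 := by simp
  have hV : MvPowerSeries.constantCoeff (varV R) = 0 := by simp
  have hnV : MvPowerSeries.constantCoeff (-varV R) = 0 := by simp
  have hs := hasSubst_pair hU hnV
  have h := congrArg (MvPowerSeries.substAlgHom hs) (lawBc_sq h2 a₁ a₂ a₃)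
  have eU := subst_pair_varU hU hnV
  have eV := subst_pair_varV hU hnV
  simp only [map_mul, map_add, map_sub, map_pow] at h
  rw [MvPowerSeries.coe_substAlgHom, subst_pair_atU hU hnV, subst_pair_atV hU hnV,
    sqrtQ_subst_neg h2 a₁ a₂ a₃ hV, MvPowerSeries.subst_C, eU, eV] at h
  linear_combination h

/-- The denominators of F(u, v)² and F(u, −v)² differ by the sign of √Q(u). Their product contains
only even powers of the roots, and equals (u² − v²)² times the leading coefficient. -/
theorem lawBc_sq_mul_sq (h2 : IsUnit (2 : R)) (a₁ a₂ a₃ : R) :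
    lawBc a₁ a₂ a₃ ^ 2 * (lawBc a₁ a₂ a₃).subst ![varU R, -varV R] ^ 2 *
        quadCoeff₂ (MvPowerSeries.C a₁) (MvPowerSeries.C a₂) (MvPowerSeries.C a₃)
          (-varU R ^ 2) (-varV R ^ 2) =
      (varU R ^ 2 - varV R ^ 2) ^ 2 := by
  have hU : MvPowerSeries.constantCoeff (varU R) = 0 := by simp
  have hV : MvPowerSeries.constantCoeff (varV R) = 0 := by simp
  have h1 := lawBc_sq h2 a₁ a₂ a₃
  have h1' := lawBc_subst_neg_sq h2 a₁ a₂ a₃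
  have hSU : atU (sqrtQ a₁ a₂ a₃) ^ 2 = _ := sqrtQ_subst_sq h2 a₁ a₂ a₃ hU
  have hSV : atV (sqrtQ a₁ a₂ a₃) ^ 2 = _ := sqrtQ_subst_sq h2 a₁ a₂ a₃ hV
  apply sq_sub_sq_cancel
  apply sq_sub_sq_cancel
  generalize lawBc a₁ a₂ a₃ ^ 2 = p at *
  generalize (lawBc a₁ a₂ a₃).subst ![varU R, -varV R] ^ 2 = q at *
  have key : ((varU R * atV (sqrtQ a₁ a₂ a₃) - varV R * atU (sqrtQ a₁ a₂ a₃)) ^ 2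
        + MvPowerSeries.C a₃ * varU R ^ 2 * varV R ^ 2 * (varU R ^ 2 - varV R ^ 2) ^ 2) *
      ((varU R * atV (sqrtQ a₁ a₂ a₃) + varV R * atU (sqrtQ a₁ a₂ a₃)) ^ 2
        + MvPowerSeries.C a₃ * varU R ^ 2 * varV R ^ 2 * (varU R ^ 2 - varV R ^ 2) ^ 2) =
      (varU R ^ 2 - varV R ^ 2) ^ 2 * quadCoeff₂ (MvPowerSeries.C a₁) (MvPowerSeries.C a₂)
        (MvPowerSeries.C a₃) (-varU R ^ 2) (-varV R ^ 2) := by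
    rw [quadCoeff₂]
    generalize atU (sqrtQ a₁ a₂ a₃) = s at *
    generalize atV (sqrtQ a₁ a₂ a₃) = t at *
    have : ∀ u v κ : MvPowerSeries (Fin 2) R, ((u * t - v * s) ^ 2 + κ) * ((u * t + v * s) ^ 2 + κ)
        = (u ^ 2 * t ^ 2 - v ^ 2 * s ^ 2) ^ 2 + 2 * (u ^ 2 * t ^ 2 + v ^ 2 * s ^ 2) * κ + κ ^ 2 :=
      fun u v κ => by ring
    rw [this, hSU, hSV]
    ring
  linear_combination (-p * q) * key + h1' * (p * ((varU R * atV (sqrtQ a₁ a₂ a₃) - varV R * atU (sqrtQ a₁ a₂ a₃)) ^ 2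
        + MvPowerSeries.C a₃ * varU R ^ 2 * varV R ^ 2 * (varU R ^ 2 - varV R ^ 2) ^ 2)) +
      (varU R ^ 2 - varV R ^ 2) ^ 2 * h1

/-- Let p, q be the two squares, d₁, d₂ their denominators and c the leading coefficient. Then pd₁ =
qd₂ = cpq, so cp = d₂ and cq = d₁, and it remains to add the denominators. -/
theorem lawBc_sq_add_sq (h2 : IsUnit (2 : R)) (a₁ a₂ a₃ : R) :
    (lawBc a₁ a₂ a₃ ^ 2 + (lawBc a₁ a₂ a₃).subst ![varU R, -varV R] ^ 2) *
        quadCoeff₂ (MvPowerSeries.C a₁) (MvPowerSeries.C a₂) (MvPowerSeries.C a₃)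
          (-varU R ^ 2) (-varV R ^ 2) =
      quadCoeff₁ (MvPowerSeries.C a₁) (MvPowerSeries.C a₂) (MvPowerSeries.C a₃)
          (-varU R ^ 2) (-varV R ^ 2) := by
  have hU : MvPowerSeries.constantCoeff (varU R) = 0 := by simp
  have hV : MvPowerSeries.constantCoeff (varV R) = 0 := by simp
  have h1 := lawBc_sq h2 a₁ a₂ a₃
  have h1' := lawBc_subst_neg_sq h2 a₁ a₂ a₃
  have h3 := lawBc_sq_mul_sq h2 a₁ a₂ a₃
  have hSU : atU (sqrtQ a₁ a₂ a₃) ^ 2 = _ := sqrtQ_subst_sq h2 a₁ a₂ a₃ hU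
  have hSV : atV (sqrtQ a₁ a₂ a₃) ^ 2 = _ := sqrtQ_subst_sq h2 a₁ a₂ a₃ hV
  apply sq_sub_sq_cancel
  apply sq_sub_sq_cancel
  generalize lawBc a₁ a₂ a₃ ^ 2 = p at *
  generalize (lawBc a₁ a₂ a₃).subst ![varU R, -varV R] ^ 2 = q at *
  generalize hc : quadCoeff₂ (MvPowerSeries.C a₁) (MvPowerSeries.C a₂) (MvPowerSeries.C a₃)
          (-varU R ^ 2) (-varV R ^ 2) = c at *
  have key : (varU R * atV (sqrtQ a₁ a₂ a₃) - varV R * atU (sqrtQ a₁ a₂ a₃)) ^ 2 +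
      (varU R * atV (sqrtQ a₁ a₂ a₃) + varV R * atU (sqrtQ a₁ a₂ a₃)) ^ 2 +
      2 * (MvPowerSeries.C a₃ * varU R ^ 2 * varV R ^ 2 * (varU R ^ 2 - varV R ^ 2) ^ 2) =
      quadCoeff₁ (MvPowerSeries.C a₁) (MvPowerSeries.C a₂) (MvPowerSeries.C a₃)
          (-varU R ^ 2) (-varV R ^ 2) := by
    rw [quadCoeff₁]
    generalize atU (sqrtQ a₁ a₂ a₃) = s at *
    generalize atV (sqrtQ a₁ a₂ a₃) = t at *
    linear_combination 2 * varU R ^ 2 * hSV + 2 * varV R ^ 2 * hSU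
  rw [← key]
  generalize MvPowerSeries.C a₃ * varU R ^ 2 * varV R ^ 2 * (varU R ^ 2 - varV R ^ 2) ^ 2 = κ at *
  linear_combination (-c * q) * h1 - (c * p) * h1' +
    ((varU R * atV (sqrtQ a₁ a₂ a₃) - varV R * atU (sqrtQ a₁ a₂ a₃)) ^ 2 +
      (varU R * atV (sqrtQ a₁ a₂ a₃) + varV R * atU (sqrtQ a₁ a₂ a₃)) ^ 2 + 2 * κ) * h3

theorem isFormalInverse_lawBc {F : FormalGroup R} {a₁ a₂ a₃ : R}
    (hF : F.toPowerSeries = lawBc a₁ a₂ a₃) : IsFormalInverse F (-PowerSeries.X) := by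
  have hX : MvPowerSeries.constantCoeff (PowerSeries.X : PowerSeries R) = 0 :=
    PowerSeries.constantCoeff_X
  have hX' : MvPowerSeries.constantCoeff (-PowerSeries.X : PowerSeries R) = 0 := by
    rw [map_neg, hX, neg_zero]
  refine ⟨hX', ?_⟩
  have hs := hasSubst_pair hX hX'
  rw [hF, lawBc_eq, MvPowerSeries.subst_mul hs, MvPowerSeries.subst_add hs,
    subst_pair_varU hX hX', subst_pair_varV hX hX', add_neg_cancel, zero_mul]

theorem isModulusSquareWith_lawBc (h2 : IsUnit (2 : R)) {F : FormalGroup R} [F.IsComm]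
    {a₁ a₂ a₃ : R} (hF : F.toPowerSeries = lawBc a₁ a₂ a₃) :
    IsModulusSquareWith F (-PowerSeries.X) (buchstaberTwoValued a₁ a₂ a₃) := by
  rw [isModulusSquareWith_neg_iff (isFormalInverse_lawBc hF), hF]
  exact ⟨lawBc_sq_add_sq h2 _ _ _, lawBc_sq_mul_sq h2 _ _ _⟩

/-! ### Universality -/

theorem isUnit_quadCoeff₂ (a₁ a₂ a₃ : R) :
    IsUnit (quadCoeff₂ (MvPowerSeries.C a₁) (MvPowerSeries.C a₂) (MvPowerSeries.C a₃)
      (-varU R ^ 2) (-varV R ^ 2)) :=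
  isUnit_of_constantCoeff (by simp [quadCoeff₂])

theorem coeff_single_one_subst_neg (F : MvPowerSeries (Fin 2) R) :
    MvPowerSeries.coeff (Finsupp.single 0 1) (F.subst ![varU R, -varV R]) =
        MvPowerSeries.coeff (Finsupp.single 0 1) F ∧
      MvPowerSeries.coeff (Finsupp.single 1 1) (F.subst ![varU R, -varV R]) =
        -MvPowerSeries.coeff (Finsupp.single 1 1) F := by
  have hU : MvPowerSeries.constantCoeff (varU R) = 0 := by simp
  have hnV : MvPowerSeries.constantCoeff (-varV R) = 0 := by simp
  simp only [coeff_single_one_eq, pderiv_subst_pair hU hnV, map_add, map_mul, map_neg,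
    constantCoeff_subst_pair hU hnV, MvPowerSeries.pderiv_X_self,
    MvPowerSeries.pderiv_X_of_ne (show (1 : Fin 2) ≠ 0 by decide),
    MvPowerSeries.pderiv_X_of_ne (show (0 : Fin 2) ≠ 1 by decide)]
  simp

/-- A commutative formal group with `ū = -u` is determined by its modulus square. -/
theorem eq_lawBc_of_isModulusSquare (h2 : IsUnit (2 : R)) {H : FormalGroup R} [H.IsComm]
    (hi : IsFormalInverse H (-PowerSeries.X)) {b₁ b₂ b₃ : R}
    (h : IsModulusSquare H (buchstaberTwoValued b₁ b₂ b₃)) :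
    H.toPowerSeries = lawBc b₁ b₂ b₃ := by
  obtain ⟨i, hi', hm⟩ := h
  rw [isFormalInverse_unique hi' hi, isModulusSquareWith_neg_iff hi] at hm
  obtain ⟨hs, hp⟩ := hm
  have hc := isUnit_quadCoeff₂ b₁ b₂ b₃
  rw [← lawBc_sq_add_sq h2] at hs
  rw [← lawBc_sq_mul_sq h2 b₁ b₂ b₃] at hp
  replace hs := hc.mul_right_cancel hs
  replace hp := hc.mul_right_cancel hp
  have hLc (j : Fin 2) : MvPowerSeries.coeff (Finsupp.single j 1) (lawBc b₁ b₂ b₃) = 1 := by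
    rw [coeff_single_one_eq, constantCoeff_pderiv_lawBc]
  have hL0 := constantCoeff_lawBc b₁ b₂ b₃
  have hU : MvPowerSeries.constantCoeff (varU R) = 0 := by simp
  have hnV : MvPowerSeries.constantCoeff (-varV R) = 0 := by simp
  have hM0 : MvPowerSeries.constantCoeff ((lawBc b₁ b₂ b₃).subst ![varU R, -varV R]) = 0 := by
    rw [constantCoeff_subst_pair hU hnV, hL0]
  have hM := coeff_single_one_subst_neg (lawBc b₁ b₂ b₃)
  generalize (lawBc b₁ b₂ b₃).subst ![varU R, -varV R] = M at *
  generalize lawBc b₁ b₂ b₃ = L at *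
  generalize H.toPowerSeries.subst ![varU R, -varV R] = H' at *
  have hH0 := H.zero_constantCoeff
  have hHU := H.lin_coeff_X
  have hHV := H.lin_coeff_Y
  generalize H.toPowerSeries = K at *
  -- Equal sums and products give (K² − L²)(K² − M²) = 0, where L = F(u, v) and M = F(u, −v). The
  -- factors K + L, K − M and K + M have linear coefficient 2 in u, v and u respectively, so they
  -- cancel and K = L is left.
  have hprod : (K + L) * ((K - M) * ((K + M) * (K - L))) = 0 := by
    linear_combination K ^ 2 * hs - hp
  have two : (1 : R) + 1 = 2 := one_add_one_eq_two
  have h1 := eq_zero_of_mul_eq_zero_of_isUnit_coeff (j := 0) (k := 1) (by decide)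
    (by rw [map_add, hH0, hL0, add_zero]) (by rw [map_add, hHU, hLc, two]; exact h2) hprod
  have h2' := eq_zero_of_mul_eq_zero_of_isUnit_coeff (j := 1) (k := 0) (by decide)
    (by rw [map_sub, hH0, hM0, sub_zero])
    (by rw [map_sub, hHV, hM.2, hLc, sub_neg_eq_add, two]; exact h2) h1
  have h3 := eq_zero_of_mul_eq_zero_of_isUnit_coeff (j := 0) (k := 1) (by decide)
    (by rw [map_add, hH0, hM0, add_zero])
    (by rw [map_add, hHU, hM.1, hLc, two]; exact h2) h2'
  exact sub_eq_zero.mp h3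

/-- The parameters are determined by the law. -/
theorem lawBc_injective (h2 : IsUnit (2 : R)) {a₁ a₂ a₃ b₁ b₂ b₃ : R}
    (h : lawBc a₁ a₂ a₃ = lawBc b₁ b₂ b₃) : a₁ = b₁ ∧ a₂ = b₂ ∧ a₃ = b₃ := by
  have ha := lawBc_sq_mul_sq h2 a₁ a₂ a₃
  have hb := lawBc_sq_mul_sq h2 b₁ b₂ b₃
  have ha' := lawBc_sq_add_sq h2 a₁ a₂ a₃
  have hb' := lawBc_sq_add_sq h2 b₁ b₂ b₃
  rw [h] at ha ha'
  -- The product of the squares is common to both sides and determines the leading coefficient; the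
  -- sum then determines the linear one.
  have hq : quadCoeff₂ (MvPowerSeries.C a₁) (MvPowerSeries.C a₂) (MvPowerSeries.C a₃)
      (-varU R ^ 2) (-varV R ^ 2) = quadCoeff₂ (MvPowerSeries.C b₁) (MvPowerSeries.C b₂)
      (MvPowerSeries.C b₃) (-varU R ^ 2) (-varV R ^ 2) := by
    apply sq_sub_sq_cancel
    apply sq_sub_sq_cancel
    generalize lawBc b₁ b₂ b₃ ^ 2 * (lawBc b₁ b₂ b₃).subst ![varU R, -varV R] ^ 2 = p at *
    generalize quadCoeff₂ (MvPowerSeries.C a₁) (MvPowerSeries.C a₂) (MvPowerSeries.C a₃)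
      (-varU R ^ 2) (-varV R ^ 2) = c at *
    generalize quadCoeff₂ (MvPowerSeries.C b₁) (MvPowerSeries.C b₂) (MvPowerSeries.C b₃)
      (-varU R ^ 2) (-varV R ^ 2) = d at *
    linear_combination d * ha - c * hb
  rw [hq, hb'] at ha'
  have hX : MvPowerSeries.constantCoeff (PowerSeries.X : PowerSeries R) = 0 :=
    PowerSeries.constantCoeff_X
  -- On the diagonal u = v = X the linear coefficient is 4X² − 4a₁X⁴ + 4a₂X⁶ − 4a₃X⁸, from which the
  -- parameters are read off.
  have hs := hasSubst_pair hX hX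
  have hd := congrArg (MvPowerSeries.substAlgHom hs) ha'
  have hC : ∀ r : R, MvPowerSeries.substAlgHom hs (MvPowerSeries.C r) = PowerSeries.C r :=
    fun r => by rw [MvPowerSeries.coe_substAlgHom, MvPowerSeries.subst_C]; rfl
  have hxU : MvPowerSeries.substAlgHom hs (varU R) = PowerSeries.X := by
    rw [MvPowerSeries.coe_substAlgHom, subst_pair_varU hX hX]
  have hxV : MvPowerSeries.substAlgHom hs (varV R) = PowerSeries.X := by
    rw [MvPowerSeries.coe_substAlgHom, subst_pair_varV hX hX]
  have e : ∀ c₁ c₂ c₃ : R, quadCoeff₁ (PowerSeries.C c₁) (PowerSeries.C c₂) (PowerSeries.C c₃)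
      (-PowerSeries.X ^ 2 : PowerSeries R) (-PowerSeries.X ^ 2) =
      PowerSeries.C 4 * PowerSeries.X ^ 2 - PowerSeries.C (4 * c₁) * PowerSeries.X ^ 4 +
      PowerSeries.C (4 * c₂) * PowerSeries.X ^ 6 - PowerSeries.C (4 * c₃) * PowerSeries.X ^ 8 := by
    intro c₁ c₂ c₃
    have e4 : (4 : PowerSeries R) = PowerSeries.C 4 := (map_ofNat PowerSeries.C 4).symm
    rw [map_mul, map_mul, map_mul, ← e4, quadCoeff₁]
    ring
  rw [map_quadCoeff₁, map_quadCoeff₁, map_neg, map_neg, map_pow, map_pow, hxU, hxV] at hd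
  simp only [hC, e] at hd
  have h4 : IsUnit (4 : R) := by
    have : (4 : R) = 2 * 2 := by norm_num
    rw [this]
    exact h2.mul h2
  refine ⟨?_, ?_, ?_⟩
  · have := congrArg (PowerSeries.coeff 4) hd
    simp only [map_add, map_sub, PowerSeries.coeff_C_mul, PowerSeries.coeff_X_pow] at this
    norm_num at this
    exact (h4.mul_left_cancel this).symm
  · have := congrArg (PowerSeries.coeff 6) hd
    simp only [map_add, map_sub, PowerSeries.coeff_C_mul, PowerSeries.coeff_X_pow] at this
    norm_num at this
    exact (h4.mul_left_cancel this).symm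
  · have := congrArg (PowerSeries.coeff 8) hd
    simp only [map_add, map_sub, PowerSeries.coeff_C_mul, PowerSeries.coeff_X_pow] at this
    norm_num at this
    exact (h4.mul_left_cancel this).symm

end ModulusSquare

/-! ### The universal law over `ℤ[1/2, a₁, a₂, a₃]` -/

section Universal

theorem mvPowerSeries_map_injective {σ R S : Type*} [CommRing R] [CommRing S] {φ : R →+* S}
    (hφ : Function.Injective φ) :
    Function.Injective (MvPowerSeries.map φ : MvPowerSeries σ R → MvPowerSeries σ S) := by
  intro f g h
  ext n
  apply hφ
  rw [← MvPowerSeries.coeff_map, h, MvPowerSeries.coeff_map]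

theorem map_subst_pair {R S τ : Type*} [CommRing R] [CommRing S] (φ : R →+* S)
    {f g : MvPowerSeries τ R} (hf : MvPowerSeries.constantCoeff f = 0)
    (hg : MvPowerSeries.constantCoeff g = 0) (M : MvPowerSeries (Fin 2) R) :
    MvPowerSeries.map φ (M.subst ![f, g]) =
      (MvPowerSeries.map φ M).subst ![MvPowerSeries.map φ f, MvPowerSeries.map φ g] := by
  rw [MvPowerSeries.map_subst (hasSubst_pair hf hg)]
  congr 1
  funext i
  fin_cases i <;> rfl

/-- A series over a subring is a commutative formal group law if it is one over the larger ring. -/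
theorem exists_formalGroup_of_map_injective {R S : Type*} [CommRing R] [CommRing S] {φ : R →+* S}
    (hφ : Function.Injective φ) {M : MvPowerSeries (Fin 2) R} {G : FormalGroup S} [G.IsComm]
    (h : MvPowerSeries.map φ M = G.toPowerSeries) :
    ∃ F : FormalGroup R, F.toPowerSeries = M ∧ F.IsComm := by
  have hX (i : Fin 3) : MvPowerSeries.constantCoeff (MvPowerSeries.X i : MvPowerSeries (Fin 3) R) =
    0 := by simp
  have hX2 (i : Fin 2) : MvPowerSeries.constantCoeff (MvPowerSeries.X i : MvPowerSeries (Fin 2) R) =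
    0 := by simp
  have h0 : MvPowerSeries.constantCoeff M = 0 := by
    apply hφ
    rw [← MvPowerSeries.constantCoeff_map, h, G.zero_constantCoeff, map_zero]
  have h1 (j : Fin 2) (hj : MvPowerSeries.coeff (Finsupp.single j 1) G.toPowerSeries = 1) :
      MvPowerSeries.coeff (Finsupp.single j 1) M = 1 := by
    apply hφ
    rw [← MvPowerSeries.coeff_map, h, hj, map_one]
  have hc (i j : Fin 3) : MvPowerSeries.constantCoeff
      (M.subst ![(MvPowerSeries.X i : MvPowerSeries (Fin 3) R), MvPowerSeries.X j]) = 0 := by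
    rw [constantCoeff_subst_pair (hX i) (hX j), h0]
  refine ⟨⟨M, h0, h1 0 G.lin_coeff_X, h1 1 G.lin_coeff_Y, ?_⟩, rfl, ⟨?_⟩⟩
  · apply mvPowerSeries_map_injective hφ
    rw [map_subst_pair φ (hc 0 1) (hX 2), map_subst_pair φ (hX 0) (hc 1 2),
      map_subst_pair φ (hX 0) (hX 1), map_subst_pair φ (hX 1) (hX 2), h]
    simp only [MvPowerSeries.map_X]
    exact G.assoc
  · apply mvPowerSeries_map_injective hφ
    change MvPowerSeries.map φ M = MvPowerSeries.map φ (M.subst _)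
    rw [map_subst_pair φ (hX2 1) (hX2 0), h, MvPowerSeries.map_X, MvPowerSeries.map_X]
    exact FormalGroup.IsComm.comm

/-- The homomorphism `ℤ[1/2] → S`. -/
noncomputable def awayTwoHom {S : Type*} [CommRing S] (h2 : IsUnit (2 : S)) :
    Localization.Away (2 : ℤ) →+* S :=
  IsLocalization.Away.lift (2 : ℤ) (g := Int.castRingHom S) (by simpa using h2)

theorem awayTwoHom_injective :
    Function.Injective (awayTwoHom (S := ℚ) (isUnit_iff_ne_zero.mpr two_ne_zero)) := by
  refine (IsLocalization.lift_injective_iff _).mpr fun x y => ?_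
  have : Function.Injective (algebraMap ℤ (Localization.Away (2 : ℤ))) :=
    IsLocalization.injective _ (powers_le_nonZeroDivisors_of_noZeroDivisors two_ne_zero)
  rw [this.eq_iff]
  simp

theorem isUnit_two_parameterRing : IsUnit (2 : ParameterRing) := by
  have h : IsUnit (algebraMap ℤ (Localization.Away (2 : ℤ)) 2) :=
    IsLocalization.Away.algebraMap_isUnit 2
  have := (h.map (MvPolynomial.C (R := Localization.Away (2 : ℤ)) (σ := Fin 3)))
  rwa [map_ofNat, map_ofNat] at this

theorem parameterRing_hom_ext {S : Type*} [CommRing S] {φ ψ : ParameterRing →+* S}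
    (h : ∀ i, φ (MvPolynomial.X i) = ψ (MvPolynomial.X i)) : φ = ψ := by
  apply MvPolynomial.ringHom_ext _ h
  intro r
  have : φ.comp MvPolynomial.C = ψ.comp MvPolynomial.C :=
    IsLocalization.ringHom_ext (Submonoid.powers (2 : ℤ)) (RingHom.ext_int _ _)
  exact congrArg (fun f : Localization.Away (2 : ℤ) →+* S => f r) this

/-- The logarithm exists only over ℚ, so the axioms are taken from ℚ[a₁, a₂, a₃], into which the
parameter ring embeds compatibly with `lawBc`. -/
theorem exists_universal_lawBc :
    ∃ F : FormalGroup ParameterRing,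
      F.toPowerSeries = lawBc (MvPolynomial.X 0) (MvPolynomial.X 1) (MvPolynomial.X 2) ∧
      F.IsComm := by
  obtain ⟨G, hG, hc, -⟩ := exists_formalGroup_lawBc
    (MvPolynomial.X 0 : MvPolynomial (Fin 3) ℚ) (MvPolynomial.X 1) (MvPolynomial.X 2)
  refine exists_formalGroup_of_map_injective
    (MvPolynomial.map_injective (σ := Fin 3) _ awayTwoHom_injective) (G := G) ?_
  rw [map_lawBc (R := ParameterRing) isUnit_two_parameterRing, hG, MvPolynomial.map_X, MvPolynomial.map_X,
    MvPolynomial.map_X]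

/-- The modulus square forces H to be the law with parameters b, which gives existence; the law in
turn determines its parameters, which gives uniqueness. -/
theorem existsUnique_hom_of_isModulusSquare {F : FormalGroup ParameterRing}
    (hF : F.toPowerSeries = lawBc (MvPolynomial.X 0) (MvPolynomial.X 1) (MvPolynomial.X 2))
    {S : Type u} [CommRing S] (h2 : IsUnit (2 : S)) {H : FormalGroup S} {b₁ b₂ b₃ : S}
    [H.IsComm] (hi : IsFormalInverse H (-PowerSeries.X))
    (hm : IsModulusSquare H (buchstaberTwoValued b₁ b₂ b₃)) :
    ∃ φ : ParameterRing →+* S,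
      φ (MvPolynomial.X 0) = b₁ ∧ φ (MvPolynomial.X 1) = b₂ ∧ φ (MvPolynomial.X 2) = b₃ ∧
      F.map φ = H ∧ ∀ ψ : ParameterRing →+* S, F.map ψ = H → ψ = φ := by
  have hmap (ψ : ParameterRing →+* S) : (F.map ψ).toPowerSeries =
      lawBc (ψ (MvPolynomial.X 0)) (ψ (MvPolynomial.X 1)) (ψ (MvPolynomial.X 2)) := by
    change MvPowerSeries.map ψ F.toPowerSeries = _
    rw [hF, map_lawBc (R := ParameterRing) isUnit_two_parameterRing]
  have hH := eq_lawBc_of_isModulusSquare h2 hi hm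
  let φ : ParameterRing →+* S := MvPolynomial.eval₂Hom (awayTwoHom h2) ![b₁, b₂, b₃]
  have hφ (i : Fin 3) : φ (MvPolynomial.X i) = ![b₁, b₂, b₃] i :=
    MvPolynomial.eval₂Hom_X' _ _ _
  refine ⟨φ, hφ 0, hφ 1, hφ 2, FormalGroup.ext ?_, fun ψ hψ => parameterRing_hom_ext fun i => ?_⟩
  · rw [hmap, hH, hφ, hφ, hφ]
    rfl
  · have := congrArg FormalGroup.toPowerSeries hψ
    rw [hmap, hH] at this
    obtain ⟨e0, e1, e2⟩ := lawBc_injective h2 this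
    rw [hφ]
    fin_cases i
    · exact e0
    · exact e1
    · exact e2

end Universal

/-! ### The logarithm of the two-valued formal group -/

section TwoValued

variable {R : Type u} [CommRing R]

theorem subst_neg_X_sq_injective {p q : PowerSeries R}
    (h : p.subst (-PowerSeries.X ^ 2 : PowerSeries R) =
      q.subst (-PowerSeries.X ^ 2 : PowerSeries R)) : p = q := by
  have hX := PowerSeries.HasSubst.of_constantCoeff_zero' (constantCoeff_X_sq (R := R))
  have hn := PowerSeries.HasSubst.of_constantCoeff_zero' (constantCoeff_neg_X (R := R))
  have e : ∀ r : PowerSeries R, r.subst (-PowerSeries.X ^ 2 : PowerSeries R) =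
      PowerSeries.subst (PowerSeries.X ^ 2 : PowerSeries R)
        (r.subst (-PowerSeries.X : PowerSeries R) : PowerSeries R) := by
    intro r
    rw [PowerSeries.subst_comp_subst_apply hn hX, ← PowerSeries.coe_substAlgHom hX, map_neg,
      PowerSeries.substAlgHom_X]
  rw [e, e] at h
  have h' := subst_X_sq_injective h
  have hr : ∀ r : PowerSeries R, r.subst (-PowerSeries.X : PowerSeries R) =
      PowerSeries.rescale (-1) r := fun r => by
    rw [PowerSeries.rescale_eq_subst, neg_one_smul]
  rw [hr, hr] at h'
  have := congrArg (PowerSeries.rescale (-1 : R)) h'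
  rwa [PowerSeries.rescale_rescale, PowerSeries.rescale_rescale, neg_one_mul, neg_neg,
    PowerSeries.rescale_one] at this

/-- The series `f(U) f(-U)`. -/
noncomputable def normSeries (f : PowerSeries R) : PowerSeries R :=
  f * f.subst (-PowerSeries.X : PowerSeries R)

theorem derivative_subst_neg_X (f : PowerSeries R) :
    PowerSeries.derivative R (f.subst (-PowerSeries.X : PowerSeries R)) =
      -(PowerSeries.derivative R f).subst (-PowerSeries.X : PowerSeries R) := by
  have hn := PowerSeries.HasSubst.of_constantCoeff_zero' (constantCoeff_neg_X (R := R))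
  rw [PowerSeries.derivative_subst hn, map_neg, PowerSeries.derivative_X, mul_neg, mul_one]

theorem constantCoeff_subst_neg_X (f : PowerSeries R) :
    PowerSeries.constantCoeff (f.subst (-PowerSeries.X : PowerSeries R)) =
      PowerSeries.constantCoeff f :=
  constantCoeff_subst_of_zero (constantCoeff_neg_X (R := R)) f

theorem constantCoeff_normSeries {f : PowerSeries R} (h0 : PowerSeries.constantCoeff f = 0) :
    PowerSeries.constantCoeff (normSeries f) = 0 := by
  rw [normSeries, map_mul, h0, zero_mul]

theorem constantCoeff_derivative_normSeries {f : PowerSeries R}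
    (h0 : PowerSeries.constantCoeff f = 0) :
    PowerSeries.constantCoeff (PowerSeries.derivative R (normSeries f)) = 0 := by
  rw [normSeries, Derivation.leibniz, map_add, smul_eq_mul, smul_eq_mul, map_mul, map_mul, h0,
    constantCoeff_subst_neg_X, h0, zero_mul, zero_mul, add_zero]

theorem constantCoeff_derivative_derivative_normSeries {f : PowerSeries R}
    (h0 : PowerSeries.constantCoeff f = 0)
    (h1 : PowerSeries.constantCoeff (PowerSeries.derivative R f) = 1) :
    PowerSeries.constantCoeff
      (PowerSeries.derivative R (PowerSeries.derivative R (normSeries f))) = -2 := by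
  have e : PowerSeries.derivative R (PowerSeries.derivative R (normSeries f)) =
      PowerSeries.derivative R (PowerSeries.derivative R f) *
        f.subst (-PowerSeries.X : PowerSeries R) -
      2 * (PowerSeries.derivative R f *
        (PowerSeries.derivative R f).subst (-PowerSeries.X : PowerSeries R)) +
      f * (PowerSeries.derivative R (PowerSeries.derivative R f)).subst
        (-PowerSeries.X : PowerSeries R) := by
    rw [normSeries, Derivation.leibniz, map_add, smul_eq_mul, smul_eq_mul, Derivation.leibniz,
      Derivation.leibniz, derivative_subst_neg_X, map_neg, derivative_subst_neg_X]
    simp only [smul_eq_mul]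
    ring
  rw [e, map_add, map_sub, map_mul, map_mul, map_mul, map_mul, constantCoeff_subst_neg_X,
    constantCoeff_subst_neg_X, h0, h1, map_ofNat]
  ring

theorem subst_normSeries {f : PowerSeries R} {τ : Type*} {Z : MvPowerSeries τ R}
    (hZ : MvPowerSeries.constantCoeff Z = 0) :
    (normSeries f).subst Z = f.subst Z * f.subst (-Z) := by
  have hs := PowerSeries.HasSubst.of_constantCoeff_zero hZ
  rw [normSeries, PowerSeries.subst_mul hs, PowerSeries.subst_comp_subst_apply
    (PowerSeries.HasSubst.of_constantCoeff_zero' (constantCoeff_neg_X (R := R))) hs,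
    neg_X_subst hZ]

/-- Since D vanishes to second order in v, the derivatives of W do not enter. -/
theorem atZeroV_pderiv_pderiv_mul {D W : MvPowerSeries (Fin 2) R} (h0 : atZeroV D = 0)
    (h1 : atZeroV (MvPowerSeries.pderiv R 1 D) = 0) :
    atZeroV (MvPowerSeries.pderiv R 1 (MvPowerSeries.pderiv R 1 (D * W))) =
      atZeroV (MvPowerSeries.pderiv R 1 (MvPowerSeries.pderiv R 1 D)) * atZeroV W := by
  rw [Derivation.leibniz, map_add, smul_eq_mul, smul_eq_mul, Derivation.leibniz, Derivation.leibniz]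
  simp only [smul_eq_mul, map_add, map_mul, h0, h1]
  ring

theorem derivative_coeff_add_two (d : PowerSeries R) (n : ℕ) :
    PowerSeries.coeff n (PowerSeries.derivative R (PowerSeries.derivative R d)) =
      PowerSeries.coeff (n + 2) d * ((n + 2 : ℕ) * (n + 1 : ℕ)) := by
  rw [PowerSeries.coeff_derivative, PowerSeries.coeff_derivative]
  push_cast
  ring

/-- The addition formula for `f(U) f(-U)`, where `f` is the exponential of a formal group with
modulus square `buchstaberTwoValued`. -/
theorem normSeries_addition {F : FormalGroup R} {i f g : PowerSeries R} {a₁ a₂ a₃ : R}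
    (hg : IsLogarithm F g) (hfg : AreCompInverse f g) (hgi : g.subst i = -g)
    (hi : PowerSeries.constantCoeff i = 0)
    (hm : IsModulusSquareWith F i (buchstaberTwoValued a₁ a₂ a₃)) :
    ((normSeries f).subst (varU R + varV R) + (normSeries f).subst (varU R - varV R)) *
        quadCoeff₂ (MvPowerSeries.C a₁) (MvPowerSeries.C a₂) (MvPowerSeries.C a₃)
          (atU (normSeries f)) (atV (normSeries f)) =
      -quadCoeff₁ (MvPowerSeries.C a₁) (MvPowerSeries.C a₂) (MvPowerSeries.C a₃)
          (atU (normSeries f)) (atV (normSeries f)) := by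
  have hU : MvPowerSeries.constantCoeff (varU R) = 0 := by simp
  have hV : MvPowerSeries.constantCoeff (varV R) = 0 := by simp
  have hf0 := hfg.1
  have hg0 := hfg.2.1
  have hfU := constantCoeff_atU hf0
  have hfV := constantCoeff_atV hf0
  have hs := hasSubst_pair hfU hfV
  have hiU := constantCoeff_atU hi
  have hiV := constantCoeff_atV hi
  have hgI : ∀ {Z : MvPowerSeries (Fin 2) R}, MvPowerSeries.constantCoeff Z = 0 →
      g.subst (i.subst Z) = -g.subst Z := by
    intro Z hZ
    have hZs := PowerSeries.HasSubst.of_constantCoeff_zero hZ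
    rw [← PowerSeries.subst_comp_subst_apply (PowerSeries.HasSubst.of_constantCoeff_zero' hi) hZs,
      hgi, ← PowerSeries.coe_substAlgHom hZs, map_neg]
  -- In the coordinate U = g(u) the inverse is U ↦ −U.
  have hiX : ∀ {Z : MvPowerSeries (Fin 2) R}, MvPowerSeries.constantCoeff Z = 0 →
      i.subst (f.subst Z) = f.subst (-Z) := by
    intro Z hZ
    have h0 := constantCoeff_subst_eq_zero' hZ hf0
    rw [← hfg.subst_subst (constantCoeff_subst_eq_zero' h0 hi), hgI h0, hfg.symm.subst_subst hZ]
  have hx : ∀ {Z : MvPowerSeries (Fin 2) R}, MvPowerSeries.constantCoeff Z = 0 →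
      f.subst Z * i.subst (f.subst Z) = (normSeries f).subst Z := by
    intro Z hZ
    rw [hiX hZ, subst_normSeries hZ]
  have hlaw : ∀ {A B : MvPowerSeries (Fin 2) R}, MvPowerSeries.constantCoeff A = 0 →
      MvPowerSeries.constantCoeff B = 0 →
      F.toPowerSeries.subst ![A, B] = f.subst (g.subst A + g.subst B) := fun hA hB => by
    rw [isLogarithm_toPowerSeries_eq hg hfg, law_subst_pair hg0 hA hB]
  have h := congrArg (MvPowerSeries.substAlgHom hs) ((isModulusSquareWith_iff _ _ _).mp hm).1
  have hC : ∀ r : R, MvPowerSeries.substAlgHom hs (MvPowerSeries.C r) = MvPowerSeries.C r :=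
    fun r => by rw [MvPowerSeries.coe_substAlgHom, MvPowerSeries.subst_C]
  have eiU : MvPowerSeries.constantCoeff (i.subst (atU f)) = 0 := constantCoeff_subst_eq_zero' hfU hi
  have eiV : MvPowerSeries.constantCoeff (i.subst (atV f)) = 0 := constantCoeff_subst_eq_zero' hfV hi
  rw [map_mul, map_add, map_mul, map_mul, map_neg, map_quadCoeff₂, map_quadCoeff₁, map_mul, map_mul,
    hC, hC, hC] at h
  simp only [MvPowerSeries.coe_substAlgHom] at h
  rw [subst_pair_subst hiU hiV _ hs, subst_pair_subst hU hiV _ hs, subst_pair_subst hiU hV _ hs,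
    subst_pair_atU hfU hfV, subst_pair_atV hfU hfV, subst_pair_varU hfU hfV, subst_pair_varV hfU hfV,
    hlaw hfU hfV, hlaw eiU eiV, hlaw hfU eiV, hlaw eiU hfV, hgI hfU, hgI hfV,
    hfg.symm.subst_subst hU, hfg.symm.subst_subst hV, hx hU, hx hV] at h
  rw [subst_normSeries (by rw [map_add, hU, hV, add_zero]),
    subst_normSeries (by rw [map_sub, hU, hV, sub_zero]), neg_add, neg_sub, sub_eq_add_neg,
    sub_eq_neg_add]
  exact h

variable [Algebra ℚ R]

/-- An odd series Xκ(X²) has square Y κ(Y)² at Y = X². The two series in Y so obtained are inverse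
because f and s are, and substitution of X² is injective. -/
theorem exists_inverse_of_sq {f s : PowerSeries R} (h : AreCompInverse f s)
    (hf : f.subst (-PowerSeries.X : PowerSeries R) = -f) :
    ∃ B E : PowerSeries R, B.subst (PowerSeries.X ^ 2 : PowerSeries R) = f ^ 2 ∧
      E.subst (PowerSeries.X ^ 2 : PowerSeries R) = s ^ 2 ∧ AreCompInverse B E := by
  have hX := PowerSeries.HasSubst.of_constantCoeff_zero' (constantCoeff_X_sq (R := R))
  have key : ∀ {p : PowerSeries R}, p.subst (-PowerSeries.X : PowerSeries R) = -p →
      ∃ P : PowerSeries R, PowerSeries.constantCoeff P = 0 ∧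
        P.subst (PowerSeries.X ^ 2 : PowerSeries R) = p ^ 2 := by
    intro p hp
    obtain ⟨κ, hκ⟩ := exists_eq_X_mul_subst_sq hp
    refine ⟨PowerSeries.X * κ ^ 2, by simp, ?_⟩
    rw [PowerSeries.subst_mul hX, PowerSeries.subst_X hX, PowerSeries.subst_pow hX, hκ]
    ring
  have comp : ∀ {p q P Q : PowerSeries R}, AreCompInverse p q → PowerSeries.constantCoeff Q = 0 →
      P.subst (PowerSeries.X ^ 2 : PowerSeries R) = p ^ 2 →
      Q.subst (PowerSeries.X ^ 2 : PowerSeries R) = q ^ 2 →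
      P.subst Q = (PowerSeries.X : PowerSeries R) := by
    intro p q P Q hpq hQ hP2 hQ2
    have hqs := PowerSeries.HasSubst.of_constantCoeff_zero' hpq.2.1
    apply subst_X_sq_injective
    have e : PowerSeries.subst q (PowerSeries.X ^ 2 : PowerSeries R) = q ^ 2 := by
      rw [PowerSeries.subst_pow hqs, PowerSeries.subst_X hqs]
    rw [PowerSeries.subst_comp_subst_apply (PowerSeries.HasSubst.of_constantCoeff_zero' hQ) hX, hQ2,
      ← e, ← PowerSeries.subst_comp_subst_apply hX hqs, hP2, PowerSeries.subst_pow hqs, hpq.2.2.1,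
      PowerSeries.subst_X hX]
  obtain ⟨B, hB0, hB⟩ := key hf
  obtain ⟨E, hE0, hE⟩ := key (h.odd hf)
  exact ⟨B, E, hB, hE, hB0, hE0, comp h hE0 hB hE, comp h.symm hB0 hE hB⟩

/-- The two-valued logarithm of the modulus square is a logarithm for the law `lawBc`. -/
theorem subst_neg_X_sq_eq_logBc {a₁ a₂ a₃ : R} {B : PowerSeries R}
    (hB : B.subst (PowerSeries.X ^ 2 : PowerSeries R) = abelianIntegral a₁ a₂ a₃ ^ 2) :
    B.subst (PowerSeries.X * -PowerSeries.X : PowerSeries R) =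
      logBc a₁ a₂ a₃ * (logBc a₁ a₂ a₃).subst (-PowerSeries.X : PowerSeries R) := by
  have hX := PowerSeries.HasSubst.of_constantCoeff_zero' (constantCoeff_X_sq (R := R))
  have hm := PowerSeries.HasSubst.of_constantCoeff_zero'
    (show PowerSeries.constantCoeff (PowerSeries.X * -PowerSeries.X : PowerSeries R) = 0 by simp)
  have hB' : B = PowerSeries.X * reducedIntegral a₁ a₂ a₃ ^ 2 := by
    apply subst_X_sq_injective
    rw [hB, abelianIntegral_eq, PowerSeries.subst_mul hX, PowerSeries.subst_X hX,
      PowerSeries.subst_pow hX]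
    ring
  have hn : PowerSeries.HasSubst ((-1 : R) • PowerSeries.X : PowerSeries R) :=
    PowerSeries.HasSubst.of_constantCoeff_zero' (by simp)
  have hk : (reducedIntegral (-a₁) a₂ (-a₃)).subst (PowerSeries.X ^ 2 : PowerSeries R) =
      (reducedIntegral a₁ a₂ a₃).subst (PowerSeries.X * -PowerSeries.X : PowerSeries R) := by
    rw [reducedIntegral_neg, PowerSeries.rescale_eq_subst,
      PowerSeries.subst_comp_subst_apply hn hX, neg_one_smul, ← PowerSeries.coe_substAlgHom hX,
      map_neg, PowerSeries.substAlgHom_X]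
    congr 1
    ring
  rw [logBc_eq_abelianIntegral, abelianIntegral_odd, abelianIntegral_eq, hk, hB',
    PowerSeries.subst_mul hm, PowerSeries.subst_X hm, PowerSeries.subst_pow hm]
  ring

/-- φ(V) = −V² + ⋯ has a double zero, so the second V-derivative of the addition formula at V = 0
involves only the part of it linear in φ(V). -/
theorem normSeries_derivative_derivative {f : PowerSeries R} {a₁ a₂ a₃ : R}
    (h0 : PowerSeries.constantCoeff f = 0)
    (h1 : PowerSeries.constantCoeff (PowerSeries.derivative R f) = 1)
    (h : ((normSeries f).subst (varU R + varV R) + (normSeries f).subst (varU R - varV R)) *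
        quadCoeff₂ (MvPowerSeries.C a₁) (MvPowerSeries.C a₂) (MvPowerSeries.C a₃)
          (atU (normSeries f)) (atV (normSeries f)) =
      -quadCoeff₁ (MvPowerSeries.C a₁) (MvPowerSeries.C a₂) (MvPowerSeries.C a₃)
          (atU (normSeries f)) (atV (normSeries f))) :
    PowerSeries.derivative R (PowerSeries.derivative R (normSeries f)) =
      -(2 + 4 * PowerSeries.C a₁ * normSeries f + 6 * PowerSeries.C a₂ * normSeries f ^ 2 +
        8 * PowerSeries.C a₃ * normSeries f ^ 3) := by
  have hφ0 := constantCoeff_normSeries h0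
  have hφ1 := constantCoeff_derivative_normSeries h0
  have hφ2 := constantCoeff_derivative_derivative_normSeries h0 h1
  generalize normSeries f = φ at *
  have hp : MvPowerSeries.constantCoeff (varU R + varV R) = 0 := by simp
  have hm : MvPowerSeries.constantCoeff (varU R - varV R) = 0 := by simp
  set T := φ.subst (varU R + varV R) + φ.subst (varU R - varV R) with hT
  set A := atU φ with hA
  set D := atV φ with hD
  -- W collects everything in the addition formula multiplied by φ(V), so that it reads T + φ(V)W =
  -- 2φ(U); the second derivative then gives φ'' = W(U, 0).
  set W := T * (-2 * MvPowerSeries.C a₂ * A + MvPowerSeries.C a₂ ^ 2 * A ^ 2 * D -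
      4 * MvPowerSeries.C a₃ * A * (A + D + MvPowerSeries.C a₁ * A * D)) +
    (-2 - 2 * MvPowerSeries.C a₂ * A * (A + D) - 4 * MvPowerSeries.C a₁ * A -
      4 * MvPowerSeries.C a₃ * A ^ 2 * D) with hW
  have hTW : T + D * W = 2 * A := by
    rw [quadCoeff₂, quadCoeff₁] at h
    linear_combination h
  have d1 : ∀ ψ : PowerSeries R,
      MvPowerSeries.pderiv R 1 (ψ.subst (varU R + varV R)) =
        (PowerSeries.derivative R ψ).subst (varU R + varV R) := by
    intro ψ
    rw [pderiv_powerSeries_subst hp, map_add, MvPowerSeries.pderiv_X_self,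
      MvPowerSeries.pderiv_X_of_ne (by decide), zero_add, mul_one]
  have d2 : ∀ ψ : PowerSeries R,
      MvPowerSeries.pderiv R 1 (ψ.subst (varU R - varV R)) =
        -(PowerSeries.derivative R ψ).subst (varU R - varV R) := by
    intro ψ
    rw [pderiv_powerSeries_subst hm, map_sub, MvPowerSeries.pderiv_X_self,
      MvPowerSeries.pderiv_X_of_ne (by decide), zero_sub, mul_neg, mul_one]
  have r1 : ∀ ψ : PowerSeries R, atZeroV (ψ.subst (varU R + varV R)) = ψ := fun ψ => by
    rw [atZeroV_subst hp, map_add, atZeroV_varU, atZeroV_varV, add_zero, PowerSeries.X_subst]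
  have r2 : ∀ ψ : PowerSeries R, atZeroV (ψ.subst (varU R - varV R)) = ψ := fun ψ => by
    rw [atZeroV_subst hm, map_sub, atZeroV_varU, atZeroV_varV, sub_zero, PowerSeries.X_subst]
  have hD0 : atZeroV D = 0 := by rw [hD, atZeroV_atV, hφ0, map_zero]
  have hD1 : atZeroV (MvPowerSeries.pderiv R 1 D) = 0 := by
    rw [hD, pderiv_one_atV, atZeroV_atV, hφ1, map_zero]
  have hD2 : atZeroV (MvPowerSeries.pderiv R 1 (MvPowerSeries.pderiv R 1 D)) = -2 := by
    rw [hD, pderiv_one_atV, pderiv_one_atV, atZeroV_atV, hφ2, map_neg, map_ofNat]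
  have hA0 : atZeroV A = φ := atZeroV_atU φ
  have hT0 : atZeroV T = 2 * φ := by rw [hT, map_add, r1, r2, two_mul]
  have hT2 : atZeroV (MvPowerSeries.pderiv R 1 (MvPowerSeries.pderiv R 1 T)) =
      2 * PowerSeries.derivative R (PowerSeries.derivative R φ) := by
    rw [hT, map_add, d1, d2, map_add, map_neg, d1, d2, neg_neg, map_add, r1, r2, two_mul]
  have hA2 : MvPowerSeries.pderiv R 1 (2 * A) = 0 := by
    rw [two_mul, map_add, hA, pderiv_one_atU, add_zero]
  have hW0 : atZeroV W = 2 * φ * (-2 * PowerSeries.C a₂ * φ - 4 * PowerSeries.C a₃ * φ ^ 2) +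
      (-2 - 2 * PowerSeries.C a₂ * φ ^ 2 - 4 * PowerSeries.C a₁ * φ) := by
    simp only [hW, map_add, map_sub, map_mul, map_neg, map_pow, map_ofNat, hT0, hA0, hD0,
      atZeroV_C]
    ring
  have hfin := congrArg (fun M => atZeroV (MvPowerSeries.pderiv R 1 (MvPowerSeries.pderiv R 1 M)))
    hTW
  simp only [map_add, hA2, map_zero, hT2, atZeroV_pderiv_pderiv_mul hD0 hD1, hD2, hW0] at hfin
  have h2 : IsUnit (2 : PowerSeries R) := by
    have := (isUnit_two (R := R)).map (PowerSeries.C (R := R))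
    rwa [map_ofNat] at this
  apply h2.mul_left_cancel
  linear_combination hfin

/-- The coefficient of degree n + 2 of d is determined by those of degree at most n. -/
theorem eq_zero_of_derivative_derivative_eq_mul {d K : PowerSeries R}
    (h0 : PowerSeries.constantCoeff d = 0)
    (h1 : PowerSeries.constantCoeff (PowerSeries.derivative R d) = 0)
    (h : PowerSeries.derivative R (PowerSeries.derivative R d) = d * K) : d = 0 := by
  have : IsAddTorsionFree R := .of_module_rat R
  ext n
  rw [map_zero]
  induction n using Nat.strong_induction_on with
  | _ n ih =>
    rcases n with _ | _ | n
    · simpa using h0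
    · rw [constantCoeff_derivative] at h1
      exact h1
    · have hn := congrArg (PowerSeries.coeff n) h
      rw [derivative_coeff_add_two, PowerSeries.coeff_mul, Finset.sum_eq_zero] at hn
      · rw [← Nat.cast_mul, mul_comm, ← nsmul_eq_mul] at hn
        exact (smul_eq_zero.mp hn).resolve_left (by positivity)
      · intro p hp
        rw [ih p.1 (by have := Finset.HasAntidiagonal.mem_antidiagonal.mp hp; omega), zero_mul]

/-- The difference of two solutions satisfies a linear equation d'' = Kd, where K is the divided
difference of the cubic right-hand side. -/
theorem eq_of_derivative_derivative_eq {φ ψ : PowerSeries R} {a₁ a₂ a₃ : R}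
    (hφ0 : PowerSeries.constantCoeff φ = 0) (hψ0 : PowerSeries.constantCoeff ψ = 0)
    (hφ1 : PowerSeries.constantCoeff (PowerSeries.derivative R φ) = 0)
    (hψ1 : PowerSeries.constantCoeff (PowerSeries.derivative R ψ) = 0)
    (hφ : PowerSeries.derivative R (PowerSeries.derivative R φ) =
      -(2 + 4 * PowerSeries.C a₁ * φ + 6 * PowerSeries.C a₂ * φ ^ 2 +
        8 * PowerSeries.C a₃ * φ ^ 3))
    (hψ : PowerSeries.derivative R (PowerSeries.derivative R ψ) =
      -(2 + 4 * PowerSeries.C a₁ * ψ + 6 * PowerSeries.C a₂ * ψ ^ 2 +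
        8 * PowerSeries.C a₃ * ψ ^ 3)) : φ = ψ := by
  rw [← sub_eq_zero]
  apply eq_zero_of_derivative_derivative_eq_mul
    (K := -(4 * PowerSeries.C a₁ + 6 * PowerSeries.C a₂ * (φ + ψ) +
      8 * PowerSeries.C a₃ * (φ ^ 2 + φ * ψ + ψ ^ 2)))
  · rw [map_sub, hφ0, hψ0, sub_zero]
  · rw [map_sub, map_sub, hφ1, hψ1, sub_zero]
  · rw [map_sub, map_sub, hφ, hψ]
    ring

/-- The data of a two-valued logarithm in terms of `φ = f(U) f(-U)`. -/
theorem IsTwoValuedLogarithm.exists_series {a₁ a₂ a₃ : R} {B : PowerSeries R}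
    (h : IsTwoValuedLogarithm (buchstaberTwoValued a₁ a₂ a₃) B) :
    ∃ φ : PowerSeries R, PowerSeries.constantCoeff φ = 0 ∧
      PowerSeries.constantCoeff (PowerSeries.derivative R φ) = 0 ∧
      PowerSeries.derivative R (PowerSeries.derivative R φ) =
        -(2 + 4 * PowerSeries.C a₁ * φ + 6 * PowerSeries.C a₂ * φ ^ 2 +
          8 * PowerSeries.C a₃ * φ ^ 3) ∧
      B.subst φ = (-PowerSeries.X ^ 2 : PowerSeries R) := by
  obtain ⟨F, i, g, -, hi, hm, hg, hB⟩ := h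
  obtain ⟨f, hgf⟩ := exists_areCompInverse hg.1 hg.2.1
  have hfg := hgf.symm
  have hX : MvPowerSeries.constantCoeff (PowerSeries.X : PowerSeries R) = 0 :=
    PowerSeries.constantCoeff_X
  have hi0 : MvPowerSeries.constantCoeff (i : PowerSeries R) = 0 := hi.1
  have hfs := PowerSeries.HasSubst.of_constantCoeff_zero' hfg.1
  have his := PowerSeries.HasSubst.of_constantCoeff_zero' hi.1
  have hgi : g.subst i = -g := by
    have h1 := hi.2
    rw [isLogarithm_toPowerSeries_eq hg hfg, law_subst_pair hg.1 hX hi0] at h1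
    have hc : MvPowerSeries.constantCoeff (PowerSeries.subst PowerSeries.X g +
        PowerSeries.subst i g : PowerSeries R) = 0 := by
      rw [map_add, constantCoeff_subst_eq_zero' hX hg.1, constantCoeff_subst_eq_zero' hi0 hg.1,
        add_zero]
    have h2 := congrArg (PowerSeries.subst · g) h1
    rw [hgf.subst_subst hc, powerSeries_subst_zero, hg.1, map_zero, PowerSeries.X_subst] at h2
    exact eq_neg_of_add_eq_zero_right h2
  have hif : i.subst f = f.subst (-PowerSeries.X : PowerSeries R) := by
    have h0 : MvPowerSeries.constantCoeff (i.subst f) = 0 := constantCoeff_subst_eq_zero' hfg.1 hi.1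
    rw [← hfg.subst_subst h0, ← PowerSeries.subst_comp_subst_apply his hfs, hgi,
      ← PowerSeries.coe_substAlgHom hfs, map_neg, PowerSeries.coe_substAlgHom, hfg.2.2.2]
  have hf1 : PowerSeries.constantCoeff (PowerSeries.derivative R f) = 1 := by
    rw [constantCoeff_derivative]
    simpa [hg.2.1] using hfg.coeff_one_mul
  refine ⟨normSeries f, constantCoeff_normSeries hfg.1, constantCoeff_derivative_normSeries hfg.1,
    normSeries_derivative_derivative hfg.1 hf1 (normSeries_addition hg hfg hgi hi.1 hm), ?_⟩
  have hXi : PowerSeries.HasSubst (PowerSeries.X * i) :=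
    PowerSeries.HasSubst.of_constantCoeff_zero' (by simp)
  -- At u = f(U) the relation B(uū) = g(u)g(ū) becomes B(φ(U)) = U · (−U).
  have h3 := congrArg (PowerSeries.subst f) hB
  rw [PowerSeries.subst_comp_subst_apply hXi hfs, PowerSeries.subst_mul hfs, PowerSeries.subst_X hfs,
    hif, hgi, PowerSeries.subst_mul hfs, ← PowerSeries.coe_substAlgHom hfs, map_neg,
    PowerSeries.coe_substAlgHom, hfg.2.2.2] at h3
  rw [normSeries, h3]
  ring

theorem isTwoValuedLogarithm_buchstaberTwoValued {a₁ a₂ a₃ : R} {B : PowerSeries R}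
    (hB : B.subst (PowerSeries.X ^ 2 : PowerSeries R) = abelianIntegral a₁ a₂ a₃ ^ 2) :
    IsTwoValuedLogarithm (buchstaberTwoValued a₁ a₂ a₃) B := by
  obtain ⟨F, hF, hc, hg⟩ := exists_formalGroup_lawBc a₁ a₂ a₃
  exact ⟨F, -PowerSeries.X, _, hc, isFormalInverse_lawBc hF, isModulusSquareWith_lawBc isUnit_two hF,
    hg, subst_neg_X_sq_eq_logBc hB⟩

/-- Both logarithms see the same φ, by the differential equation. Since φ = E(−X²), this makes B' a
left inverse of E, hence equal to B. -/
theorem IsTwoValuedLogarithm.unique {a₁ a₂ a₃ : R} {B B' E : PowerSeries R}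
    (hB : IsTwoValuedLogarithm (buchstaberTwoValued a₁ a₂ a₃) B)
    (hB' : IsTwoValuedLogarithm (buchstaberTwoValued a₁ a₂ a₃) B')
    (hE : AreCompInverse B E) : B' = B := by
  obtain ⟨φ, hφ0, hφ1, hφ2, hφ⟩ := hB.exists_series
  obtain ⟨ψ, hψ0, hψ1, hψ2, hψ⟩ := hB'.exists_series
  rw [← eq_of_derivative_derivative_eq hφ0 hψ0 hφ1 hψ1 hφ2 hψ2] at hψ
  have hn : PowerSeries.constantCoeff (-PowerSeries.X ^ 2 : PowerSeries R) = 0 := by simp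
  have hns := PowerSeries.HasSubst.of_constantCoeff_zero' hn
  have hEs := PowerSeries.HasSubst.of_constantCoeff_zero' hE.2.1
  have hφE : φ = E.subst (-PowerSeries.X ^ 2 : PowerSeries R) := by
    rw [← hφ, hE.symm.subst_subst hφ0]
  have h1 : B'.subst E = (PowerSeries.X : PowerSeries R) := by
    apply subst_neg_X_sq_injective
    rw [PowerSeries.subst_comp_subst_apply hEs hns, ← hφE, hψ, PowerSeries.subst_X hns]
  have h2 := congrArg (PowerSeries.subst B) h1
  have hBs := PowerSeries.HasSubst.of_constantCoeff_zero' hE.1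
  rwa [PowerSeries.subst_comp_subst_apply hEs hBs, hE.2.2.2, PowerSeries.X_subst,
    PowerSeries.subst_X hBs] at h2

/-- The logarithm and the exponential of the two-valued formal group. -/
theorem exists_twoValuedLogarithm (a₁ a₂ a₃ : R) :
    ∃ B E : PowerSeries R,
      (∀ B' : PowerSeries R, IsTwoValuedLogarithm (buchstaberTwoValued a₁ a₂ a₃) B' ↔ B' = B) ∧
      B.subst (PowerSeries.X ^ 2 : PowerSeries R) = abelianIntegral a₁ a₂ a₃ ^ 2 ∧
      AreCompInverse B E ∧
      HahnSeries.ofPowerSeries ℤ R (E.subst (PowerSeries.X ^ 2 : PowerSeries R)) *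
        (wpSeries (invariant₂ a₁ a₂) (invariant₃ a₁ a₂ a₃)
          - HahnSeries.C ((1 / 3 : ℚ) • a₁)) = 1 := by
  obtain ⟨s, hs⟩ := exists_areCompInverse (constantCoeff_abelianIntegral a₁ a₂ a₃)
    (coeff_one_abelianIntegral a₁ a₂ a₃)
  obtain ⟨B, E, hB, hE, hBE⟩ := exists_inverse_of_sq hs (abelianIntegral_odd a₁ a₂ a₃)
  have hlog := isTwoValuedLogarithm_buchstaberTwoValued hB
  refine ⟨B, E, fun B' => ⟨fun h => hlog.unique h hBE, fun h => h ▸ hlog⟩, hB, hBE, ?_⟩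
  rw [hE]
  exact inverse_sq_mul_wpSeries hs

/-- The exponential of the law `lawBc`. -/
theorem exists_isExponential_lawBc {F : FormalGroup R} {a₁ a₂ a₃ : R}
    (hg : IsLogarithm F (logBc a₁ a₂ a₃)) :
    ∃ f : PowerSeries R, IsExponential F f ∧
      HahnSeries.ofPowerSeries ℤ R f ^ 2 *
        (wpSeries (invariant₂ a₁ a₂) (-invariant₃ a₁ a₂ a₃)
          + HahnSeries.C ((1 / 3 : ℚ) • a₁)) = 1 := by
  obtain ⟨f, hf⟩ := exists_areCompInverse hg.1 hg.2.1
  refine ⟨f, isExponential_of_isLogarithm hg hf.symm, ?_⟩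
  rw [logBc_eq_abelianIntegral] at hf
  have h := inverse_sq_mul_wpSeries hf
  -- Passing to (−a₁, a₂, −a₃) fixes g₂, which has even weight, and negates g₃ and a₁/3.
  have e2 : invariant₂ (-a₁) a₂ = invariant₂ a₁ a₂ := by rw [invariant₂, invariant₂, neg_sq]
  have e3 : invariant₃ (-a₁) a₂ (-a₃) = -invariant₃ a₁ a₂ a₃ := by
    rw [invariant₃, invariant₃, neg_mul, smul_neg, Odd.neg_pow (by decide), smul_neg]
    ring
  rwa [map_pow, e2, e3, smul_neg, map_neg, sub_neg_eq_add] at h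

end TwoValued

/-! ### The Weierstrass function near its pole -/

section Complex

theorem analyticAt_dslope {f : ℂ → ℂ} {c : ℂ} (hf : AnalyticAt ℂ f c) :
    AnalyticAt ℂ (dslope f c) c := by
  have hs := hf.eventually_analyticAt
  refine DifferentiableOn.analyticAt (s := {z | AnalyticAt ℂ f z}) ?_ hs
  exact (Complex.differentiableOn_dslope hs).mpr fun z hz => hz.differentiableAt.differentiableWithinAt

/-- The properties of `℘` near `0` on which the inversion of the integral rests. -/
def IsWeierstrassPNearZero (g₂ g₃ : ℂ) (p : ℂ → ℂ) : Prop :=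
  (∃ N : ℂ → ℂ, AnalyticAt ℂ N 0 ∧ N 0 = 1 ∧ ∀ᶠ z in 𝓝[≠] (0 : ℂ), p z = N z / z ^ 2) ∧
    ∀ᶠ z in 𝓝[≠] (0 : ℂ), ∃ d, HasDerivAt p d z ∧ d ^ 2 = 4 * p z ^ 3 - g₂ * p z - g₃

theorem isWeierstrassPNearZero_lattice (L : PeriodPair) :
    IsWeierstrassPNearZero L.g₂ L.g₃ L.weierstrassP := by
  have hL : ∀ᶠ z in 𝓝[≠] (0 : ℂ), z ∉ L.lattice := by
    rw [eventually_nhdsWithin_iff]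
    filter_upwards [L.compl_lattice_sdiff_singleton_mem_nhds 0] with z hz hz0 hzL
    exact hz ⟨hzL, hz0⟩
  refine ⟨⟨fun z => 1 + z ^ 2 * L.weierstrassPExcept 0 z, ?_, by simp, ?_⟩, ?_⟩
  · have := L.analyticAt_weierstrassPExcept 0
    fun_prop
  · filter_upwards [self_mem_nhdsWithin] with z hz
    have h := L.weierstrassPExcept_add 0 z
    have hz : z ≠ 0 := hz
    simp only [ZeroMemClass.coe_zero, sub_zero] at h
    rw [← h]
    field_simp
    simp
    ring
  · filter_upwards [hL] with z hz
    refine ⟨L.derivWeierstrassP z, ?_, L.derivWeierstrassP_sq z hz⟩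
    rw [← L.deriv_weierstrassP]
    exact (L.analyticOnNhd_weierstrassP z hz).differentiableAt.hasDerivAt

theorem eventually_sinh_ne_zero {k : ℂ} (hk : k ≠ 0) :
    ∀ᶠ z in 𝓝[≠] (0 : ℂ), Complex.sinh (k * z) ≠ 0 := by
  have h : HasDerivAt (fun z : ℂ => Complex.sinh (k * z)) (Complex.cosh (k * 0) * (k * 1)) 0 :=
    ((hasDerivAt_id (0 : ℂ)).const_mul k).csinh
  have := h.eventually_ne (c := 0) (by simpa using hk)
  exact this

/-- Here ℘(z) = k²/sinh²(kz) + k²/3, or 1/z² for k = 0; the differential equation reduces to cosh² =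
sinh² + 1. -/
theorem isWeierstrassPNearZero_degenerate (k : ℂ) :
    IsWeierstrassPNearZero (4 * k ^ 4 / 3) (-8 * k ^ 6 / 27)
      (fun z => -deriv (logDeriv (degenerateSigma k)) z) := by
  by_cases hk : k = 0
  · subst hk
    have hp : ∀ z : ℂ, z ≠ 0 → -deriv (logDeriv (degenerateSigma 0)) z = 1 / z ^ 2 := by
      intro z hz
      have : logDeriv (degenerateSigma 0) = fun z => z⁻¹ := by
        have e : degenerateSigma 0 = fun z => z := by funext z; simp [degenerateSigma]
        funext z
        rw [e, logDeriv_apply]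
        simp
      rw [this, deriv_inv]
      simp
    refine ⟨⟨fun _ => 1, analyticAt_const, rfl, ?_⟩, ?_⟩
    · filter_upwards [self_mem_nhdsWithin] with z hz
      exact hp z hz
    · filter_upwards [self_mem_nhdsWithin] with z hz
      have hz : z ≠ 0 := hz
      refine ⟨-(2 * z) / (z ^ 2) ^ 2, ?_, ?_⟩
      · have h : HasDerivAt (fun z : ℂ => 1 / z ^ 2) (-(2 * z) / (z ^ 2) ^ 2) z := by
          simpa using ((hasDerivAt_pow 2 z).fun_inv (pow_ne_zero 2 hz))
        refine h.congr_of_eventuallyEq ?_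
        filter_upwards [isOpen_ne.mem_nhds hz] with y hy
        exact hp y hy
      · simp only [hp z hz]
        field_simp
        norm_num
  · have hp : ∀ z : ℂ, Complex.sinh (k * z) ≠ 0 →
        -deriv (logDeriv (degenerateSigma k)) z = k ^ 2 / Complex.sinh (k * z) ^ 2 + k ^ 2 / 3 := by
      have hlog : ∀ z : ℂ, Complex.sinh (k * z) ≠ 0 → logDeriv (degenerateSigma k) z =
          k * Complex.cosh (k * z) / Complex.sinh (k * z) - k ^ 2 * z / 3 := by
        intro z hz
        have h1 : HasDerivAt (fun z : ℂ => Complex.sinh (k * z) / k)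
            (Complex.cosh (k * z) * (k * 1) / k) z :=
          (((hasDerivAt_id z).const_mul k).csinh).div_const k
        have h2 : HasDerivAt (fun z : ℂ => Complex.exp (-(k ^ 2 * z ^ 2) / 6))
            (Complex.exp (-(k ^ 2 * z ^ 2) / 6) * (-(k ^ 2 * (((2 : ℕ) : ℂ) * z ^ (2 - 1))) / 6)) z :=
          ((((hasDerivAt_pow 2 z).const_mul (k ^ 2)).fun_neg).div_const 6).cexp
        have e : degenerateSigma k = fun z => Complex.sinh (k * z) / k *
            Complex.exp (-(k ^ 2 * z ^ 2) / 6) := by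
          funext z
          rw [degenerateSigma, if_neg hk]
        have hE := Complex.exp_ne_zero (-(k ^ 2 * z ^ 2) / 6)
        rw [e, logDeriv_apply, (h1.fun_mul h2).deriv]
        field_simp
        push_cast
        ring
      intro z hz
      have hev : logDeriv (degenerateSigma k) =ᶠ[𝓝 z]
          fun z => k * Complex.cosh (k * z) / Complex.sinh (k * z) - k ^ 2 * z / 3 := by
        have hc : Continuous fun z : ℂ => Complex.sinh (k * z) := by fun_prop
        filter_upwards [hc.continuousAt.eventually_ne hz] with y hy
        exact hlog y hy
      have hs : HasDerivAt (fun z : ℂ => Complex.sinh (k * z)) (Complex.cosh (k * z) * (k * 1)) z :=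
        ((hasDerivAt_id z).const_mul k).csinh
      have hco : HasDerivAt (fun z : ℂ => k * Complex.cosh (k * z))
          (k * (Complex.sinh (k * z) * (k * 1))) z :=
        (((hasDerivAt_id z).const_mul k).ccosh).const_mul k
      have hl : HasDerivAt (fun z : ℂ => k ^ 2 * z / 3) (k ^ 2 * 1 / 3) z :=
        ((hasDerivAt_id z).const_mul (k ^ 2)).div_const 3
      rw [hev.deriv_eq, ((hco.fun_div hs hz).fun_sub hl).deriv]
      field_simp
      have := Complex.cosh_sq (k * z)
      linear_combination 3 * this
    have hsinh := eventually_sinh_ne_zero hk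
    have hsa : AnalyticAt ℂ (fun z : ℂ => Complex.sinh (k * z)) 0 := by fun_prop
    have hd0 : dslope (fun z : ℂ => Complex.sinh (k * z)) 0 0 = k := by
      have h : HasDerivAt (fun z : ℂ => Complex.sinh (k * z)) (Complex.cosh (k * 0) * (k * 1)) 0 :=
        ((hasDerivAt_id (0 : ℂ)).const_mul k).csinh
      rw [dslope_same, h.deriv]
      simp
    -- `dslope` is sinh(kz)/z with its removable singularity filled by the value k, so N is analytic
    -- with N(0) = 1.
    refine ⟨⟨fun z => k ^ 2 / dslope (fun z : ℂ => Complex.sinh (k * z)) 0 z ^ 2 +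
      k ^ 2 / 3 * z ^ 2, ?_, ?_, ?_⟩, ?_⟩
    · have h1 := analyticAt_dslope hsa
      have h2 : dslope (fun z : ℂ => Complex.sinh (k * z)) 0 0 ^ 2 ≠ 0 := by
        rw [hd0]; exact pow_ne_zero 2 hk
      exact (analyticAt_const.fun_div (h1.fun_pow 2) h2).fun_add
        (analyticAt_const.fun_mul (analyticAt_id.fun_pow 2))
    · simp only [hd0]
      field_simp
      simp
    · filter_upwards [hsinh, self_mem_nhdsWithin] with z hz hz0
      have hz0 : z ≠ 0 := hz0
      have h := sub_smul_dslope (fun z : ℂ => Complex.sinh (k * z)) 0 z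
      simp only [sub_zero, mul_zero, Complex.sinh_zero, smul_eq_mul] at h
      rw [hp z hz, ← h]
      have : dslope (fun z : ℂ => Complex.sinh (k * z)) 0 z ≠ 0 := by
        intro h0
        rw [h0, mul_zero] at h
        exact hz h.symm
      field_simp
    · filter_upwards [hsinh] with z hz
      have hs : HasDerivAt (fun z : ℂ => Complex.sinh (k * z)) (Complex.cosh (k * z) * (k * 1)) z :=
        ((hasDerivAt_id z).const_mul k).csinh
      have h : HasDerivAt (fun z : ℂ => k ^ 2 * (Complex.sinh (k * z) ^ 2)⁻¹ + k ^ 2 / 3)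
        (k ^ 2 * (-(((2 : ℕ) : ℂ) * Complex.sinh (k * z) ^ (2 - 1) *
          (Complex.cosh (k * z) * (k * 1))) / (Complex.sinh (k * z) ^ 2) ^ 2)) z :=
        ((((hs.fun_pow 2).fun_inv (pow_ne_zero 2 hz)).const_mul (k ^ 2))).add_const _
      refine ⟨_, h.congr_of_eventuallyEq ?_, ?_⟩
      · have hc : Continuous fun z : ℂ => Complex.sinh (k * z) := by fun_prop
        filter_upwards [hc.continuousAt.eventually_ne hz] with y hy
        rw [hp y hy, div_eq_mul_inv]
      · simp only [hp z hz]
        have := Complex.cosh_sq (k * z)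
        field_simp
        push_cast
        rw [this]
        ring

theorem IsWeierstrassP.nearZero {g₂ g₃ : ℂ} {p : ℂ → ℂ} (h : IsWeierstrassP g₂ g₃ p) :
    IsWeierstrassPNearZero g₂ g₃ p := by
  rcases h with ⟨L, rfl, rfl, rfl⟩ | ⟨k, rfl, rfl, rfl⟩
  · exact isWeierstrassPNearZero_lattice L
  · exact isWeierstrassPNearZero_degenerate k

/-! ### The abelian integral as an analytic function -/

/-- The polynomial `1 + a₁ t² + a₂ t⁴ + a₃ t⁶`. -/
def sexticEval (a₁ a₂ a₃ t : ℂ) : ℂ := 1 + a₁ * t ^ 2 + a₂ * t ^ 4 + a₃ * t ^ 6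

/-- On a small disc the sextic stays in the slit plane, so the principal root is holomorphic and has
a primitive; the integral along the segment from 0 to s is a difference of its values. -/
theorem exists_integral_analyticAt (a₁ a₂ a₃ : ℂ) :
    ∃ u w : ℂ → ℂ, AnalyticAt ℂ u 0 ∧ u 0 = 0 ∧ w 0 = 1 ∧
      (∀ᶠ s in 𝓝 (0 : ℂ), HasDerivAt u (w s) s) ∧
      (∀ᶠ s in 𝓝 (0 : ℂ), w s ^ 2 * sexticEval a₁ a₂ a₃ s = 1) ∧
      ∀ᶠ s in 𝓝 (0 : ℂ), (∫ r in (0 : ℝ)..1, s / (1 + a₁ * (r * s) ^ 2 + a₂ * (r * s) ^ 4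
          + a₃ * (r * s) ^ 6) ^ (1 / 2 : ℂ)) = u s := by
  have hD : Differentiable ℂ (sexticEval a₁ a₂ a₃) := by
    unfold sexticEval
    fun_prop
  have hmem : sexticEval a₁ a₂ a₃ ⁻¹' Complex.slitPlane ∈ 𝓝 (0 : ℂ) :=
    hD.continuous.continuousAt.preimage_mem_nhds (Complex.isOpen_slitPlane.mem_nhds (by
      simp [sexticEval]))
  obtain ⟨ρ, hρ, hball⟩ := Metric.mem_nhds_iff.mp hmem
  have hB := Metric.ball_mem_nhds (0 : ℂ) hρ
  set w : ℂ → ℂ := fun t => (sexticEval a₁ a₂ a₃ t ^ (1 / 2 : ℂ))⁻¹ with hw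
  have hDne : ∀ t ∈ Metric.ball (0 : ℂ) ρ, sexticEval a₁ a₂ a₃ t ≠ 0 := fun t ht =>
    Complex.slitPlane_ne_zero (hball ht)
  have hwd : DifferentiableOn ℂ w (Metric.ball 0 ρ) := by
    intro t ht
    refine DifferentiableAt.differentiableWithinAt (DifferentiableAt.fun_inv ?_ ?_)
    · exact (hD t).cpow_const (hball ht)
    · rw [Complex.cpow_ne_zero_iff]
      exact Or.inl (hDne t ht)
  obtain ⟨F, hF⟩ := hwd.isExactOn_ball
  have hu : ∀ s ∈ Metric.ball (0 : ℂ) ρ, HasDerivAt (fun s => F s - F 0) (w s) s := fun s hs =>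
    (hF s hs).sub_const _
  refine ⟨fun s => F s - F 0, w, ?_, by simp, by simp [hw, sexticEval], ?_, ?_, ?_⟩
  · exact DifferentiableOn.analyticAt
      (fun s hs => (hu s hs).differentiableAt.differentiableWithinAt) hB
  · filter_upwards [hB] with s hs using hu s hs
  · filter_upwards [hB] with s hs
    have h : (sexticEval a₁ a₂ a₃ s ^ (1 / 2 : ℂ)) ^ 2 = sexticEval a₁ a₂ a₃ s := by
      rw [← Complex.cpow_nat_mul]
      norm_num
    rw [hw]
    simp only
    rw [inv_pow, h, inv_mul_cancel₀ (hDne s hs)]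
  · filter_upwards [hB] with s hs
    have hseg : ∀ r ∈ Set.uIcc (0 : ℝ) 1, (r : ℂ) * s ∈ Metric.ball (0 : ℂ) ρ := by
      intro r hr
      rw [Set.uIcc_of_le zero_le_one] at hr
      rw [mem_ball_zero_iff] at hs ⊢
      rw [norm_mul, Complex.norm_real, Real.norm_of_nonneg hr.1]
      exact (mul_le_of_le_one_left (norm_nonneg s) hr.2).trans_lt hs
    have hder : ∀ r ∈ Set.uIcc (0 : ℝ) 1,
        HasDerivAt (fun r : ℝ => F (r * s)) (w (r * s) * (1 * s)) r := by
      intro r hr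
      have h1 : HasDerivAt (fun z : ℂ => F (z * s)) (w (r * s) * (1 * s)) (r : ℂ) :=
        (hF _ (hseg r hr)).comp (r : ℂ) ((hasDerivAt_id (r : ℂ)).mul_const s)
      exact h1.comp_ofReal
    have hint : IntervalIntegrable (fun r : ℝ => w (r * s) * (1 * s)) MeasureTheory.volume 0 1 := by
      apply ContinuousOn.intervalIntegrable
      refine ContinuousOn.mul ?_ continuousOn_const
      exact hwd.continuousOn.comp (by fun_prop) hseg
    have := intervalIntegral.integral_eq_sub_of_hasDerivAt hder hint
    simp only [Complex.ofReal_one, Complex.ofReal_zero, one_mul, zero_mul] at this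
    rw [← this]
    refine intervalIntegral.integral_congr fun r _ => ?_
    simp only [hw, sexticEval, div_eq_mul_inv]
    rw [mul_comm]

/-! ### Inversion of the abelian integral -/

/-- If e vanished to finite order n, write e = sⁿφ with φ(0) ≠ 0. Dividing the equation by sⁿ and
letting s → 0 gives nA(0) = K(0), which is excluded. -/
theorem eventually_eq_zero_of_mul_deriv {e A K : ℂ → ℂ} (he : AnalyticAt ℂ e 0)
    (hA : ContinuousAt A 0) (hK : ContinuousAt K 0)
    (h : ∀ᶠ s in 𝓝[≠] (0 : ℂ), s * deriv e s * A s = e s * K s)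
    (hn : ∀ n : ℕ, n * A 0 ≠ K 0) : ∀ᶠ s in 𝓝 (0 : ℂ), e s = 0 := by
  by_contra hne
  obtain ⟨n, φ, hφ, hφ0, heφ⟩ := he.exists_eventuallyEq_pow_smul_nonzero_iff.mpr hne
  simp only [sub_zero, smul_eq_mul] at heφ
  have h1 : ∀ᶠ s in 𝓝[≠] (0 : ℂ),
      (n * φ s + s * deriv φ s) * A s = φ s * K s := by
    have hev := (heφ.eventually_nhds).filter_mono (nhdsWithin_le_nhds (s := {0}ᶜ))
    have hφa := (hφ.eventually_analyticAt).filter_mono (nhdsWithin_le_nhds (s := {0}ᶜ))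
    filter_upwards [h, hev, hφa, self_mem_nhdsWithin] with s hs hes hφs hs0
    have hs0 : s ≠ 0 := hs0
    have hd : deriv e s = (n * s ^ (n - 1)) * φ s + s ^ n * deriv φ s := by
      have hes' : e =ᶠ[𝓝 s] fun z => z ^ n * φ z := hes
      rw [hes'.deriv_eq]
      exact ((hasDerivAt_pow n s).fun_mul hφs.differentiableAt.hasDerivAt).deriv
    have hpow : s * (n * s ^ (n - 1)) = n * s ^ n := by
      rcases n with _ | n
      · simp
      · rw [Nat.add_sub_cancel, pow_succ]
        ring
    rw [hd, hes.self_of_nhds] at hs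
    apply mul_left_cancel₀ (pow_ne_zero n hs0)
    linear_combination hs - φ s * A s * hpow
  have hc1 : ContinuousAt (fun s => (n * φ s + s * deriv φ s) * A s) 0 :=
    ((continuousAt_const.mul hφ.continuousAt).add
      (continuousAt_id.mul hφ.deriv.continuousAt)).mul hA
  have hc2 : ContinuousAt (fun s => φ s * K s) 0 := hφ.continuousAt.mul hK
  have heq := tendsto_nhds_unique_of_eventuallyEq (hc1.tendsto.mono_left nhdsWithin_le_nhds)
    (hc2.tendsto.mono_left nhdsWithin_le_nhds) h1
  apply hn n
  apply mul_left_cancel₀ hφ0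
  simp only [zero_mul, add_zero] at heq
  linear_combination heq

/-- H(s) = s²p(u(s)) extends analytically with H(0) = 1. It satisfies the same first-order equation
as q = 1 + cs², and the order argument applied to e = H − q shows H = q. -/
theorem IsWeierstrassPNearZero.inversion {c a₂ a₃ : ℂ} {p u w : ℂ → ℂ}
    (hp : IsWeierstrassPNearZero (4 * (3 * c ^ 2 - a₂)) (4 * (c * a₂ - 2 * c ^ 3 - a₃)) p)
    (hu : AnalyticAt ℂ u 0) (hu0 : u 0 = 0) (hw0 : w 0 = 1)
    (hud : ∀ᶠ s in 𝓝 (0 : ℂ), HasDerivAt u (w s) s)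
    (hw : ∀ᶠ s in 𝓝 (0 : ℂ), w s ^ 2 * sexticEval (3 * c) a₂ a₃ s = 1) :
    ∀ᶠ s in 𝓝[≠] (0 : ℂ), s ^ 2 * (p (u s) - c) = 1 := by
  obtain ⟨⟨N, hN, hN0, hpN⟩, hpd⟩ := hp
  have hu1 : HasDerivAt u 1 0 := hw0 ▸ hud.self_of_nhds
  have hut : Tendsto u (𝓝[≠] 0) (𝓝[≠] 0) := by
    have h1 : Tendsto u (𝓝[≠] 0) (𝓝 0) := by
      have := hu.continuousAt.tendsto.mono_left (nhdsWithin_le_nhds (s := {0}ᶜ))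
      rwa [hu0] at this
    exact tendsto_nhdsWithin_of_tendsto_nhds_of_eventually_within _ h1
      (hu1.eventually_ne one_ne_zero)
  set v := dslope u 0 with hv
  have hva : AnalyticAt ℂ v 0 := analyticAt_dslope hu
  have hv0 : v 0 = 1 := by rw [hv, dslope_same, hu1.deriv]
  have hsv : ∀ s, s * v s = u s := fun s => by
    have := sub_smul_dslope u 0 s
    simpa [hu0] using this
  set H : ℂ → ℂ := fun s => N (u s) / v s ^ 2 with hH
  have hHa : AnalyticAt ℂ H 0 := by
    have hNu : AnalyticAt ℂ (fun s => N (u s)) 0 := by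
      have hN' : AnalyticAt ℂ N (u 0) := by rwa [hu0]
      exact hN'.comp hu
    exact hNu.fun_div (hva.fun_pow 2) (by rw [hv0]; simp)
  have hH0 : H 0 = 1 := by simp [hH, hu0, hN0, hv0]
  have hHp : ∀ᶠ s in 𝓝[≠] (0 : ℂ), H s = s ^ 2 * p (u s) := by
    filter_upwards [hut.eventually hpN, hut.eventually self_mem_nhdsWithin, self_mem_nhdsWithin]
      with s hs hus hs0
    have hus : u s ≠ 0 := hus
    have hs0 : s ≠ 0 := hs0
    have hvs : v s ≠ 0 := fun h => hus (by rw [← hsv, h, mul_zero])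
    rw [hs, hH]
    simp only
    rw [← hsv s]
    field_simp
  have hode : ∀ᶠ s in 𝓝[≠] (0 : ℂ), (s * deriv H s - 2 * H s) ^ 2 * sexticEval (3 * c) a₂ a₃ s =
      4 * H s ^ 3 - 4 * (3 * c ^ 2 - a₂) * s ^ 4 * H s -
        4 * (c * a₂ - 2 * c ^ 3 - a₃) * s ^ 6 := by
    filter_upwards [hut.eventually hpd, hud.filter_mono nhdsWithin_le_nhds,
      hw.filter_mono nhdsWithin_le_nhds, eventually_eventually_nhdsWithin.mpr hHp, hHp,
      self_mem_nhdsWithin] with s hs hus hws hHs hHs' hs0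
    have hs0 : s ∈ ({0}ᶜ : Set ℂ) := hs0
    rw [isOpen_compl_singleton.nhdsWithin_eq hs0] at hHs
    obtain ⟨d, hd, hd2⟩ := hs
    have hder : deriv H s = (((2 : ℕ) : ℂ) * s ^ (2 - 1)) * p (u s) + s ^ 2 * (d * w s) := by
      have hHs2 : H =ᶠ[𝓝 s] fun s => s ^ 2 * p (u s) := hHs
      rw [hHs2.deriv_eq]
      exact ((hasDerivAt_pow 2 s).fun_mul (hd.comp s hus)).deriv
    rw [hder, hHs']
    push_cast
    linear_combination s ^ 6 * d ^ 2 * hws + s ^ 6 * hd2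
  have hqa : AnalyticAt ℂ (fun s : ℂ => 1 + c * s ^ 2) 0 := by fun_prop
  set e : ℂ → ℂ := fun s => H s - (1 + c * s ^ 2) with he
  have hea : AnalyticAt ℂ e 0 := hHa.fun_sub hqa
  -- As sq' − 2q = −2, subtracting the equations for H and q factors the left side as A · (se' − 2e)
  -- and the right side as a multiple of e. This is se'A = eK, with A(0) = −4 and K(0) = 4, and −4n
  -- = 4 has no solution in ℕ.
  set A : ℂ → ℂ := fun s => (s * deriv H s - 2 * H s - 2) * sexticEval (3 * c) a₂ a₃ s with hA
  set K : ℂ → ℂ := fun s => 4 * (H s ^ 2 + H s * (1 + c * s ^ 2) + (1 + c * s ^ 2) ^ 2) -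
    4 * (3 * c ^ 2 - a₂) * s ^ 4 + 2 * A s with hK
  have hAa : AnalyticAt ℂ A 0 := by
    have h1 := hHa.deriv
    have h2 : AnalyticAt ℂ (sexticEval (3 * c) a₂ a₃) 0 := by
      unfold sexticEval
      fun_prop
    fun_prop
  have hKa : AnalyticAt ℂ K 0 := by fun_prop
  have hA0 : A 0 = -4 := by
    simp only [hA, hH0, sexticEval]
    norm_num
  have hK0 : K 0 = 4 := by
    simp only [hK, hA0, hH0]
    norm_num
  have hzero := eventually_eq_zero_of_mul_deriv hea hAa.continuousAt hKa.continuousAt ?_ ?_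
  · filter_upwards [hzero.filter_mono nhdsWithin_le_nhds, hHp] with s hs hHs
    rw [he] at hs
    simp only [hHs] at hs
    linear_combination hs
  · have hHd := (hHa.eventually_analyticAt).filter_mono (nhdsWithin_le_nhds (s := {0}ᶜ))
    filter_upwards [hode, hHd] with s hs hHs
    have hde : deriv e s = deriv H s - c * (((2 : ℕ) : ℂ) * s ^ (2 - 1)) := by
      exact (hHs.differentiableAt.hasDerivAt.fun_sub
        (((hasDerivAt_pow 2 s).const_mul c).const_add 1)).deriv
    rw [hde]
    push_cast
    simp only [hK, hA, he]
    simp only [sexticEval] at hs ⊢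
    linear_combination hs
  · intro n hn
    rw [hA0, hK0] at hn
    have h1 : ((n + 1 : ℕ) : ℂ) = 0 := by
      push_cast
      linear_combination (-1 / 4 : ℂ) * hn
    exact Nat.cast_ne_zero.mpr (Nat.succ_ne_zero n) h1

theorem IsWeierstrassP.inversion {a₁ a₂ a₃ : ℂ} {p : ℂ → ℂ}
    (hp : IsWeierstrassP (invariant₂ a₁ a₂) (invariant₃ a₁ a₂ a₃) p) :
    ∀ᶠ s in 𝓝[≠] (0 : ℂ),
      s ^ 2 = 1 / (p (∫ r in (0 : ℝ)..1, s / (1 + a₁ * (r * s) ^ 2 + a₂ * (r * s) ^ 4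
        + a₃ * (r * s) ^ 6) ^ (1 / 2 : ℂ)) - a₁ / 3) := by
  obtain ⟨u, w, hu, hu0, hw0, hud, hw, hI⟩ := exists_integral_analyticAt a₁ a₂ a₃
  have h := hp.nearZero
  -- With c = a₁/3 the invariants take the denominator-free form used in the inversion.
  have e2 : invariant₂ a₁ a₂ = 4 * (3 * (a₁ / 3) ^ 2 - a₂) := by
    rw [invariant₂, Rat.smul_def]
    push_cast
    ring
  have e3 : invariant₃ a₁ a₂ a₃ = 4 * (a₁ / 3 * a₂ - 2 * (a₁ / 3) ^ 3 - a₃) := by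
    rw [invariant₃, Rat.smul_def, Rat.smul_def]
    push_cast
    ring
  rw [e2, e3] at h
  have e1 : 3 * (a₁ / 3) = a₁ := by ring
  filter_upwards [h.inversion hu hu0 hw0 hud (by rwa [e1]), hI.filter_mono nhdsWithin_le_nhds]
    with s hs hIs
  rw [hIs]
  exact eq_one_div_of_mul_eq_one_left hs

end Complex

end BuchstaberGenus

theorem theorem1 :
    -- Formal statements, over an arbitrary `ℚ`-algebra with parameters `a₁, a₂, a₃`.
    (∀ (R : Type u) [CommRing R] [Algebra ℚ R] (a₁ a₂ a₃ : R),
      -- (i) `x(u) = s(u)²`, for `s` the inverse of `∫₀ˢ dt / √(1 + a₁t² + a₂t⁴ + a₃t⁶)`.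
      (∃ s : PowerSeries R, AreCompInverse (abelianIntegral a₁ a₂ a₃) s ∧
        HahnSeries.ofPowerSeries ℤ R (s ^ 2) *
          (wpSeries (invariant₂ a₁ a₂) (invariant₃ a₁ a₂ a₃)
            - HahnSeries.C ((1 / 3 : ℚ) • a₁)) = 1) ∧
      -- (ii) the logarithm `B` and the exponential `E = B⁻¹` of the two-valued formal group
      (∃ B E : PowerSeries R,
        (∀ B' : PowerSeries R,
          IsTwoValuedLogarithm (buchstaberTwoValued a₁ a₂ a₃) B' ↔ B' = B) ∧
        B.subst (PowerSeries.X ^ 2 : PowerSeries R) = abelianIntegral a₁ a₂ a₃ ^ 2 ∧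
        AreCompInverse B E ∧
        HahnSeries.ofPowerSeries ℤ R (E.subst (PowerSeries.X ^ 2 : PowerSeries R)) *
          (wpSeries (invariant₂ a₁ a₂) (invariant₃ a₁ a₂ a₃)
            - HahnSeries.C ((1 / 3 : ℚ) • a₁)) = 1) ∧
      -- (iii) the law, its exponential and its logarithm
      (∃ F : FormalGroup R, F.IsComm ∧ F.toPowerSeries = lawBc a₁ a₂ a₃ ∧
        F.toPowerSeries ^ 2 *
          ((varU R * atV (sqrtSeries (seriesQ a₁ a₂ a₃))
              - varV R * atU (sqrtSeries (seriesQ a₁ a₂ a₃))) ^ 2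
            + MvPowerSeries.C a₃ * varU R ^ 2 * varV R ^ 2 * (varU R ^ 2 - varV R ^ 2) ^ 2)
          = (varU R ^ 2 - varV R ^ 2) ^ 2 ∧
        (∃ f : PowerSeries R, IsExponential F f ∧
          HahnSeries.ofPowerSeries ℤ R f ^ 2 *
            (wpSeries (invariant₂ a₁ a₂) (-invariant₃ a₁ a₂ a₃)
              + HahnSeries.C ((1 / 3 : ℚ) • a₁)) = 1) ∧
        IsLogarithm F (formalIntegral (invSqrt (seriesQ a₁ a₂ a₃)))) ∧
      -- (v) the intersection with the class of the laws in fraction form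
      (InKricheverClass (lawBc a₁ a₂ a₃) ↔ a₃ = 0) ∧
      (∀ F : FormalGroup R,
        ((InKricheverClass F.toPowerSeries ∧
            ∃ b₁ b₂ b₃ : R, F.toPowerSeries = lawBc b₁ b₂ b₃) ↔
          ∃ δ ε : R, IsOchanine F δ ε) ∧
        ((∃ δ ε : R, IsOchanine F δ ε) ↔
          ∃ l₂ : PowerSeries R, HasFractionForm F.toPowerSeries 1 l₂) ∧
        ((∃ δ ε : R, IsOchanine F δ ε) ↔
          ∃ b₁ b₂ : R, F.toPowerSeries = lawBc b₁ b₂ 0))) ∧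
    -- (i) for functions of a complex variable, with `s = √x` near `0`
    (∀ (a₁ a₂ a₃ : ℂ) (p : ℂ → ℂ),
      IsWeierstrassP (invariant₂ a₁ a₂) (invariant₃ a₁ a₂ a₃) p →
      ∀ᶠ s in 𝓝[≠] (0 : ℂ),
        s ^ 2 = 1 / (p (∫ r in (0 : ℝ)..1, s / (1 + a₁ * (r * s) ^ 2 + a₂ * (r * s) ^ 4
          + a₃ * (r * s) ^ 6) ^ (1 / 2 : ℂ)) - a₁ / 3)) ∧
    -- (iv) universality of the law over `ℤ[1/2, a₁, a₂, a₃]`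
    (∃ F : FormalGroup ParameterRing,
      F.toPowerSeries = lawBc (MvPolynomial.X 0) (MvPolynomial.X 1) (MvPolynomial.X 2) ∧
      F.IsComm ∧
      IsFormalInverse F (-PowerSeries.X) ∧
      IsModulusSquare F
        (buchstaberTwoValued (MvPolynomial.X 0) (MvPolynomial.X 1) (MvPolynomial.X 2)) ∧
      ∀ (S : Type u) [CommRing S], IsUnit (2 : S) →
        ∀ (H : FormalGroup S) (b₁ b₂ b₃ : S), H.IsComm →
          IsFormalInverse H (-PowerSeries.X) →
          IsModulusSquare H (buchstaberTwoValued b₁ b₂ b₃) →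
          ∃ φ : ParameterRing →+* S,
            φ (MvPolynomial.X 0) = b₁ ∧ φ (MvPolynomial.X 1) = b₂ ∧ φ (MvPolynomial.X 2) = b₃ ∧
            F.map φ = H ∧
            ∀ ψ : ParameterRing →+* S, F.map ψ = H → ψ = φ) := by
  refine ⟨fun R _ _ a₁ a₂ a₃ => ⟨?_, exists_twoValuedLogarithm a₁ a₂ a₃, ?_,
    inKricheverClass_lawBc_iff a₁ a₂ a₃, fun F => ⟨inKricheverClass_and_lawBc_iff F,
      exists_isOchanine_iff_hasFractionForm_one F, exists_isOchanine_iff_lawBc F⟩⟩,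
    fun a₁ a₂ a₃ p hp => hp.inversion, ?_⟩
  · obtain ⟨s, hs⟩ := exists_areCompInverse (constantCoeff_abelianIntegral a₁ a₂ a₃)
      (coeff_one_abelianIntegral a₁ a₂ a₃)
    exact ⟨s, hs, inverse_sq_mul_wpSeries hs⟩
  · obtain ⟨F, hF, hc, hg⟩ := exists_formalGroup_lawBc a₁ a₂ a₃
    exact ⟨F, hc, hF, hF ▸ lawBc_sq isUnit_two a₁ a₂ a₃, exists_isExponential_lawBc hg, hg⟩
  · obtain ⟨F, hF, hc⟩ := exists_universal_lawBc
    have hi := isFormalInverse_lawBc hF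
    exact ⟨F, hF, hc, hi, ⟨_, hi, isModulusSquareWith_lawBc isUnit_two_parameterRing hF⟩,
      fun S _ h2 H b₁ b₂ b₃ _ hH hm => existsUnique_hom_of_isModulusSquare hF h2 hH hm⟩
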